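/- Let $q_0,q_1,q_2$ be the vertices of an equilateral triangle in the plane (indices mod $3$), $F_i(x)=\tfrac12(x-q_i)+q_i$, and let $SG$ be the Sierpinski gasket, the attractor of $F_0,F_1,F_2$. Let $\mu$ be the probability measure on $SG$ that gives mass $3^{-m}$ to each cell $F_w(SG)$ of level $m=|w|$, where $F_w=F_{w_1}\circ\dots\circ F_{w_m}$. Put $\langle u,v\rangle=\int_{SG}uv\,d\mu$ and $\|u\|=\langle u,u\rangle^{1/2}$. Let $V_0=\{q_0,q_1,q_2\}$, $V_{m+1}=\bigcup_iF_iV_m$, and write $x\sim_m y$ if $x\ne y$ are points of $V_m$ in a common cell of level $m$. For continuous $u,f$ on $SG$ write $\Delta u=f$ if $\tfrac32 5^m\sum_{y\sim_m x}(u(y)-u(x))\to f(x)$ as $m\to\infty$, uniformly over $x\in V_m\setminus V_0$. Put $$\partial_nu(q_i)=\lim_{m\to\infty}\left(\tfrac53\right)^m\bigl(2u(q_i)-u(F_i^mq_{i+1})-u(F_i^mq_{i-1})\bigr),\qquad \partial_Tu(q_i)=\lim_{m\to\infty}5^m\bigl(u(F_i^mq_{i+1})-u(F_i^mq_{i-1})\bigr).$$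 For $n\in\{0,1,2\}$, $i\in\{1,2,3\}$ and $j\ge0$ let $P_{ji}^{(n)}$ be the solution of $\Delta^{j+1}P=0$ on $SG$ such that, for $0\le m\le j$, $$\Delta^mP(q_n)=\delta_{mj}\delta_{i1},\qquad \partial_n\Delta^mP(q_n)=\delta_{mj}\delta_{i2},\qquad \partial_T\Delta^mP(q_n)=\delta_{mj}\delta_{i3}.$$ Fix $n$ and $i$, and let $p_0,p_1,\dots$ be obtained from $P_{0i}^{(n)},P_{1i}^{(n)},\dots$ by the Gram-Schmidt process without normalization, $$p_j=P_{ji}^{(n)}-\sum_{l<j}d_l^2\,\langle P_{ji}^{(n)},p_l\rangle\,p_l,\qquad d_l^{-1}=\|p_l\|.$$ Let $G$ be Green's function of $-\Delta$ on $SG$ with zero boundary values on $V_0$, that is $$G(x,y)=\lim_{M\to\infty}\sum_{m=0}^{M}\ \sum_{z,z'\in V_{m+1}\setminus V_m}g(z,z')\,\psi_z^{(m+1)}(x)\,\psi_{z'}^{(m+1)}(y),$$ where $g(z,z)=\tfrac9{50}(\tfrac35)^m$, $g(z,z')=\tfrac3{50}(\tfrac35)^m$ if $z\sim_{m+1}z'$,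 $g(z,z')=0$ otherwise, and $\psi_z^{(m)}$ is the continuous function on $SG$ that is harmonic on each cell of level $m$ (that is, $\Delta(\psi_z^{(m)}\circ F_w)=0$ for $|w|=m$), equals $1$ at $z$ and vanishes on $V_m\setminus\{z\}$. Put $\|G\|_{L^2}=\left(\iint_{SG\times SG}G(x,y)^2\,d\mu(x)\,d\mu(y)\right)^{1/2}$, $f_{k+1}(x)=-\int_{SG}G(x,y)\,p_k(y)\,d\mu(y)$, and define the recursion coefficients by $$b_k=d_k^2\,\langle f_{k+1},p_k\rangle\quad(k\ge0),\qquad c_k=\frac{d_{k-1}^2}{d_k^2}=\frac{\|p_k\|^2}{\|p_{k-1}\|^2}\quad(k\ge1).$$ Then 1. $-\|G\|_{L^2}\le b_k<0$ for all $k\ge0$; 2. $0<c_k\le\|G\|_{L^2}^2$ for all $k\ge1$; 3. $d_{k+1}^{-1}\le\|G\|_{L^2}\,d_k^{-1}$ for all $k\ge0$; 4. $\|p_k\|\le\|p_0\|\,\|G\|_{L^2}^k$ for all $k\ge0$, and $\|G\|_{L^2}<1$, so that $\|p_k\|$ decays exponentially. -/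

import Mathlib

open MeasureTheory Filter Topology

namespace SierpinskiGasket

noncomputable section

/-- The Euclidean plane. -/
abbrev Plane : Type := EuclideanSpace ℝ (Fin 2)

/-- The vertices `q₀, q₁, q₂` of an equilateral triangle (of side length `1`). -/
def corner : Fin 3 → Plane :=
  ![!₂[0, 0], !₂[1, 0], !₂[1 / 2, Real.sqrt 3 / 2]]

/-- The contractions `F_i x = (x - q_i) / 2 + q_i` of the plane. -/
def planeMap (i : Fin 3) (x : Plane) : Plane := (1 / 2 : ℝ) • (x - corner i) + corner i

/-- The point with address `w`, that is the limit of `F_{w 0} ∘ F_{w 1} ∘ ⋯ ∘ F_{w m} x` as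
`m → ∞` (for any `x`), written as a series. -/
def address (w : ℕ → Fin 3) : Plane := ∑' k : ℕ, ((1 / 2 : ℝ) ^ (k + 1)) • corner (w k)

/-- The Sierpinski gasket, the attractor of `F₀, F₁, F₂` (see `gasket_nonempty`,
`gasket_isCompact`, `gasket_selfSimilar`), as the set of all points that have an address. -/
def gasket : Set Plane := Set.range address

theorem address_bound (i : Fin 3) (k : ℕ) :
    ‖((1 / 2 : ℝ) ^ (k + 1)) • corner i‖ ≤ (1 / 2 : ℝ) ^ k * ∑ j : Fin 3, ‖corner j‖ := by
  have h1 : ‖corner i‖ ≤ ∑ j : Fin 3, ‖corner j‖ :=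
    Finset.single_le_sum (f := fun j => ‖corner j‖) (fun j _ => norm_nonneg _) (Finset.mem_univ i)
  rw [norm_smul, Real.norm_of_nonneg (by positivity)]
  refine mul_le_mul ?_ h1 (norm_nonneg _) (by positivity)
  exact pow_le_pow_of_le_one (by norm_num) (by norm_num) (Nat.le_succ k)

theorem summable_bound :
    Summable fun k : ℕ => (1 / 2 : ℝ) ^ k * ∑ j : Fin 3, ‖corner j‖ :=
  (summable_geometric_of_lt_one (by norm_num) (by norm_num)).mul_right _

theorem address_summable (w : ℕ → Fin 3) :
    Summable fun k : ℕ => ((1 / 2 : ℝ) ^ (k + 1)) • corner (w k) :=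
  Summable.of_norm_bounded summable_bound fun k => address_bound (w k) k

theorem address_continuous : Continuous address := by
  have h : ∀ k : ℕ, Continuous fun w : ℕ → Fin 3 => ((1 / 2 : ℝ) ^ (k + 1)) • corner (w k) :=
    fun k => (continuous_of_discreteTopology
      (f := fun i : Fin 3 => ((1 / 2 : ℝ) ^ (k + 1)) • corner i)).comp (continuous_apply k)
  exact continuous_tsum h summable_bound fun k w => address_bound (w k) k

theorem planeMap_address (i : Fin 3) (w : ℕ → Fin 3) :
    planeMap i (address w) = address (fun k => Nat.casesOn k i w) := by
  unfold address planeMap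
  rw [(address_summable (fun k => Nat.casesOn k i w)).tsum_eq_zero_add, smul_sub,
    ← (address_summable w).tsum_const_smul]
  simp only [smul_smul, pow_succ, pow_zero, one_mul]
  have h : ∀ k : ℕ, (1 / 2 : ℝ) * ((1 / 2) ^ k * (1 / 2)) = (1 / 2) ^ k * (1 / 2) * (1 / 2) :=
    fun k => by ring
  simp only [h]
  have e : corner i = (1 / 2 : ℝ) • corner i + (1 / 2 : ℝ) • corner i := by
    rw [← add_smul]; norm_num
  nth_rewrite 2 [e]
  abel

theorem planeMap_mem (i : Fin 3) {x : Plane} (hx : x ∈ gasket) : planeMap i x ∈ gasket := by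
  obtain ⟨w, rfl⟩ := hx
  exact ⟨_, (planeMap_address i w).symm⟩

theorem corner_mem (i : Fin 3) : corner i ∈ gasket := by
  refine ⟨fun _ => i, ?_⟩
  have h : HasSum (fun k : ℕ => (1 / 2 : ℝ) ^ (k + 1)) 1 := by
    have h0 := (hasSum_geometric_of_lt_one (r := (1 / 2 : ℝ)) (by norm_num) (by norm_num)).mul_right
      (1 / 2 : ℝ)
    norm_num at h0
    simpa [pow_succ] using h0
  have h2 := (h.smul_const (corner i)).tsum_eq
  rw [one_smul] at h2
  exact h2

theorem gasket_nonempty : gasket.Nonempty := ⟨_, corner_mem 0⟩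

theorem gasket_isCompact : IsCompact gasket := isCompact_range address_continuous

theorem gasket_selfSimilar : gasket = ⋃ i : Fin 3, planeMap i '' gasket := by
  ext x
  simp only [Set.mem_iUnion, Set.mem_image]
  constructor
  · rintro ⟨w, rfl⟩
    refine ⟨w 0, address (fun k => w (k + 1)), ⟨_, rfl⟩, ?_⟩
    rw [planeMap_address]
    congr 1
    funext k
    cases k <;> rfl
  · rintro ⟨i, y, hy, rfl⟩
    exact planeMap_mem i hy

/-- The boundary points `q_i`, as points of the gasket. -/
def q (i : Fin 3) : gasket := ⟨corner i, corner_mem i⟩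

/-- The contractions `F_i` as self-maps of the gasket. -/
def F (i : Fin 3) (x : gasket) : gasket := ⟨planeMap i x, planeMap_mem i x.2⟩

/-- `F_w = F_{w₁} ∘ ⋯ ∘ F_{w_m}` for a word `w = (w₁, …, w_m)`; the range of `F_w` is a cell of
level `m = |w|`. -/
def wordMap : List (Fin 3) → gasket → gasket
  | [] => id
  | i :: w => F i ∘ wordMap w

/-- The natural measure on the gasket: the law of the point whose address is a sequence of
independent uniformly distributed letters. It is the probability measure which gives each cell of
level `m` the mass `3 ^ (-m)`. -/
def μ : Measure gasket :=
  (Measure.infinitePi fun _ : ℕ => (PMF.uniformOfFintype (Fin 3)).toMeasure).map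
    fun w => (⟨address w, w, rfl⟩ : gasket)

theorem point_measurable :
    Measurable fun w : ℕ → Fin 3 => (⟨address w, w, rfl⟩ : gasket) :=
  (address_continuous.measurable).subtype_mk

instance : IsProbabilityMeasure μ :=
  Measure.isProbabilityMeasure_map point_measurable.aemeasurable

/-! ### Graph approximations and the Laplacian -/

open Classical in
/-- The vertices `V_m`: `V_0 = {q₀, q₁, q₂}` and `V_{m+1} = ⋃ i, F_i V_m`. -/
def V : ℕ → Finset gasket
  | 0 => Finset.univ.image q
  | m + 1 => Finset.univ.biUnion fun i => (V m).image (F i)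

/-- The edge relation of `Γ_m`: `x` and `y` are distinct vertices of a common cell of level `m`. -/
def Adj (m : ℕ) (x y : gasket) : Prop :=
  x ≠ y ∧ ∃ w : List (Fin 3), w.length = m ∧
    (∃ i, x = wordMap w (q i)) ∧ (∃ j, y = wordMap w (q j))

open Classical in
/-- The graph Laplacian `Δ_m u (x) = ∑_{y ∼_m x} (u y - u x)`. -/
def graphLaplacian (m : ℕ) (u : gasket → ℝ) (x : gasket) : ℝ :=
  ∑ y ∈ V m with Adj m x y, (u y - u x)

/-- `Δ u = f`: both functions are continuous on the gasket, and `(3/2) 5^m Δ_m u → f` as `m → ∞`,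
uniformly over the vertices off the boundary at which `Δ_m` is defined. -/
def HasLaplacian (u f : gasket → ℝ) : Prop :=
  Continuous u ∧ Continuous f ∧
    ∀ ε > 0, ∃ M : ℕ, ∀ m ≥ M, ∀ x ∈ V m, x ∉ V 0 →
      |(3 / 2 : ℝ) * 5 ^ m * graphLaplacian m u x - f x| < ε

/-- `Δ^m u = f`. -/
def HasLaplacianPow : ℕ → (gasket → ℝ) → (gasket → ℝ) → Prop
  | 0, u, f => u = f
  | m + 1, u, f => ∃ v, HasLaplacian u v ∧ HasLaplacianPow m v f

/-- The normal derivative `∂_n u (q_i)` exists and equals `a`. -/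
def HasNormalDeriv (u : gasket → ℝ) (i : Fin 3) (a : ℝ) : Prop :=
  Tendsto (fun m : ℕ => (5 / 3 : ℝ) ^ m *
    (2 * u (q i) - u ((F i)^[m] (q (i + 1))) - u ((F i)^[m] (q (i - 1))))) atTop (𝓝 a)

/-- The tangential derivative `∂_T u (q_i)` exists and equals `a`. -/
def HasTangentialDeriv (u : gasket → ℝ) (i : Fin 3) (a : ℝ) : Prop :=
  Tendsto (fun m : ℕ => (5 : ℝ) ^ m *
    (u ((F i)^[m] (q (i + 1))) - u ((F i)^[m] (q (i - 1))))) atTop (𝓝 a)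

/-! ### Monomials -/

/-- The space `ℋ^j` of polynomials of degree at most `j`: the solutions of `Δ^{j+1} u = 0`. -/
def IsPolynomial (j : ℕ) (u : gasket → ℝ) : Prop := HasLaplacianPow (j + 1) u 0

/-- The conditions that define the monomial `P_{ji}^{(n)}` (`i = 1, 2, 3`): it lies in `ℋ^j`, and for
`0 ≤ m ≤ j` the value, the normal derivative and the tangential derivative of `Δ^m u` at `q_n` are
`δ_{mj} δ_{i1}`, `δ_{mj} δ_{i2}` and `δ_{mj} δ_{i3}`. -/
def IsMonomial (n : Fin 3) (i j : ℕ) (u : gasket → ℝ) : Prop :=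
  IsPolynomial j u ∧ ∀ m ≤ j, ∃ v, HasLaplacianPow m u v ∧
    v (q n) = (if m = j ∧ i = 1 then 1 else 0) ∧
    HasNormalDeriv v n (if m = j ∧ i = 2 then 1 else 0) ∧
    HasTangentialDeriv v n (if m = j ∧ i = 3 then 1 else 0)

/-- The monomial `P_{ji}^{(n)}`, the function that satisfies `IsMonomial n i j`. -/
def monomial (n : Fin 3) (i j : ℕ) : gasket → ℝ := Classical.epsilon (IsMonomial n i j)

/-! ### Green's function -/

open Classical in
/-- The conditions that define the spline `ψ_z^{(m)}`: it is continuous, equals `δ_{zx}` at the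
vertices `x` in `V_m`, and is harmonic on each cell of level `m`. -/
def IsSpline (m : ℕ) (z : gasket) (ψ : gasket → ℝ) : Prop :=
  Continuous ψ ∧ (∀ x ∈ V m, ψ x = if x = z then 1 else 0) ∧
    ∀ w : List (Fin 3), w.length = m → HasLaplacian (ψ ∘ wordMap w) 0

/-- The piecewise harmonic function `ψ_z^{(m)}`. -/
def spline (m : ℕ) (z : gasket) : gasket → ℝ := Classical.epsilon (IsSpline m z)

open Classical in
/-- The coefficients `g(z, z')` for `z, z'` in `V_{m+1} \ V_m`. -/
def greenCoeff (m : ℕ) (z z' : gasket) : ℝ :=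
  if z = z' then 9 / 50 * (3 / 5 : ℝ) ^ m
  else if Adj (m + 1) z z' then 3 / 50 * (3 / 5 : ℝ) ^ m
  else 0

open Classical in
/-- The partial sums `G_M`. -/
def greenPartial (M : ℕ) (x y : gasket) : ℝ :=
  ∑ m ∈ Finset.range (M + 1), ∑ z ∈ V (m + 1) \ V m, ∑ z' ∈ V (m + 1) \ V m,
    greenCoeff m z z' * spline (m + 1) z x * spline (m + 1) z' y

/-- Green's function `G(x, y) = lim_{M → ∞} G_M(x, y)`. -/
def green (x y : gasket) : ℝ := limUnder atTop fun M : ℕ => greenPartial M x y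

/-- `‖G‖_{L²} = (∬ G(x, y)² dμ(x) dμ(y))^{1/2}`. -/
def greenNorm : ℝ := Real.sqrt (∫ z : gasket × gasket, green z.1 z.2 ^ 2 ∂(μ.prod μ))

/-! ### Orthogonal polynomials -/

/-- The inner product of `L²(μ)`. -/
def ip (u v : gasket → ℝ) : ℝ := ∫ x, u x * v x ∂μ

/-- The norm of `L²(μ)`. -/
def l2norm (u : gasket → ℝ) : ℝ := Real.sqrt (ip u u)

/-- The (not normalized) Gram-Schmidt process in `L²(μ)`:
`p_j = P_j - ∑_{l < j} ‖p_l‖^{-2} ⟨P_j, p_l⟩ p_l`. -/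
def gramSchmidt (P : ℕ → gasket → ℝ) (j : ℕ) : gasket → ℝ :=
  P j - ∑ l : Fin j,
    ((l2norm (gramSchmidt P l))⁻¹ ^ 2 * ip (P j) (gramSchmidt P l)) • gramSchmidt P l
termination_by j
decreasing_by exact l.2

/-- The orthogonal polynomials `p_j` made from the monomials `P_{ji}^{(n)}`, `j ≥ 0`. -/
def p (n : Fin 3) (i : ℕ) : ℕ → gasket → ℝ := gramSchmidt (monomial n i)

/-- `d_k = ‖p_k‖^{-1}`. -/
def d (n : Fin 3) (i k : ℕ) : ℝ := (l2norm (p n i k))⁻¹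

/-- `fNext n i k` is `f_{k+1}(x) = -∫ G(x, y) p_k(y) dμ(y)`. -/
def fNext (n : Fin 3) (i k : ℕ) (x : gasket) : ℝ := -∫ y, green x y * p n i k y ∂μ

/-- The recursion coefficient `b_k = d_k² ⟨f_{k+1}, p_k⟩`. -/
def b (n : Fin 3) (i k : ℕ) : ℝ := d n i k ^ 2 * ip (fNext n i k) (p n i k)

/-- The recursion coefficient `c_k = d_{k-1}² / d_k²`, meaningful for `k ≥ 1` only. -/
def c (n : Fin 3) (i k : ℕ) : ℝ := d n i (k - 1) ^ 2 / d n i k ^ 2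

end

end SierpinskiGasket

/-!
Everything is reduced to the three maps `F_i` by self-similarity. The crucial inequality is
`‖p_{k+1}‖ ≤ ‖G‖ ‖p_k‖` (`l2norm_p_succ_le`); it is the third part of the theorem, and the second
and fourth follow from it, since `p_k ≠ 0` and `0 ≤ G ≤ 9 / 20`, so that `‖G‖ < 1`.

*Green's operator.* Let `𝒢 f = ∫ G(·, y) f(y) dμ(y)` (`greenOp`). The series for `G` gives
`G(F_i x, F_j y) = G₀(F_i x, F_j y) + δ_{ij} (3 / 5) G(x, y)`, where `G₀` is the first term, so that
`(𝒢 f) ∘ F_i` is a harmonic function plus `(1 / 5) 𝒢 (f ∘ F_i)` (`greenOp_F`). By induction on the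
level, the renormalized graph Laplacians of `-𝒢 f` differ from `f` by no more than the oscillation
of `f` on cells (`graphLaplacian_greenOp_close`), hence `Δ (-𝒢 f) = f`. The maximum principle, with
`-𝒢 1` as a barrier, gives uniqueness for the Dirichlet problem, and every solution of `Δ u = f` is
`-𝒢 f` plus a harmonic function (`HasLaplacian.eq_greenOp`). The same recursion for the
quadratic form `⟨𝒢 f, f⟩` shows that it is strictly positive (`greenForm_pos`). As
`b_k = -⟨𝒢 p_k, p_k⟩ / ‖p_k‖²`, this and the Cauchy-Schwarz inequality give the first part of the
theorem (`b_bounds`).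

*Monomials.* The monomial `P_{ji}^{(n)}` is constructed from `-𝒢 P_{j-1,i}^{(n)}` by adding the
harmonic function that makes it an eigenfunction of composition with `F_n`, with eigenvalue
`5^{-j}` times that of `P_{0i}^{(n)}`, namely `1`, `3 / 5` or `1 / 5` (`mono_symm`). The eigenvalue
determines value and derivatives at `q_n`, and a harmonic function is determined by its value and
its two derivatives at `q_n`, so that these are the monomials (`monomial_eq`).

*The inequality.* Since `p_{k+1}` has minimal norm in `P_{k+1} + span(P_0, …, P_k)`
(`gsC_minimal`), it suffices to find there an element of norm at most `‖G‖ ‖p_k‖`. This set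
contains an antiderivative `v` of `p_k` that vanishes at `q_n`, has normal derivative zero there,
and has the parity of the monomials (`exists_antideriv`). Then `v + 𝒢 p_k` is harmonic with the same
value at `q_n` and the same parity.

For `i = 2, 3` this makes it a multiple of `P_0`, so that `-𝒢 p_k` lies in the set, and the bound is
that of an operator by the Hilbert-Schmidt norm of its kernel.

For `i = 1` it is a multiple of `1 - h`, where `h` is the harmonic function that is `1` at `q_n` and
`0` at the other two boundary points, and the normal derivative of `𝒢 p_k` gives the multiple:
`v = -𝒢 p_k + ½ ⟨h, p_k⟩ (1 - h)`. Here `P_0 = 1`, so constants may be added to `v`. For `k ≥ 1`,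
`p_k` has mean zero, and up to a constant `v` is minus the integral of `p_k` against the kernel
`G(x, y) + ½ h̃(x) h̃(y) - 1 / 18`, where `h̃ = h - 1 / 3` (`neumannKernel`). The mean of `G` being
`1 / 18`, subtracting it from the kernel lowers the square of the norm, and this outweighs the
contribution of the rank one summand (`prodL_neumannKernel_sq`). For `k = 0` explicit integrals
suffice (`norm_one_le_of_eq_one`).
-/

namespace SierpinskiGasket

noncomputable section

/-! ### Barycentric coordinates and the cell structure -/

instance : CompactSpace gasket := isCompact_iff_compactSpace.mp gasket_isCompact

instance : Nonempty gasket := ⟨q 0⟩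

/-- The barycentric coordinates of a point of the plane with respect to `q₀, q₁, q₂`. -/
def bary (i : Fin 3) (x : Plane) : ℝ :=
  ![1 - x 0 - x 1 / Real.sqrt 3, x 0 - x 1 / Real.sqrt 3, 2 * x 1 / Real.sqrt 3] i

theorem bary_sum (x : Plane) : bary 0 x + bary 1 x + bary 2 x = 1 := by
  simp [bary]; ring

theorem bary_corner (i j : Fin 3) : bary i (corner j) = if i = j then 1 else 0 := by
  have h : Real.sqrt 3 ≠ 0 := by positivity
  fin_cases i <;> fin_cases j <;> simp [bary, corner] <;> field_simp <;> norm_num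

theorem bary_planeMap (i j : Fin 3) (x : Plane) :
    bary i (planeMap j x) = (bary i x + if i = j then 1 else 0) / 2 := by
  rw [← bary_corner i j]
  fin_cases i <;> simp [bary, planeMap] <;> ring

theorem bary_ext {x y : Plane} (h : ∀ i, bary i x = bary i y) : x = y := by
  have h3 : Real.sqrt 3 ≠ 0 := by positivity
  have h2 := h 2
  have h1 := h 1
  simp only [bary, Matrix.cons_val] at h1 h2
  have e : x 1 / Real.sqrt 3 = y 1 / Real.sqrt 3 := by
    rw [mul_div_assoc, mul_div_assoc] at h2; linarith
  ext i
  fin_cases i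
  · simp only [Fin.zero_eta]; linarith
  · simpa [div_left_inj' h3] using e

theorem bary_continuous (i : Fin 3) : Continuous (bary i) := by
  unfold bary
  fin_cases i <;> simp <;> fun_prop

theorem F_continuous (i : Fin 3) : Continuous (F i) := by
  unfold F planeMap
  fun_prop

theorem exists_F (x : gasket) : ∃ i y, F i y = x := by
  have h : (x : Plane) ∈ ⋃ i : Fin 3, planeMap i '' gasket :=
    (Set.ext_iff.mp gasket_selfSimilar _).mp x.2
  simp only [Set.mem_iUnion, Set.mem_image] at h
  obtain ⟨i, y, hy, e⟩ := h
  exact ⟨i, ⟨y, hy⟩, Subtype.ext e⟩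

theorem bary_F (i j : Fin 3) (x : gasket) :
    bary i (F j x) = (bary i x + if i = j then 1 else 0) / 2 := bary_planeMap i j x

theorem bary_q (i j : Fin 3) : bary i (q j) = if i = j then 1 else 0 := bary_corner i j

theorem gasket_ext {x y : gasket} (h : ∀ i, bary i x = bary i y) : x = y :=
  Subtype.ext (bary_ext h)

/-- The minimum of a barycentric coordinate over the gasket is at least half of itself, by
self-similarity. -/
theorem bary_nonneg (i : Fin 3) (x : gasket) : 0 ≤ bary i x := by
  obtain ⟨m, -, hm⟩ := isCompact_univ.exists_isMinOn (Set.univ_nonempty (α := gasket))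
    ((bary_continuous i).comp continuous_subtype_val).continuousOn
  have hmin : ∀ z : gasket, bary i m ≤ bary i z := fun z => hm (Set.mem_univ z)
  obtain ⟨j, y, rfl⟩ := exists_F m
  have h1 := hmin y
  have h2 := hmin x
  rw [bary_F] at h1 h2
  split_ifs at h1 h2 <;> linarith

theorem bary_le_one (i : Fin 3) (x : gasket) : bary i x ≤ 1 := by
  have h := bary_sum x
  have h0 := bary_nonneg 0 x
  have h1 := bary_nonneg 1 x
  have h2 := bary_nonneg 2 x
  fin_cases i <;> simp only [Fin.zero_eta, Fin.mk_one, Fin.reduceFinMk] <;> linarith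

theorem eq_q_of_bary {i : Fin 3} {x : gasket} (hx : bary i x = 1) : x = q i := by
  have h := bary_sum x
  have h0 := bary_nonneg 0 x
  have h1 := bary_nonneg 1 x
  have h2 := bary_nonneg 2 x
  apply gasket_ext
  intro j
  rw [bary_q]
  fin_cases i <;> fin_cases j <;> simp at hx ⊢ <;> linarith

theorem q_injective : Function.Injective q := by
  intro i j h
  have := bary_q i i
  rw [h, bary_q] at this
  by_contra hne
  simp [hne] at this

@[simp] theorem q_inj {i j : Fin 3} : q i = q j ↔ i = j := q_injective.eq_iff

theorem F_injective (i : Fin 3) : Function.Injective (F i) := by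
  intro x y h
  apply gasket_ext
  intro j
  have h1 := bary_F j i x
  rw [h, bary_F] at h1
  linarith

@[simp] theorem F_inj {i : Fin 3} {x y : gasket} : F i x = F i y ↔ x = y := (F_injective i).eq_iff

@[simp] theorem F_q_self (i : Fin 3) : F i (q i) = q i := by
  apply gasket_ext
  intro j
  rw [bary_F, bary_q]
  split_ifs <;> norm_num

theorem F_q_comm (i j : Fin 3) : F i (q j) = F j (q i) := by
  apply gasket_ext
  intro k
  rw [bary_F, bary_F, bary_q, bary_q]
  ring

/-- Two cells of level `1` meet in a single point only. -/
theorem eq_q_of_F_eq {i j : Fin 3} {x y : gasket} (hij : i ≠ j) (h : F i x = F j y) :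
    x = q j ∧ y = q i := by
  have h1 := bary_F i i x
  have h2 := bary_F j i x
  rw [h, bary_F] at h1 h2
  have hi := bary_le_one i y
  have hj := bary_le_one j x
  have hi' := bary_nonneg i x
  have hj' := bary_nonneg j y
  rw [if_neg hij, if_pos rfl] at h1
  rw [if_pos rfl, if_neg hij.symm] at h2
  exact ⟨eq_q_of_bary (by linarith), eq_q_of_bary (by linarith)⟩

theorem F_eq_q {i j : Fin 3} {x : gasket} (h : F i x = q j) : i = j ∧ x = q j := by
  rw [← F_q_self j] at h
  by_cases hij : i = j
  · subst hij
    exact ⟨rfl, F_injective _ h⟩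
  · obtain ⟨-, h2⟩ := eq_q_of_F_eq hij h
    exact absurd (q_injective h2).symm hij

/-- The function on the gasket that equals `v i ∘ (F i)⁻¹` on the cell `F_i(SG)`. -/
def glue (v : Fin 3 → gasket → ℝ) (x : gasket) : ℝ :=
  v (exists_F x).choose (exists_F x).choose_spec.choose

theorem glue_F {v : Fin 3 → gasket → ℝ} (hv : ∀ i j, v i (q j) = v j (q i)) (i : Fin 3)
    (x : gasket) : glue v (F i x) = v i x := by
  unfold glue
  have h := (exists_F (F i x)).choose_spec.choose_spec
  generalize (exists_F (F i x)).choose_spec.choose = y at h ⊢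
  generalize (exists_F (F i x)).choose = j at h ⊢
  by_cases hij : j = i
  · subst hij
    rw [F_injective _ h]
  · obtain ⟨rfl, rfl⟩ := eq_q_of_F_eq hij h
    exact hv _ _

theorem continuous_of_comp_F {u : gasket → ℝ} (h : ∀ i, Continuous (u ∘ F i)) : Continuous u := by
  rw [continuous_iff_isClosed]
  intro C hC
  have e : u ⁻¹' C = ⋃ i, F i '' ((u ∘ F i) ⁻¹' C) := by
    ext x
    simp only [Set.mem_preimage, Set.mem_iUnion, Set.mem_image, Function.comp]
    constructor
    · intro hx
      obtain ⟨i, y, rfl⟩ := exists_F x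
      exact ⟨i, y, hx, rfl⟩
    · rintro ⟨i, y, hy, rfl⟩
      exact hy
  rw [e]
  exact isClosed_iUnion_of_finite fun i =>
    (F_continuous i).isClosedMap _ (hC.preimage (h i))

theorem wordMap_cons (i : Fin 3) (w : List (Fin 3)) (x : gasket) :
    wordMap (i :: w) x = F i (wordMap w x) := rfl

theorem wordMap_continuous (w : List (Fin 3)) : Continuous (wordMap w) := by
  induction w with
  | nil => exact continuous_id
  | cons i w ih => exact (F_continuous i).comp ih

theorem exists_wordMap (m : ℕ) (x : gasket) : ∃ w : List (Fin 3), w.length = m ∧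
    ∃ y, wordMap w y = x := by
  induction m generalizing x with
  | zero => exact ⟨[], rfl, x, rfl⟩
  | succ m ih =>
    obtain ⟨i, y, rfl⟩ := exists_F x
    obtain ⟨w, rfl, z, rfl⟩ := ih y
    exact ⟨i :: w, rfl, z, rfl⟩

theorem dist_wordMap (w : List (Fin 3)) (x y : gasket) :
    dist (wordMap w x) (wordMap w y) = (1 / 2) ^ w.length * dist x y := by
  induction w with
  | nil => simp [wordMap]
  | cons i w ih =>
    have h : ∀ a b : gasket, dist (F i a) (F i b) = 1 / 2 * dist a b := by
      intro a b
      simp only [F, Subtype.dist_eq, planeMap, dist_add_right, dist_smul₀, dist_sub_right]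
      norm_num
    rw [wordMap_cons, wordMap_cons, h, ih, List.length_cons, pow_succ]
    ring

/-- A continuous function has small oscillation on cells of high level. -/
theorem exists_osc_lt {f : gasket → ℝ} (hf : Continuous f) {ε : ℝ} (hε : 0 < ε) :
    ∃ M : ℕ, ∀ m ≥ M, ∀ w : List (Fin 3), w.length = m → ∀ x y,
      |f (wordMap w x) - f (wordMap w y)| < ε := by
  have huc := CompactSpace.uniformContinuous_of_continuous hf
  obtain ⟨δ, hδ, h⟩ := Metric.uniformContinuous_iff.mp huc ε hε
  obtain ⟨D, hD⟩ := (Metric.isBounded_iff.mp (isCompact_univ (X := gasket)).isBounded)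
  have hD0 : 0 ≤ D := dist_nonneg.trans (hD (Set.mem_univ (q 0)) (Set.mem_univ (q 1)))
  have hlim : Tendsto (fun m : ℕ => (1 / 2 : ℝ) ^ m * D) atTop (𝓝 (0 * D)) :=
    (tendsto_pow_atTop_nhds_zero_of_lt_one (by norm_num) (by norm_num)).mul_const D
  rw [zero_mul] at hlim
  obtain ⟨M, hM⟩ := eventually_atTop.mp (hlim.eventually (gt_mem_nhds hδ))
  refine ⟨M, fun m hm w hw x y => ?_⟩
  have h1 : dist (wordMap w x) (wordMap w y) < δ := by
    rw [dist_wordMap, hw]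
    exact lt_of_le_of_lt (mul_le_mul_of_nonneg_left (hD (Set.mem_univ x) (Set.mem_univ y))
      (by positivity)) (hM m hm)
  exact h h1

/-! ### Vertices -/

theorem mem_V_zero {x : gasket} : x ∈ V 0 ↔ ∃ i, x = q i := by
  simp [V, eq_comm]

@[simp] theorem q_mem_V_zero (i : Fin 3) : q i ∈ V 0 := mem_V_zero.mpr ⟨i, rfl⟩

theorem mem_V_succ {m : ℕ} {x : gasket} : x ∈ V (m + 1) ↔ ∃ i, ∃ y ∈ V m, F i y = x := by
  simp [V]

theorem F_mem_V {m : ℕ} {x : gasket} (hx : x ∈ V m) (i : Fin 3) : F i x ∈ V (m + 1) :=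
  mem_V_succ.mpr ⟨i, x, hx, rfl⟩

theorem V_subset_succ (m : ℕ) : V m ⊆ V (m + 1) := by
  induction m with
  | zero =>
    intro x hx
    obtain ⟨i, rfl⟩ := mem_V_zero.mp hx
    exact mem_V_succ.mpr ⟨i, q i, hx, F_q_self i⟩
  | succ m ih =>
    intro x hx
    obtain ⟨i, y, hy, rfl⟩ := mem_V_succ.mp hx
    exact F_mem_V (ih hy) i

theorem q_mem_V (m : ℕ) (i : Fin 3) : q i ∈ V m := by
  induction m with
  | zero => exact q_mem_V_zero i
  | succ m ih => exact V_subset_succ m ih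

theorem wordMap_mem_V {w : List (Fin 3)} {m : ℕ} {x : gasket} (hx : x ∈ V m) :
    wordMap w x ∈ V (w.length + m) := by
  induction w with
  | nil => simpa [wordMap] using hx
  | cons i w ih =>
    have := F_mem_V ih i
    rw [List.length_cons, Nat.add_right_comm]
    exact this

theorem F_notMem_V_zero {i : Fin 3} {x : gasket} (hx : x ∉ V 0) : F i x ∉ V 0 := by
  intro h
  obtain ⟨j, hj⟩ := mem_V_zero.mp h
  exact hx (mem_V_zero.mpr ⟨j, (F_eq_q hj).2⟩)

theorem F_q_notMem_V_zero {a b : Fin 3} (hab : a ≠ b) : F a (q b) ∉ V 0 := by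
  intro h
  obtain ⟨j, hj⟩ := mem_V_zero.mp h
  obtain ⟨h1, h2⟩ := F_eq_q hj
  exact hab (h1.trans (q_injective h2).symm)

theorem wordMap_notMem_V_zero {w : List (Fin 3)} {x : gasket} (hx : x ∉ V 0) :
    wordMap w x ∉ V 0 := by
  induction w with
  | nil => exact hx
  | cons i w ih => exact F_notMem_V_zero ih

/-- If `F_i x` is a vertex, then so is `x`. -/
theorem mem_V_of_F_mem {m : ℕ} {i : Fin 3} {x : gasket} (h : F i x ∈ V (m + 1)) : x ∈ V m := by
  obtain ⟨j, y, hy, e⟩ := mem_V_succ.mp h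
  by_cases hij : j = i
  · subst hij
    rwa [← F_injective _ e]
  · rw [(eq_q_of_F_eq hij e).2]
    exact q_mem_V m j

@[simp] theorem F_mem_V_iff {m : ℕ} {i : Fin 3} {x : gasket} : F i x ∈ V (m + 1) ↔ x ∈ V m :=
  ⟨mem_V_of_F_mem, fun h => F_mem_V h i⟩

/-- The vertices off the boundary are dense in the gasket. -/
theorem eq_of_eq_on_vertices {u v : gasket → ℝ} (hu : Continuous u) (hv : Continuous v)
    (h : ∀ m, ∀ x ∈ V m, x ∉ V 0 → u x = v x) : u = v := by
  have hc : Continuous fun x => u x - v x := hu.sub hv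
  funext x
  by_contra hne
  have hpos : 0 < |u x - v x| := abs_pos.mpr (sub_ne_zero.mpr hne)
  obtain ⟨M, hM⟩ := exists_osc_lt hc hpos
  obtain ⟨w, hw, y, rfl⟩ := exists_wordMap M x
  have h1 := hM M le_rfl w hw y (F 0 (q 1))
  have h2 : u (wordMap w (F 0 (q 1))) = v (wordMap w (F 0 (q 1))) :=
    h _ _ (wordMap_mem_V (F_mem_V (q_mem_V_zero 1) 0))
      (wordMap_notMem_V_zero (F_q_notMem_V_zero (by decide)))
  simp only [h2, sub_self, sub_zero, lt_irrefl] at h1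

/-- A sequence of continuous functions with geometrically small increments has a continuous
limit. -/
theorem tendsto_of_geometric {u : ℕ → gasket → ℝ} (hu : ∀ m, Continuous (u m)) {C r : ℝ}
    (hr : r < 1) (h : ∀ m x, |u (m + 1) x - u m x| ≤ C * r ^ m) :
    ∃ v : gasket → ℝ, Continuous v ∧ ∀ x, Tendsto (fun m => u m x) atTop (𝓝 (v x)) := by
  let U : ℕ → C(gasket, ℝ) := fun m => ⟨u m, hu m⟩
  have hU : CauchySeq U := by
    refine cauchySeq_of_le_geometric r C hr fun m => ?_
    have h0 : 0 ≤ C * r ^ m := (abs_nonneg _).trans (h m (q 0))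
    rw [ContinuousMap.dist_le h0]
    intro x
    rw [dist_comm, Real.dist_eq]
    exact h m x
  obtain ⟨v, hv⟩ := cauchySeq_tendsto_of_complete hU
  refine ⟨v, v.continuous, fun x => ?_⟩
  exact ((ContinuousEvalConst.continuous_eval_const x).tendsto v).comp hv

/-! ### Harmonic functions -/

/-- The boundary values on the cell `F_i(SG)` of the harmonic function with boundary values `c`:
the "`1/5`-`2/5` rule". -/
def child (i : Fin 3) (c : Fin 3 → ℝ) (j : Fin 3) : ℝ :=
  if j = i then c i else (c 0 + c 1 + c 2 + c i + c j) / 5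

theorem child_comm (i j : Fin 3) (c : Fin 3 → ℝ) : child i c j = child j c i := by
  unfold child
  by_cases h : j = i
  · subst h; rfl
  · rw [if_neg h, if_neg (Ne.symm h)]; ring

theorem child_self (i : Fin 3) (c : Fin 3 → ℝ) : child i c i = c i := if_pos rfl

/-- Approximations of the harmonic function with boundary values `c`: the `m`-th one is affine on
each cell of level `m`, with the values of the harmonic function at the vertices. -/
def harmApprox : ℕ → (Fin 3 → ℝ) → gasket → ℝ
  | 0, c, x => c 0 * bary 0 x + c 1 * bary 1 x + c 2 * bary 2 x
  | m + 1, c, x => glue (fun i => harmApprox m (child i c)) x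

theorem harmApprox_q (m : ℕ) (c : Fin 3 → ℝ) (i : Fin 3) : harmApprox m c (q i) = c i := by
  induction m generalizing c i with
  | zero => simp only [harmApprox, bary_q]; fin_cases i <;> simp
  | succ m ih =>
    rw [← F_q_self i]
    simp only [harmApprox]
    rw [glue_F (fun i j => by rw [ih, ih, child_comm]), ih, child_self]

theorem harmApprox_F (m : ℕ) (c : Fin 3 → ℝ) (i : Fin 3) (x : gasket) :
    harmApprox (m + 1) c (F i x) = harmApprox m (child i c) x := by
  simp only [harmApprox]
  rw [glue_F (fun i j => by rw [harmApprox_q, harmApprox_q, child_comm])]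

theorem harmApprox_continuous (m : ℕ) (c : Fin 3 → ℝ) : Continuous (harmApprox m c) := by
  induction m generalizing c with
  | zero =>
    have h := fun i => (bary_continuous i).comp (continuous_subtype_val (p := (· ∈ gasket)))
    simp only [Function.comp_def] at h
    change Continuous fun x : gasket => c 0 * bary 0 x + c 1 * bary 1 x + c 2 * bary 2 x
    exact (((h 0).const_mul _).add ((h 1).const_mul _)).add ((h 2).const_mul _)
  | succ m ih =>
    exact continuous_of_comp_F fun i => by
      have : harmApprox (m + 1) c ∘ F i = harmApprox m (child i c) :=
        funext fun x => harmApprox_F m c i x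
      rw [this]; exact ih _

theorem child_osc {c : Fin 3 → ℝ} {D : ℝ} (hD : ∀ a b, |c a - c b| ≤ D) (i a b : Fin 3) :
    |child i c a - child i c b| ≤ 3 / 5 * D := by
  have h := fun a b => abs_le.mp (hD a b)
  have h01 := h 0 1
  have h02 := h 0 2
  have h12 := h 1 2
  rw [abs_le]
  fin_cases i <;> fin_cases a <;> fin_cases b <;> simp [child] <;>
    (try constructor) <;> linarith

/-- The oscillation shrinks by `3 / 5` with each level, so that the approximations converge. -/
theorem harmApprox_step (m : ℕ) {c : Fin 3 → ℝ} {D : ℝ} (hD : ∀ a b, |c a - c b| ≤ D)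
    (x : gasket) : |harmApprox (m + 1) c x - harmApprox m c x| ≤ D * (3 / 5) ^ m := by
  induction m generalizing c D x with
  | zero =>
    obtain ⟨i, y, rfl⟩ := exists_F x
    rw [harmApprox_F]
    have hs := bary_sum (y : Plane)
    have h0 := bary_nonneg 0 y
    have h1 := bary_nonneg 1 y
    have h2 := bary_nonneg 2 y
    have h := fun a b => abs_le.mp (hD a b)
    have h01 := h 0 1
    have h02 := h 0 2
    have h12 := h 1 2
    have key : ∀ j, |child i c j - (c j + c i) / 2| ≤ D := by
      intro j
      rw [abs_le]
      fin_cases i <;> fin_cases j <;> simp [child] <;> (try constructor) <;> linarith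
    have e : harmApprox 0 (child i c) y - harmApprox 0 c (F i y) =
        (child i c 0 - (c 0 + c i) / 2) * bary 0 y + (child i c 1 - (c 1 + c i) / 2) * bary 1 y +
        (child i c 2 - (c 2 + c i) / 2) * bary 2 y := by
      have hs' : bary 0 (y : Plane) = 1 - bary 1 y - bary 2 y := by linarith
      simp only [harmApprox, bary_F]
      rw [hs']
      fin_cases i <;> simp <;> ring
    rw [e, pow_zero, mul_one]
    have k0 := abs_le.mp (key 0)
    have k1 := abs_le.mp (key 1)
    have k2 := abs_le.mp (key 2)
    rw [abs_le]
    constructor <;> nlinarith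
  | succ m ih =>
    obtain ⟨i, y, rfl⟩ := exists_F x
    rw [harmApprox_F, harmApprox_F]
    refine (ih (fun a b => child_osc hD i a b) y).trans (le_of_eq ?_)
    ring

theorem exists_osc_bound (c : Fin 3 → ℝ) : ∃ D, ∀ a b, |c a - c b| ≤ D := by
  refine ⟨∑ a, ∑ b, |c a - c b|, fun a b => ?_⟩
  refine (Finset.single_le_sum (f := fun b => |c a - c b|) (fun b _ => abs_nonneg _)
    (Finset.mem_univ b)).trans ?_
  exact Finset.single_le_sum (f := fun a => ∑ b, |c a - c b|)
    (fun a _ => Finset.sum_nonneg fun b _ => abs_nonneg _) (Finset.mem_univ a)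

theorem exists_harm (c : Fin 3 → ℝ) : ∃ v : gasket → ℝ, Continuous v ∧
    ∀ x, Tendsto (fun m => harmApprox m c x) atTop (𝓝 (v x)) := by
  obtain ⟨D, hD⟩ := exists_osc_bound c
  exact tendsto_of_geometric (fun m => harmApprox_continuous m c) (by norm_num)
    fun m x => harmApprox_step m hD x

/-- The harmonic function on the gasket with boundary values `c`. -/
def harm (c : Fin 3 → ℝ) : gasket → ℝ := (exists_harm c).choose

theorem harm_continuous (c : Fin 3 → ℝ) : Continuous (harm c) := (exists_harm c).choose_spec.1

theorem tendsto_harm (c : Fin 3 → ℝ) (x : gasket) :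
    Tendsto (fun m => harmApprox m c x) atTop (𝓝 (harm c x)) := (exists_harm c).choose_spec.2 x

@[simp] theorem harm_q (c : Fin 3 → ℝ) (i : Fin 3) : harm c (q i) = c i :=
  tendsto_nhds_unique (tendsto_harm c (q i)) (by simp only [harmApprox_q]; exact tendsto_const_nhds)

theorem harm_F (c : Fin 3 → ℝ) (i : Fin 3) (x : gasket) :
    harm c (F i x) = harm (child i c) x := by
  have h1 := (tendsto_harm c (F i x)).comp (tendsto_add_atTop_nat 1)
  refine tendsto_nhds_unique h1 ?_
  simp only [Function.comp_def, harmApprox_F]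
  exact tendsto_harm _ x

theorem child_add (i : Fin 3) (c c' : Fin 3 → ℝ) : child i (c + c') = child i c + child i c' := by
  funext j
  simp only [child, Pi.add_apply]
  split_ifs <;> ring

theorem child_smul (i : Fin 3) (r : ℝ) (c : Fin 3 → ℝ) : child i (r • c) = r • child i c := by
  funext j
  simp only [child, Pi.smul_apply, smul_eq_mul]
  split_ifs <;> ring

theorem harmApprox_add (m : ℕ) (c c' : Fin 3 → ℝ) (x : gasket) :
    harmApprox m (c + c') x = harmApprox m c x + harmApprox m c' x := by
  induction m generalizing c c' x with
  | zero => simp only [harmApprox, Pi.add_apply]; ring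
  | succ m ih =>
    obtain ⟨i, y, rfl⟩ := exists_F x
    rw [harmApprox_F, harmApprox_F, harmApprox_F, child_add, ih]

theorem harmApprox_smul (m : ℕ) (r : ℝ) (c : Fin 3 → ℝ) (x : gasket) :
    harmApprox m (r • c) x = r * harmApprox m c x := by
  induction m generalizing c x with
  | zero => simp only [harmApprox, Pi.smul_apply, smul_eq_mul]; ring
  | succ m ih =>
    obtain ⟨i, y, rfl⟩ := exists_F x
    rw [harmApprox_F, harmApprox_F, child_smul, ih]

theorem harm_add (c c' : Fin 3 → ℝ) : harm (c + c') = harm c + harm c' := by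
  funext x
  refine tendsto_nhds_unique (tendsto_harm _ x) ?_
  simp only [harmApprox_add]
  exact (tendsto_harm c x).add (tendsto_harm c' x)

theorem harm_smul (r : ℝ) (c : Fin 3 → ℝ) : harm (r • c) = r • harm c := by
  funext x
  refine tendsto_nhds_unique (tendsto_harm _ x) ?_
  simp only [harmApprox_smul]
  exact (tendsto_harm c x).const_mul r

theorem harm_zero : harm 0 = 0 := by
  have := harm_smul 0 0
  simpa using this

theorem harm_sub (c c' : Fin 3 → ℝ) : harm (c - c') = harm c - harm c' := by
  have h := harm_add (c - c') c'
  rw [sub_add_cancel] at h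
  rw [h, add_sub_cancel_right]

theorem harmApprox_bounds (m : ℕ) {c : Fin 3 → ℝ} {A B : ℝ} (h : ∀ j, A ≤ c j ∧ c j ≤ B)
    (x : gasket) : A ≤ harmApprox m c x ∧ harmApprox m c x ≤ B := by
  induction m generalizing c x with
  | zero =>
    have hs := bary_sum (x : Plane)
    have h0 := bary_nonneg 0 x
    have h1 := bary_nonneg 1 x
    have h2 := bary_nonneg 2 x
    have k0 := h 0
    have k1 := h 1
    have k2 := h 2
    have a0 := mul_le_mul_of_nonneg_right k0.1 h0
    have a1 := mul_le_mul_of_nonneg_right k1.1 h1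
    have a2 := mul_le_mul_of_nonneg_right k2.1 h2
    have b0 := mul_le_mul_of_nonneg_right k0.2 h0
    have b1 := mul_le_mul_of_nonneg_right k1.2 h1
    have b2 := mul_le_mul_of_nonneg_right k2.2 h2
    have hA := congrArg (A * ·) hs
    have hB := congrArg (B * ·) hs
    simp only [mul_add, mul_one] at hA hB
    simp only [harmApprox]
    constructor <;> linarith
  | succ m ih =>
    obtain ⟨i, y, rfl⟩ := exists_F x
    rw [harmApprox_F]
    refine ih (fun j => ?_) y
    have k0 := h 0
    have k1 := h 1
    have k2 := h 2
    have ki := h i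
    have kj := h j
    unfold child
    split_ifs
    · exact ki
    · constructor <;> linarith

/-- The maximum principle for harmonic functions. -/
theorem harm_bounds {c : Fin 3 → ℝ} {A B : ℝ} (h : ∀ j, A ≤ c j ∧ c j ≤ B)
    (x : gasket) : A ≤ harm c x ∧ harm c x ≤ B :=
  ⟨ge_of_tendsto' (tendsto_harm c x) fun m => (harmApprox_bounds m h x).1,
    le_of_tendsto' (tendsto_harm c x) fun m => (harmApprox_bounds m h x).2⟩

theorem harm_const (r : ℝ) (x : gasket) : harm (fun _ => r) x = r :=
  le_antisymm (harm_bounds (A := r) (fun _ => ⟨le_rfl, le_rfl⟩) x).2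
    (harm_bounds (B := r) (fun _ => ⟨le_rfl, le_rfl⟩) x).1

/-- The harmonic function that equals `1` at `q_a` and `0` at the other two boundary points. -/
def hb (a : Fin 3) : gasket → ℝ := harm (Pi.single a 1)

theorem hb_continuous (a : Fin 3) : Continuous (hb a) := harm_continuous _

theorem hb_nonneg (a : Fin 3) (x : gasket) : 0 ≤ hb a x := by
  refine (harm_bounds (B := 1) (fun j => ?_) x).1
  simp only [Pi.single_apply]
  split_ifs <;> norm_num

theorem harm_eq (c : Fin 3 → ℝ) (x : gasket) :
    harm c x = c 0 * hb 0 x + c 1 * hb 1 x + c 2 * hb 2 x := by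
  have e : c = c 0 • Pi.single 0 1 + c 1 • Pi.single 1 1 + c 2 • Pi.single 2 1 := by
    funext j
    fin_cases j <;> simp
  conv_lhs => rw [e]
  simp only [harm_add, harm_smul, hb, Pi.add_apply, Pi.smul_apply, smul_eq_mul]

theorem hb_sum (x : gasket) : hb 0 x + hb 1 x + hb 2 x = 1 := by
  have h := harm_eq (fun _ => 1) x
  rw [harm_const] at h
  linarith

theorem hb_F (a i : Fin 3) (x : gasket) : hb a (F i x) =
    child i (Pi.single a 1) 0 * hb 0 x + child i (Pi.single a 1) 1 * hb 1 x +
      child i (Pi.single a 1) 2 * hb 2 x := by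
  rw [hb, harm_F, harm_eq]

/-! ### Piecewise harmonic splines and the terms of Green's function -/

open Classical in
/-- The function `φ (F_j⁻¹ z)`, to be read as `0` if `z` is not in the cell `F_j(SG)`. -/
def onCell (φ : gasket → gasket → ℝ) (z : gasket) (j : Fin 3) (x : gasket) : ℝ :=
  if h : ∃ z₀, F j z₀ = z then φ h.choose x else 0

theorem onCell_F (φ : gasket → gasket → ℝ) (z : gasket) (j : Fin 3) (x : gasket) :
    onCell φ (F j z) j x = φ z x := by
  have h : ∃ z₀, F j z₀ = F j z := ⟨z, rfl⟩
  rw [onCell, dif_pos h, F_injective j h.choose_spec]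

theorem onCell_of_ne {φ : gasket → gasket → ℝ} {z : gasket} {j : Fin 3}
    (h : ¬ ∃ z₀, F j z₀ = z) (x : gasket) : onCell φ z j x = 0 := by
  rw [onCell, dif_neg h]

/-- The piecewise harmonic spline `ψ_z^{(m)}`, constructed cell by cell. It agrees with
`spline m z`, see `spline_eq`. -/
def spl : ℕ → gasket → gasket → ℝ
  | 0, z => harm fun a => if q a = z then 1 else 0
  | m + 1, z => glue (onCell (spl m) z)

theorem onCell_q {φ : gasket → gasket → ℝ} (hφ : ∀ z a, φ z (q a) = if q a = z then 1 else 0)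
    (z : gasket) (i j : Fin 3) : onCell φ z i (q j) = if F i (q j) = z then 1 else 0 := by
  by_cases h : ∃ z₀, F i z₀ = z
  · obtain ⟨z₀, rfl⟩ := h
    rw [onCell_F, hφ]
    simp only [F_inj]
  · rw [onCell_of_ne h, if_neg fun e => h ⟨_, e⟩]

theorem spl_q (m : ℕ) (z : gasket) (a : Fin 3) : spl m z (q a) = if q a = z then 1 else 0 := by
  induction m generalizing z a with
  | zero => simp [spl]
  | succ m ih =>
    rw [← F_q_self a]
    simp only [spl]
    rw [glue_F (fun i j => by rw [onCell_q ih, onCell_q ih, F_q_comm]), onCell_q ih]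

theorem onCell_spl_compat (m : ℕ) (z : gasket) (i j : Fin 3) :
    onCell (spl m) z i (q j) = onCell (spl m) z j (q i) := by
  rw [onCell_q (spl_q m), onCell_q (spl_q m), F_q_comm]

theorem spl_F (m : ℕ) (z : gasket) (j : Fin 3) (x : gasket) :
    spl (m + 1) (F j z) (F j x) = spl m z x := by
  simp only [spl]
  rw [glue_F (onCell_spl_compat m _), onCell_F]

theorem spl_F_of_ne {m : ℕ} {z : gasket} {j : Fin 3} (h : ¬ ∃ z₀, F j z₀ = z) (x : gasket) :
    spl (m + 1) z (F j x) = 0 := by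
  simp only [spl]
  rw [glue_F (onCell_spl_compat m _), onCell_of_ne h]

theorem spl_continuous (m : ℕ) (z : gasket) : Continuous (spl m z) := by
  induction m generalizing z with
  | zero => exact harm_continuous _
  | succ m ih =>
    refine continuous_of_comp_F fun j => ?_
    by_cases h : ∃ z₀, F j z₀ = z
    · obtain ⟨z₀, rfl⟩ := h
      have : spl (m + 1) (F j z₀) ∘ F j = spl m z₀ := funext fun x => spl_F m z₀ j x
      rw [this]; exact ih z₀
    · have : spl (m + 1) z ∘ F j = fun _ => 0 := funext fun x => spl_F_of_ne h x
      rw [this]; exact continuous_const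

theorem spl_vertex (m : ℕ) (z : gasket) {x : gasket} (hx : x ∈ V m) :
    spl m z x = if x = z then 1 else 0 := by
  induction m generalizing z x with
  | zero =>
    obtain ⟨a, rfl⟩ := mem_V_zero.mp hx
    exact spl_q 0 z a
  | succ m ih =>
    obtain ⟨j, y, hy, rfl⟩ := mem_V_succ.mp hx
    by_cases h : ∃ z₀, F j z₀ = z
    · obtain ⟨z₀, rfl⟩ := h
      rw [spl_F, ih _ hy]
      simp only [F_inj]
    · rw [spl_F_of_ne h, if_neg fun e => h ⟨y, e⟩]

theorem spl_wordMap (m : ℕ) (z : gasket) {w : List (Fin 3)} (hw : w.length = m) :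
    ∃ c, spl m z ∘ wordMap w = harm c := by
  induction w generalizing m z with
  | nil => subst hw; exact ⟨_, rfl⟩
  | cons j w ih =>
    subst hw
    by_cases h : ∃ z₀, F j z₀ = z
    · obtain ⟨z₀, rfl⟩ := h
      obtain ⟨c, hc⟩ := ih w.length z₀ rfl
      refine ⟨c, ?_⟩
      rw [← hc]
      exact funext fun x => spl_F _ z₀ j _
    · refine ⟨0, ?_⟩
      rw [harm_zero]
      exact funext fun x => spl_F_of_ne h _

/-- A vertex `F_i x` with `x` not a corner has all its neighbours in the cell `F_i(SG)`. -/
theorem adj_F_iff {m : ℕ} {i : Fin 3} {x y : gasket} (hx : x ∉ V 0) :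
    Adj (m + 1) (F i x) y ↔ ∃ y', F i y' = y ∧ Adj m x y' := by
  constructor
  · rintro ⟨hne, w, hw, ⟨a, ha⟩, ⟨b, hb⟩⟩
    cases w with
    | nil => simp at hw
    | cons k w =>
      rw [wordMap_cons] at ha hb
      have hk : i = k := by
        by_contra hik
        exact hx (mem_V_zero.mpr ⟨k, (eq_q_of_F_eq hik ha).1⟩)
      subst hk
      refine ⟨wordMap w (q b), hb.symm, fun e => hne ?_, w, by simpa using hw,
        ⟨a, F_injective _ ha⟩, ⟨b, rfl⟩⟩
      rw [hb, e]
  · rintro ⟨y', rfl, hne, w, hw, ⟨a, ha⟩, ⟨b, hb⟩⟩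
    exact ⟨fun e => hne (F_injective _ e), i :: w, by simp [hw],
      ⟨a, by rw [wordMap_cons, ← ha]⟩, ⟨b, by rw [wordMap_cons, ← hb]⟩⟩

theorem greenCoeff_F_self {m : ℕ} {i : Fin 3} {z z' : gasket} (hz : z ∉ V 0) :
    greenCoeff (m + 1) (F i z) (F i z') = 3 / 5 * greenCoeff m z z' := by
  have h : Adj (m + 1 + 1) (F i z) (F i z') ↔ Adj (m + 1) z z' := by
    rw [adj_F_iff hz]
    constructor
    · rintro ⟨y, hy, h⟩; rwa [← F_injective i hy]
    · exact fun h => ⟨_, rfl, h⟩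
  unfold greenCoeff
  by_cases hA : Adj (m + 1) z z'
  · simp only [F_inj, h.mpr hA, hA]
    split_ifs <;> ring
  · simp only [F_inj, mt h.mp hA, hA]
    split_ifs <;> ring

theorem greenCoeff_F_ne {m : ℕ} {i j : Fin 3} (hij : i ≠ j) {z z' : gasket} (hz : z ∉ V 0)
    (hz' : z' ∉ V 0) : greenCoeff (m + 1) (F i z) (F j z') = 0 := by
  have h : ∀ y, F i y ≠ F j z' := fun y hy => hz' (mem_V_zero.mpr ⟨i, (eq_q_of_F_eq hij hy).2⟩)
  unfold greenCoeff
  rw [if_neg (h z), if_neg]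
  rw [adj_F_iff hz]
  rintro ⟨y, hy, -⟩
  exact h y hy

theorem greenCoeff_comm (m : ℕ) (z z' : gasket) : greenCoeff m z z' = greenCoeff m z' z := by
  have h : Adj (m + 1) z z' ↔ Adj (m + 1) z' z := by
    constructor <;> rintro ⟨h, w, hw, a, b⟩ <;> exact ⟨h.symm, w, hw, b, a⟩
  unfold greenCoeff
  by_cases hA : Adj (m + 1) z z'
  · simp only [hA, h.mp hA, eq_comm (a := z)]
  · simp only [hA, mt h.mpr hA, eq_comm (a := z)]

open Classical in
/-- The vertices of level `m + 1` that are not vertices of level `m`. -/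
def newV (m : ℕ) : Finset gasket := V (m + 1) \ V m

theorem mem_newV {m : ℕ} {x : gasket} : x ∈ newV m ↔ x ∈ V (m + 1) ∧ x ∉ V m := by
  simp [newV]

theorem notMem_V_zero_of_mem_newV {m : ℕ} {x : gasket} (h : x ∈ newV m) : x ∉ V 0 := by
  intro hx
  obtain ⟨i, rfl⟩ := mem_V_zero.mp hx
  exact (mem_newV.mp h).2 (q_mem_V m i)

theorem sum_newV_succ {m : ℕ} (i : Fin 3) {φ : gasket → ℝ}
    (h : ∀ z, (¬ ∃ z₀, F i z₀ = z) → φ z = 0) :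
    ∑ z ∈ newV (m + 1), φ z = ∑ z ∈ newV m, φ (F i z) := by
  classical
  rw [← Finset.sum_image (f := φ) (s := newV m) (g := F i) (fun x _ y _ e => F_injective i e)]
  symm
  refine Finset.sum_subset ?_ ?_
  · intro x hx
    obtain ⟨y, hy, rfl⟩ := Finset.mem_image.mp hx
    rw [mem_newV] at hy ⊢
    simpa using hy
  · intro x hx hx'
    refine h x ?_
    rintro ⟨y, rfl⟩
    refine hx' (Finset.mem_image_of_mem _ ?_)
    rw [mem_newV] at hx ⊢
    simpa using hx

/-- The level `m` term of the series for Green's function. -/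
def gTerm (m : ℕ) (x y : gasket) : ℝ :=
  ∑ z ∈ newV m, ∑ z' ∈ newV m, greenCoeff m z z' * spl (m + 1) z x * spl (m + 1) z' y

theorem gTerm_comm (m : ℕ) (x y : gasket) : gTerm m x y = gTerm m y x := by
  unfold gTerm
  rw [Finset.sum_comm]
  refine Finset.sum_congr rfl fun z _ => Finset.sum_congr rfl fun z' _ => ?_
  rw [greenCoeff_comm]; ring

theorem gTerm_expand (m : ℕ) (i j : Fin 3) (x y : gasket) :
    gTerm (m + 1) (F i x) (F j y) = ∑ z ∈ newV m, ∑ z' ∈ newV m,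
      greenCoeff (m + 1) (F i z) (F j z') * spl (m + 1) z x * spl (m + 1) z' y := by
  unfold gTerm
  rw [sum_newV_succ i]
  · refine Finset.sum_congr rfl fun z _ => ?_
    rw [sum_newV_succ j]
    · simp only [spl_F]
    · intro z' h
      rw [spl_F_of_ne h, mul_zero]
  · intro z h
    refine Finset.sum_eq_zero fun z' _ => ?_
    rw [spl_F_of_ne h, mul_zero, zero_mul]

theorem gTerm_F_self (m : ℕ) (i : Fin 3) (x y : gasket) :
    gTerm (m + 1) (F i x) (F i y) = 3 / 5 * gTerm m x y := by
  rw [gTerm_expand, gTerm, Finset.mul_sum]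
  refine Finset.sum_congr rfl fun z hz => ?_
  rw [Finset.mul_sum]
  refine Finset.sum_congr rfl fun z' _ => ?_
  rw [greenCoeff_F_self (notMem_V_zero_of_mem_newV hz)]
  ring

theorem gTerm_F_ne (m : ℕ) {i j : Fin 3} (hij : i ≠ j) (x y : gasket) :
    gTerm (m + 1) (F i x) (F j y) = 0 := by
  rw [gTerm_expand]
  refine Finset.sum_eq_zero fun z hz => Finset.sum_eq_zero fun z' hz' => ?_
  rw [greenCoeff_F_ne hij (notMem_V_zero_of_mem_newV hz) (notMem_V_zero_of_mem_newV hz')]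
  ring

/-- The vertex of `V₁` opposite to `q_k`: the midpoint of the other two boundary points. -/
def node (k : Fin 3) : gasket := F (k + 1) (q (k + 2))

theorem F_q_eq_node {i j : Fin 3} (hij : i ≠ j) : F i (q j) = node (-(i + j)) := by
  unfold node
  fin_cases i <;> fin_cases j <;> simp at hij ⊢ <;> first | rfl | exact F_q_comm _ _

theorem node_injective : Function.Injective node := by
  intro k l h
  by_contra hkl
  unfold node at h
  by_cases e : k + 1 = l + 1
  · exact hkl (add_right_cancel e)
  · obtain ⟨h1, h2⟩ := eq_q_of_F_eq e h
    have h1 := q_injective h1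
    have h2 := q_injective h2
    clear h
    omega

theorem newV_zero : newV 0 = Finset.univ.image node := by
  ext x
  rw [mem_newV, mem_V_succ]
  simp only [Finset.mem_image, Finset.mem_univ, true_and]
  constructor
  · rintro ⟨⟨i, y, hy, rfl⟩, hx⟩
    obtain ⟨j, rfl⟩ := mem_V_zero.mp hy
    have hij : i ≠ j := by
      rintro rfl
      exact hx (by simp)
    exact ⟨_, (F_q_eq_node hij).symm⟩
  · rintro ⟨k, rfl⟩
    exact ⟨⟨_, _, q_mem_V_zero _, rfl⟩, F_q_notMem_V_zero (by revert k; decide)⟩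

/-- The level `1` spline at the vertex `node k`. -/
def psi (k : Fin 3) : gasket → ℝ := spl 1 (node k)

theorem psi_continuous (k : Fin 3) : Continuous (psi k) := spl_continuous _ _

theorem psi_F_self (k : Fin 3) (x : gasket) : psi k (F k x) = 0 := by
  refine spl_F_of_ne ?_ x
  rintro ⟨z, hz⟩
  have h := (eq_q_of_F_eq (show k ≠ k + 1 by omega) hz).2
  have := q_injective h
  omega

theorem psi_F {k i : Fin 3} (h : i ≠ k) (x : gasket) : psi k (F i x) = hb (-(i + k)) x := by
  have e : node k = F i (q (-(i + k))) := by
    have hne : i ≠ -(i + k) := by revert i k; decide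
    rw [F_q_eq_node hne]
    congr 1
    revert i k; decide
  rw [psi, e, spl_F]
  simp only [spl, q_inj, hb]
  congr 1
  funext a
  simp [Pi.single_apply]

theorem adj_node {k l : Fin 3} (h : k ≠ l) : Adj 1 (node k) (node l) := by
  refine ⟨fun e => h (node_injective e), [-(k + l)], rfl, ⟨l, ?_⟩, ⟨k, ?_⟩⟩
  · change node k = F (-(k + l)) (q l)
    rw [F_q_eq_node (by revert k l; decide)]
    congr 1; revert k l; decide
  · change node l = F (-(k + l)) (q k)
    rw [F_q_eq_node (by revert k l; decide)]
    congr 1; revert k l; decide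

theorem gTerm_zero (x y : gasket) : gTerm 0 x y = 3 / 50 *
    ((psi 0 x + psi 1 x + psi 2 x) * (psi 0 y + psi 1 y + psi 2 y) +
      2 * (psi 0 x * psi 0 y + psi 1 x * psi 1 y + psi 2 x * psi 2 y)) := by
  have hc : ∀ k l : Fin 3, greenCoeff 0 (node k) (node l) = if k = l then 9 / 50 else 3 / 50 := by
    intro k l
    unfold greenCoeff
    by_cases h : k = l
    · subst h; simp
    · rw [if_neg (fun e => h (node_injective e)), if_pos (adj_node h), if_neg h]
      norm_num
  unfold gTerm
  rw [newV_zero]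
  simp only [Finset.sum_image (fun x _ y _ e => node_injective e : Set.InjOn node _), hc]
  simp only [Fin.sum_univ_three, psi]
  simp only [reduceIte, show (0 : Fin 3) ≠ 1 by decide, show (0 : Fin 3) ≠ 2 by decide,
    show (1 : Fin 3) ≠ 0 by decide, show (1 : Fin 3) ≠ 2 by decide, show (2 : Fin 3) ≠ 0 by decide,
    show (2 : Fin 3) ≠ 1 by decide]
  ring

theorem psi_nonneg (k : Fin 3) (x : gasket) : 0 ≤ psi k x := by
  obtain ⟨i, x, rfl⟩ := exists_F x
  by_cases h : i = k
  · subst h; rw [psi_F_self]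
  · rw [psi_F h]; exact hb_nonneg _ _

theorem gTerm_zero_bounds (x y : gasket) : 0 ≤ gTerm 0 x y ∧ gTerm 0 x y ≤ 9 / 50 := by
  have hsum : ∀ x, psi 0 x + psi 1 x + psi 2 x ≤ 1 := by
    intro x
    obtain ⟨i, x, rfl⟩ := exists_F x
    have hs := hb_sum x
    have h0 := hb_nonneg 0 x
    have h1 := hb_nonneg 1 x
    have h2 := hb_nonneg 2 x
    fin_cases i
    · have e0 : psi 0 (F 0 x) = 0 := psi_F_self 0 x
      have e1 : psi 1 (F 0 x) = hb 2 x := psi_F (by decide) x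
      have e2 : psi 2 (F 0 x) = hb 1 x := psi_F (by decide) x
      simp only [Fin.zero_eta, e0, e1, e2]; linarith
    · have e0 : psi 0 (F 1 x) = hb 2 x := psi_F (by decide) x
      have e1 : psi 1 (F 1 x) = 0 := psi_F_self 1 x
      have e2 : psi 2 (F 1 x) = hb 0 x := psi_F (by decide) x
      simp only [Fin.mk_one, e0, e1, e2]; linarith
    · have e0 : psi 0 (F 2 x) = hb 1 x := psi_F (by decide) x
      have e1 : psi 1 (F 2 x) = hb 0 x := psi_F (by decide) x
      have e2 : psi 2 (F 2 x) = 0 := psi_F_self 2 x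
      simp only [Fin.reduceFinMk, e0, e1, e2]; linarith
  rw [gTerm_zero]
  have a0 := psi_nonneg 0 x
  have a1 := psi_nonneg 1 x
  have a2 := psi_nonneg 2 x
  have b0 := psi_nonneg 0 y
  have b1 := psi_nonneg 1 y
  have b2 := psi_nonneg 2 y
  have h00 := mul_nonneg a0 b0
  have h01 := mul_nonneg a0 b1
  have h02 := mul_nonneg a0 b2
  have h10 := mul_nonneg a1 b0
  have h11 := mul_nonneg a1 b1
  have h12 := mul_nonneg a1 b2
  have h20 := mul_nonneg a2 b0
  have h21 := mul_nonneg a2 b1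
  have h22 := mul_nonneg a2 b2
  have hxy : (psi 0 x + psi 1 x + psi 2 x) * (psi 0 y + psi 1 y + psi 2 y) ≤ 1 :=
    mul_le_one₀ (hsum x) (by positivity) (hsum y)
  constructor
  · positivity
  · linarith

/-- At most one cell of each level contains both points, so the terms decay geometrically. -/
theorem gTerm_bounds (m : ℕ) (x y : gasket) :
    0 ≤ gTerm m x y ∧ gTerm m x y ≤ 9 / 50 * (3 / 5) ^ m := by
  induction m generalizing x y with
  | zero => simpa using gTerm_zero_bounds x y
  | succ m ih =>
    obtain ⟨i, x, rfl⟩ := exists_F x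
    obtain ⟨j, y, rfl⟩ := exists_F y
    by_cases h : i = j
    · subst h
      rw [gTerm_F_self]
      obtain ⟨h1, h2⟩ := ih x y
      exact ⟨by positivity, by rw [pow_succ]; linarith⟩
    · rw [gTerm_F_ne m h]
      exact ⟨le_rfl, by positivity⟩

theorem gTerm_continuous (m : ℕ) : Continuous fun z : gasket × gasket => gTerm m z.1 z.2 := by
  unfold gTerm
  refine continuous_finsetSum _ fun z _ => continuous_finsetSum _ fun z' _ => ?_
  exact (continuous_const.mul ((spl_continuous _ _).comp continuous_fst)).mul
    ((spl_continuous _ _).comp continuous_snd)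

theorem gTerm_summable (x y : gasket) : Summable fun m => gTerm m x y :=
  Summable.of_nonneg_of_le (fun m => (gTerm_bounds m x y).1) (fun m => (gTerm_bounds m x y).2)
    ((summable_geometric_of_lt_one (by norm_num) (by norm_num)).mul_left _)

/-- Green's function as the sum of the series of the `gTerm`s. It agrees with `green`, see
`green_eq`. -/
def gr (x y : gasket) : ℝ := ∑' m, gTerm m x y

theorem gr_comm (x y : gasket) : gr x y = gr y x := by
  unfold gr
  simp only [gTerm_comm _ x y]

theorem gr_nonneg (x y : gasket) : 0 ≤ gr x y := tsum_nonneg fun m => (gTerm_bounds m x y).1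

theorem gr_le (x y : gasket) : gr x y ≤ 9 / 20 := by
  have h := (hasSum_geometric_of_lt_one (r := (3 / 5 : ℝ)) (by norm_num) (by norm_num)).mul_left
    (9 / 50 : ℝ)
  have h2 := hasSum_le (fun m => (gTerm_bounds m x y).2) (gTerm_summable x y).hasSum h
  refine h2.trans (by norm_num)

theorem gr_continuous : Continuous fun z : gasket × gasket => gr z.1 z.2 := by
  refine continuous_tsum gTerm_continuous
    ((summable_geometric_of_lt_one (r := (3 / 5 : ℝ)) (by norm_num) (by norm_num)).mul_left
      (9 / 50 : ℝ)) fun m z => ?_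
  rw [Real.norm_of_nonneg (gTerm_bounds m z.1 z.2).1]
  exact (gTerm_bounds m z.1 z.2).2

theorem gr_F_self (i : Fin 3) (x y : gasket) :
    gr (F i x) (F i y) = gTerm 0 (F i x) (F i y) + 3 / 5 * gr x y := by
  unfold gr
  rw [(gTerm_summable (F i x) (F i y)).tsum_eq_zero_add]
  simp only [gTerm_F_self]
  rw [tsum_mul_left]

theorem gr_F_ne {i j : Fin 3} (hij : i ≠ j) (x y : gasket) :
    gr (F i x) (F j y) = gTerm 0 (F i x) (F j y) := by
  unfold gr
  rw [(gTerm_summable (F i x) (F j y)).tsum_eq_zero_add]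
  simp only [gTerm_F_ne _ hij, tsum_zero, add_zero]

/-! ### Integration on the gasket -/

/-- Prepending a letter to an infinite word. -/
def consWord (z : Fin 3 × (ℕ → Fin 3)) : ℕ → Fin 3 := fun k => Nat.casesOn k z.1 z.2

theorem consWord_measurable : Measurable consWord := by
  refine measurable_pi_lambda _ fun k => ?_
  cases k with
  | zero => exact measurable_fst
  | succ k => exact (measurable_pi_apply k).comp measurable_snd

/-- Prepending an independent letter leaves the distribution of i.i.d. letters unchanged. -/
theorem map_consWord (ν : Measure (Fin 3)) [IsProbabilityMeasure ν] :
    (ν.prod (Measure.infinitePi fun _ : ℕ => ν)).map consWord =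
      Measure.infinitePi fun _ : ℕ => ν := by
  classical
  refine Measure.eq_infinitePi _ fun s t ht => ?_
  let N := s.sup id
  have hs : ∀ k ∈ s, k < N + 1 := fun k hk => Nat.lt_succ_of_le (Finset.le_sup (f := id) hk)
  let t' : ℕ → Set (Fin 3) := fun k => if k ∈ s then t k else Set.univ
  have hpre : consWord ⁻¹' (Set.pi s t) =
      t' 0 ×ˢ Set.pi (Finset.range N : Finset ℕ) fun k => t' (k + 1) := by
    ext ⟨i, w⟩
    simp only [Set.mem_preimage, Set.mem_pi, Set.mem_prod, Finset.mem_coe, Finset.mem_range, t']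
    constructor
    · intro h
      constructor
      · split_ifs with h0
        · exact h 0 h0
        · trivial
      · intro k _
        split_ifs with h0
        · exact h (k + 1) h0
        · trivial
    · rintro ⟨h0, h1⟩ k hk
      cases k with
      | zero => rw [if_pos hk] at h0; exact h0
      | succ k =>
        have := h1 k (by have := hs _ hk; omega)
        rw [if_pos hk] at this
        exact this
  have ht' : ∀ k, MeasurableSet (t' k) := fun k => MeasurableSet.of_discrete
  rw [Measure.map_apply consWord_measurable (MeasurableSet.pi s.countable_toSet fun i _ => ht i),
    hpre, Measure.prod_prod, Measure.infinitePi_pi _ fun i _ => ht' _, mul_comm,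
    ← Finset.prod_range_succ' (fun k => ν (t' k)) N]
  symm
  calc ∏ k ∈ s, ν (t k) = ∏ k ∈ s, ν (t' k) :=
        Finset.prod_congr rfl fun k hk => by simp only [t', if_pos hk]
    _ = ∏ k ∈ Finset.range (N + 1), ν (t' k) := by
        refine Finset.prod_subset (fun k hk => Finset.mem_range.mpr (hs k hk)) fun k _ hk => ?_
        simp only [t', if_neg hk, measure_univ]

/-- The point of the gasket with address `w`. -/
def point (w : ℕ → Fin 3) : gasket := ⟨address w, w, rfl⟩

theorem integrable_of_continuous {f : gasket → ℝ} (hf : Continuous f) : Integrable f μ :=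
  hf.integrable_of_hasCompactSupport (HasCompactSupport.of_compactSpace f)

theorem integrable_prod_of_continuous {f : gasket × gasket → ℝ} (hf : Continuous f) :
    Integrable f (μ.prod μ) :=
  hf.integrable_of_hasCompactSupport (HasCompactSupport.of_compactSpace f)

/-- Self-similarity of the measure. -/
theorem integral_eq_sum_F {f : gasket → ℝ} (hf : Continuous f) :
    ∫ x, f x ∂μ = 1 / 3 * (∫ x, f (F 0 x) ∂μ + ∫ x, f (F 1 x) ∂μ + ∫ x, f (F 2 x) ∂μ) := by
  set ν : Measure (Fin 3) := (PMF.uniformOfFintype (Fin 3)).toMeasure with hν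
  set P : Measure (ℕ → Fin 3) := Measure.infinitePi fun _ : ℕ => ν with hP
  have hμ : μ = P.map point := rfl
  have hpt : Measurable point := point_measurable
  have e : ∀ g : gasket → ℝ, Continuous g → ∫ x, g x ∂μ = ∫ w, g (point w) ∂P := by
    intro g hg
    rw [hμ, integral_map hpt.aemeasurable hg.aestronglyMeasurable]
  have hcF : ∀ i, Continuous fun x => f (F i x) := fun i => hf.comp (F_continuous i)
  have hint : Integrable (fun w => f (point w)) P := by
    have := integrable_of_continuous hf
    rw [hμ] at this
    exact this.comp_measurable hpt
  rw [e f hf, e _ (hcF 0), e _ (hcF 1), e _ (hcF 2)]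
  have hmp : P = (ν.prod P).map consWord := (map_consWord ν).symm
  conv_lhs => rw [hmp]
  have hint' : Integrable (fun w => f (point w)) ((ν.prod P).map consWord) := by
    rw [← hmp]; exact hint
  rw [integral_map consWord_measurable.aemeasurable hint'.aestronglyMeasurable,
    integral_prod (fun z => f (point (consWord z))) (hint'.comp_measurable consWord_measurable), hν,
    PMF.integral_eq_sum]
  have hF : ∀ i w, point (consWord (i, w)) = F i (point w) :=
    fun i w => Subtype.ext (planeMap_address i w).symm
  simp only [hF, Fin.sum_univ_three, PMF.uniformOfFintype_apply, Fintype.card_fin, smul_eq_mul]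
  norm_num
  ring

theorem integral_lower_bound (w : List (Fin 3)) {f : gasket → ℝ} (hf : Continuous f)
    (h0 : ∀ x, 0 ≤ f x) {δ : ℝ} (hδ : ∀ y, δ ≤ f (wordMap w y)) :
    (1 / 3) ^ w.length * δ ≤ ∫ x, f x ∂μ := by
  induction w generalizing f with
  | nil =>
    have := integral_mono (integrable_const δ) (integrable_of_continuous hf) (fun x => hδ x)
    simpa using this
  | cons i w ih =>
    have h := ih (hf.comp (F_continuous i)) (fun x => h0 _) hδ
    simp only [Function.comp_apply] at h
    rw [integral_eq_sum_F hf, List.length_cons, pow_succ]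
    have hn : ∀ j, 0 ≤ ∫ x, f (F j x) ∂μ := fun j => integral_nonneg fun x => h0 _
    have h0 := hn 0
    have h1 := hn 1
    have h2 := hn 2
    fin_cases i <;> simp only [Fin.zero_eta, Fin.mk_one, Fin.reduceFinMk] at h <;> linarith

theorem integral_pos_of_pos {f : gasket → ℝ} (hf : Continuous f) (h0 : ∀ x, 0 ≤ f x) {x : gasket}
    (hx : 0 < f x) : 0 < ∫ x, f x ∂μ := by
  obtain ⟨M, hM⟩ := exists_osc_lt hf (half_pos hx)
  obtain ⟨w, hw, y, rfl⟩ := exists_wordMap M x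
  refine lt_of_lt_of_le ?_ (integral_lower_bound w hf h0 (δ := f (wordMap w y) / 2) fun z => ?_)
  · positivity
  · have := (abs_lt.mp (hM M le_rfl w hw z y)).1
    linarith

/-- The integral of a continuous function, as a linear functional. -/
def meanL : C(gasket, ℝ) →ₗ[ℝ] ℝ where
  toFun f := ∫ x, f x ∂μ
  map_add' f g := integral_add (integrable_of_continuous f.continuous)
    (integrable_of_continuous g.continuous)
  map_smul' r _ := integral_const_mul r _

theorem meanL_apply (f : C(gasket, ℝ)) : meanL f = ∫ x, f x ∂μ := rfl

/-- The restriction of a function to the cell `F_i(SG)`, carried back to the gasket. -/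
def cell (i : Fin 3) (f : C(gasket, ℝ)) : C(gasket, ℝ) := f.comp ⟨F i, F_continuous i⟩

@[simp] theorem cell_apply (i : Fin 3) (f : C(gasket, ℝ)) (x : gasket) : cell i f x = f (F i x) :=
  rfl

theorem cell_mul (i : Fin 3) (f g : C(gasket, ℝ)) : cell i (f * g) = cell i f * cell i g := rfl

theorem iterate_cell_apply (i : Fin 3) (m : ℕ) (f : C(gasket, ℝ)) (x : gasket) :
    (cell i)^[m] f x = f ((F i)^[m] x) := by
  induction m generalizing x with
  | zero => rfl
  | succ m ih =>
    rw [Function.iterate_succ_apply', cell_apply, ih, Function.iterate_succ_apply]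

theorem meanL_eq (f : C(gasket, ℝ)) :
    meanL f = 1 / 3 * (meanL (cell 0 f) + meanL (cell 1 f) + meanL (cell 2 f)) :=
  integral_eq_sum_F f.continuous

theorem meanL_one : meanL 1 = 1 := by simp [meanL_apply]

/-- `hb a` as a continuous map. -/
def hC (a : Fin 3) : C(gasket, ℝ) := ⟨hb a, hb_continuous a⟩

@[simp] theorem hC_apply (a : Fin 3) (x : gasket) : hC a x = hb a x := rfl

theorem hC_sum : hC 0 + hC 1 + hC 2 = 1 := by
  ext x; exact hb_sum x

theorem cell_hC (i a : Fin 3) : cell i (hC a) = child i (Pi.single a 1) 0 • hC 0 +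
    child i (Pi.single a 1) 1 • hC 1 + child i (Pi.single a 1) 2 • hC 2 := by
  ext x
  exact hb_F a i x

/-- The splines `psi k` as continuous maps. -/
def psiC (k : Fin 3) : C(gasket, ℝ) := ⟨psi k, psi_continuous k⟩

@[simp] theorem psiC_apply (k : Fin 3) (x : gasket) : psiC k x = psi k x := rfl

theorem cell_psiC_self (k : Fin 3) : cell k (psiC k) = 0 := by
  ext x; exact psi_F_self k x

theorem cell_psiC {k i : Fin 3} (h : i ≠ k) : cell i (psiC k) = hC (-(i + k)) := by
  ext x; exact psi_F h x

theorem cell_hC_values : (cell 0 (hC 0) = hC 0 + (2 / 5 : ℝ) • hC 1 + (2 / 5 : ℝ) • hC 2 ∧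
    cell 1 (hC 0) = (2 / 5 : ℝ) • hC 0 + (1 / 5 : ℝ) • hC 2 ∧
    cell 2 (hC 0) = (2 / 5 : ℝ) • hC 0 + (1 / 5 : ℝ) • hC 1) ∧
    (cell 0 (hC 1) = (2 / 5 : ℝ) • hC 1 + (1 / 5 : ℝ) • hC 2 ∧
    cell 1 (hC 1) = (2 / 5 : ℝ) • hC 0 + hC 1 + (2 / 5 : ℝ) • hC 2 ∧
    cell 2 (hC 1) = (1 / 5 : ℝ) • hC 0 + (2 / 5 : ℝ) • hC 1) ∧
    (cell 0 (hC 2) = (1 / 5 : ℝ) • hC 1 + (2 / 5 : ℝ) • hC 2 ∧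
    cell 1 (hC 2) = (1 / 5 : ℝ) • hC 0 + (2 / 5 : ℝ) • hC 2 ∧
    cell 2 (hC 2) = (2 / 5 : ℝ) • hC 0 + (2 / 5 : ℝ) • hC 1 + hC 2) := by
  simp only [cell_hC]
  refine ⟨⟨?_, ?_, ?_⟩, ⟨?_, ?_, ?_⟩, ⟨?_, ?_, ?_⟩⟩ <;> ext x <;>
    simp [child, -mul_eq_mul_right_iff] <;> ring

theorem cell_psiC_values : (cell 0 (psiC 0) = 0 ∧ cell 1 (psiC 0) = hC 2 ∧
    cell 2 (psiC 0) = hC 1) ∧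
    (cell 0 (psiC 1) = hC 2 ∧ cell 1 (psiC 1) = 0 ∧ cell 2 (psiC 1) = hC 0) ∧
    (cell 0 (psiC 2) = hC 1 ∧ cell 1 (psiC 2) = hC 0 ∧ cell 2 (psiC 2) = 0) :=
  ⟨⟨cell_psiC_self 0, cell_psiC (by decide), cell_psiC (by decide)⟩,
    ⟨cell_psiC (by decide), cell_psiC_self 1, cell_psiC (by decide)⟩,
    ⟨cell_psiC (by decide), cell_psiC (by decide), cell_psiC_self 2⟩⟩

theorem meanL_hC (a : Fin 3) : meanL (hC a) = 1 / 3 := by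
  obtain ⟨⟨h00, h10, h20⟩, ⟨h01, h11, h21⟩, ⟨h02, h12, h22⟩⟩ := cell_hC_values
  have e := congrArg meanL hC_sum
  have e0 := meanL_eq (hC 0)
  have e1 := meanL_eq (hC 1)
  have e2 := meanL_eq (hC 2)
  rw [h00, h10, h20] at e0
  rw [h01, h11, h21] at e1
  rw [h02, h12, h22] at e2
  simp only [map_add, map_smul, smul_eq_mul, meanL_one] at e e0 e1 e2
  fin_cases a <;> simp only [Fin.zero_eta, Fin.mk_one, Fin.reduceFinMk] <;> linarith

theorem meanL_psiC (k : Fin 3) : meanL (psiC k) = 2 / 9 := by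
  obtain ⟨⟨h00, h10, h20⟩, ⟨h01, h11, h21⟩, ⟨h02, h12, h22⟩⟩ := cell_psiC_values
  fin_cases k <;> simp only [Fin.zero_eta, Fin.mk_one, Fin.reduceFinMk] <;> rw [meanL_eq] <;>
    simp only [h00, h10, h20, h01, h11, h21, h02, h12, h22, map_zero, meanL_hC] <;> norm_num

theorem meanL_hC_mul_values : (meanL (hC 0 * hC 0) = 7 / 45 ∧ meanL (hC 1 * hC 1) = 7 / 45 ∧
    meanL (hC 2 * hC 2) = 7 / 45) ∧ meanL (hC 0 * hC 1) = 4 / 45 ∧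
    meanL (hC 0 * hC 2) = 4 / 45 ∧ meanL (hC 1 * hC 2) = 4 / 45 := by
  obtain ⟨⟨h00, h10, h20⟩, ⟨h01, h11, h21⟩, ⟨h02, h12, h22⟩⟩ := cell_hC_values
  have c10 : hC 1 * hC 0 = hC 0 * hC 1 := mul_comm _ _
  have c20 : hC 2 * hC 0 = hC 0 * hC 2 := mul_comm _ _
  have c21 : hC 2 * hC 1 = hC 1 * hC 2 := mul_comm _ _
  have e0 := congrArg (fun f => meanL (hC 0 * f)) hC_sum
  have e1 := congrArg (fun f => meanL (hC 1 * f)) hC_sum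
  have e2 := congrArg (fun f => meanL (hC 2 * f)) hC_sum
  have e00 := meanL_eq (hC 0 * hC 0)
  have e11 := meanL_eq (hC 1 * hC 1)
  have e22 := meanL_eq (hC 2 * hC 2)
  simp only [cell_mul, h00, h10, h20, h01, h11, h21, h02, h12, h22, mul_add, add_mul,
    smul_mul_assoc, mul_smul_comm, map_add, map_smul, smul_eq_mul, mul_one, meanL_hC, c10, c20,
    c21] at e0 e1 e2 e00 e11 e22
  generalize meanL (hC 0 * hC 0) = x0 at *
  generalize meanL (hC 1 * hC 1) = x1 at *
  generalize meanL (hC 2 * hC 2) = x2 at *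
  generalize meanL (hC 0 * hC 1) = y2 at *
  generalize meanL (hC 0 * hC 2) = y1 at *
  generalize meanL (hC 1 * hC 2) = y0 at *
  have k2 : y2 = (1 / 3 - x0 - x1 + x2) / 2 := by linarith only [e0, e1, e2]
  have k1 : y1 = (1 / 3 - x0 + x1 - x2) / 2 := by linarith only [e0, e1, e2]
  have k0 : y0 = (1 / 3 + x0 - x1 - x2) / 2 := by linarith only [e0, e1, e2]
  subst k2 k1 k0
  ring_nf at e00 e11 e22
  have z0 : x0 = 7 / 45 := by linarith only [e00, e11, e22]
  have z1 : x1 = 7 / 45 := by linarith only [e00, e11, e22]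
  have z2 : x2 = 7 / 45 := by linarith only [e00, e11, e22]
  subst z0 z1 z2
  norm_num

theorem meanL_hC_sq (a : Fin 3) : meanL (hC a * hC a) = 7 / 45 := by
  obtain ⟨⟨h0, h1, h2⟩, -⟩ := meanL_hC_mul_values
  fin_cases a
  exacts [h0, h1, h2]

theorem meanL_hC_mul {a b : Fin 3} (h : a ≠ b) : meanL (hC a * hC b) = 4 / 45 := by
  obtain ⟨-, h01, h02, h12⟩ := meanL_hC_mul_values
  have h10 : meanL (hC 1 * hC 0) = 4 / 45 := by rw [mul_comm]; exact h01
  have h20 : meanL (hC 2 * hC 0) = 4 / 45 := by rw [mul_comm]; exact h02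
  have h21 : meanL (hC 2 * hC 1) = 4 / 45 := by rw [mul_comm]; exact h12
  fin_cases a <;> fin_cases b <;> first | exact absurd rfl h | assumption

/-! ### Graph Laplacians at vertices -/

/-- At a vertex inside a cell `F_i(SG)`, the graph Laplacian is that of the restriction. -/
theorem graphLaplacian_F (m : ℕ) (u : gasket → ℝ) (i : Fin 3) {x : gasket} (hx : x ∉ V 0) :
    graphLaplacian (m + 1) u (F i x) = graphLaplacian m (u ∘ F i) x := by
  classical
  unfold graphLaplacian
  symm
  refine Finset.sum_bij (fun y _ => F i y) ?_ ?_ ?_ ?_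
  · intro y hy
    simp only [Finset.mem_filter] at hy ⊢
    exact ⟨F_mem_V hy.1 i, (adj_F_iff hx).mpr ⟨y, rfl, hy.2⟩⟩
  · intro y _ z _ h
    exact F_injective i h
  · intro y hy
    simp only [Finset.mem_filter] at hy
    obtain ⟨y', rfl, h⟩ := (adj_F_iff hx).mp hy.2
    exact ⟨y', by simpa using ⟨by simpa using hy.1, h⟩, rfl⟩
  · intro y _
    rfl

/-- The difference `2 u(q_b) - u(F_b^m q_{b+1}) - u(F_b^m q_{b-1})`: the normal derivative at `q_b`
before renormalization and passage to the limit. -/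
def nd (m : ℕ) (b : Fin 3) (u : gasket → ℝ) : ℝ :=
  2 * u (q b) - u ((F b)^[m] (q (b + 1))) - u ((F b)^[m] (q (b - 1)))

theorem wordMap_replicate (m : ℕ) (b : Fin 3) (x : gasket) :
    wordMap (List.replicate m b) x = (F b)^[m] x := by
  induction m with
  | zero => rfl
  | succ m ih => rw [List.replicate_succ, wordMap_cons, ih, Function.iterate_succ_apply']

theorem eq_replicate_of_wordMap_eq_q {w : List (Fin 3)} {b : Fin 3} {x : gasket}
    (h : wordMap w x = q b) : w = List.replicate w.length b ∧ x = q b := by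
  induction w with
  | nil => exact ⟨rfl, h⟩
  | cons i w ih =>
    obtain ⟨rfl, h2⟩ := F_eq_q h
    obtain ⟨h3, h4⟩ := ih h2
    refine ⟨?_, h4⟩
    rw [List.length_cons, List.replicate_succ, ← h3]

theorem iterate_F_q (m : ℕ) (b : Fin 3) : (F b)^[m] (q b) = q b :=
  Function.iterate_fixed (F_q_self b) m

theorem iterate_F_injective (m : ℕ) (b : Fin 3) : Function.Injective (F b)^[m] :=
  (F_injective b).iterate m

/-- The neighbours of the junction point of the cells `F_a(SG)` and `F_b(SG)`: two in each of the
cells. -/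
theorem adj_junction_iff {m : ℕ} {a b : Fin 3} (hab : a ≠ b) {y : gasket} :
    Adj (m + 1) (F a (q b)) y ↔ (∃ d, d ≠ b ∧ y = F a ((F b)^[m] (q d))) ∨
      ∃ d, d ≠ a ∧ y = F b ((F a)^[m] (q d)) := by
  constructor
  · rintro ⟨hne, w, hw, ⟨c, hc⟩, ⟨d, rfl⟩⟩
    cases w with
    | nil => simp at hw
    | cons k w =>
      have hw' : w.length = m := by simpa using hw
      subst hw'
      rw [wordMap_cons] at hc hne ⊢
      by_cases hk : a = k
      · subst hk
        obtain ⟨h1, h2⟩ := eq_replicate_of_wordMap_eq_q (F_injective _ hc).symm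
        left
        rw [h1, wordMap_replicate] at hne
        refine ⟨d, ?_, by rw [← wordMap_replicate, ← h1]⟩
        rintro rfl
        exact hne (by rw [iterate_F_q])
      · obtain ⟨h1, h2⟩ := eq_q_of_F_eq hk hc
        have hbk := q_injective h1
        subst hbk
        obtain ⟨h3, h4⟩ := eq_replicate_of_wordMap_eq_q h2
        right
        rw [h3, wordMap_replicate] at hne
        refine ⟨d, ?_, by rw [← wordMap_replicate, ← h3]⟩
        rintro rfl
        exact hne (by rw [iterate_F_q, F_q_comm])
  · have key : ∀ {a b : Fin 3}, ∀ d, d ≠ b → Adj (m + 1) (F a (q b)) (F a ((F b)^[m] (q d))) := by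
      intro a b d hd
      refine ⟨fun e => ?_, a :: List.replicate m b, by simp, ⟨b, ?_⟩, ⟨d, ?_⟩⟩
      · have h := F_injective a e
        nth_rewrite 1 [← iterate_F_q m b] at h
        exact hd (q_injective (iterate_F_injective m b h)).symm
      · rw [wordMap_cons, wordMap_replicate, iterate_F_q]
      · rw [wordMap_cons, wordMap_replicate]
    rintro (⟨d, hd, rfl⟩ | ⟨d, hd, rfl⟩)
    · exact key d hd
    · rw [F_q_comm]; exact key d hd

theorem iterate_F_mem_V (m : ℕ) (b d : Fin 3) : (F b)^[m] (q d) ∈ V m := by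
  rw [← wordMap_replicate]
  have := wordMap_mem_V (w := List.replicate m b) (q_mem_V_zero d)
  simpa using this

/-- At a junction point of two cells, the graph Laplacian is the sum of the approximate normal
derivatives of the two restrictions, up to sign. -/
theorem graphLaplacian_junction (m : ℕ) (u : gasket → ℝ) {a b : Fin 3} (hab : a ≠ b) :
    graphLaplacian (m + 1) u (F a (q b)) = -(nd m b (u ∘ F a) + nd m a (u ∘ F b)) := by
  classical
  have hadd : ∀ b : Fin 3, b + 1 ≠ b - 1 := by decide
  have hadd1 : ∀ b : Fin 3, b + 1 ≠ b := by decide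
  have hadd2 : ∀ b : Fin 3, b - 1 ≠ b := by decide
  have hcases : ∀ b d : Fin 3, d ≠ b ↔ d = b + 1 ∨ d = b - 1 := by decide
  have hset : (V (m + 1)).filter (Adj (m + 1) (F a (q b))) =
      {F a ((F b)^[m] (q (b + 1))), F a ((F b)^[m] (q (b - 1)))} ∪
        {F b ((F a)^[m] (q (a + 1))), F b ((F a)^[m] (q (a - 1)))} := by
    ext y
    simp only [Finset.mem_filter, adj_junction_iff hab, hcases, Finset.mem_union,
      Finset.mem_insert, Finset.mem_singleton, or_and_right, exists_or, exists_eq_left]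
    constructor
    · exact fun h => h.2
    · refine fun h => ⟨?_, h⟩
      rcases h with (rfl | rfl) | (rfl | rfl) <;> exact F_mem_V (iterate_F_mem_V _ _ _) _
  have hne : ∀ a b : Fin 3, F a ((F b)^[m] (q (b + 1))) ≠ F a ((F b)^[m] (q (b - 1))) := by
    intro a b h
    exact hadd b (q_injective (iterate_F_injective m b (F_injective a h)))
  have hne2 : ∀ d d', d ≠ b → F a ((F b)^[m] (q d)) ≠ F b ((F a)^[m] (q d')) := by
    intro d d' hd h
    have h1 := (eq_q_of_F_eq hab h).1.trans (iterate_F_q m b).symm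
    exact hd (q_injective (iterate_F_injective m b h1))
  have hdisj : Disjoint ({F a ((F b)^[m] (q (b + 1))), F a ((F b)^[m] (q (b - 1)))} : Finset gasket)
      {F b ((F a)^[m] (q (a + 1))), F b ((F a)^[m] (q (a - 1)))} := by
    rw [Finset.disjoint_left]
    intro y hy hy'
    simp only [Finset.mem_insert, Finset.mem_singleton] at hy hy'
    rcases hy with rfl | rfl <;> rcases hy' with h | h <;>
      first | exact hne2 _ _ (hadd1 b) h | exact hne2 _ _ (hadd2 b) h
  unfold graphLaplacian
  rw [hset, Finset.sum_union hdisj, Finset.sum_pair (hne a b), Finset.sum_pair (hne b a)]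
  simp only [nd, Function.comp, F_q_comm b a]
  ring

theorem nd_succ (m : ℕ) (b : Fin 3) (u : gasket → ℝ) : nd (m + 1) b u = nd m b (u ∘ F b) := by
  simp only [nd, Function.iterate_succ_apply', Function.comp, F_q_self]

theorem nd_add (m : ℕ) (b : Fin 3) (u v : gasket → ℝ) : nd m b (u + v) = nd m b u + nd m b v := by
  simp only [nd, Pi.add_apply]; ring

theorem nd_smul (m : ℕ) (b : Fin 3) (r : ℝ) (u : gasket → ℝ) : nd m b (r • u) = r * nd m b u := by
  simp only [nd, Pi.smul_apply, smul_eq_mul]; ring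

theorem harm_comp_F (c : Fin 3 → ℝ) (i : Fin 3) : harm c ∘ F i = harm (child i c) :=
  funext fun x => harm_F c i x

theorem nd_harm (m : ℕ) (b : Fin 3) (c : Fin 3 → ℝ) :
    nd m b (harm c) = (3 / 5) ^ m * (2 * c b - c (b + 1) - c (b - 1)) := by
  induction m generalizing c with
  | zero => simp [nd]
  | succ m ih =>
    rw [nd_succ, harm_comp_F, ih, pow_succ, mul_assoc]
    congr 1
    fin_cases b <;> simp [child, show (-1 : Fin 3) = 2 from rfl, show (2 - 1 : Fin 3) = 1 from rfl,
      show (2 + 1 : Fin 3) = 0 from rfl] <;> ring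

/-- A vertex off the boundary is a vertex inside a cell of level `1`, or a junction point. -/
theorem vertex_cases {m : ℕ} {x : gasket} (hx : x ∈ V (m + 1)) (hx0 : x ∉ V 0) :
    (∃ i, ∃ y ∈ V m, y ∉ V 0 ∧ F i y = x) ∨ ∃ a b, a ≠ b ∧ F a (q b) = x := by
  obtain ⟨i, y, hy, rfl⟩ := mem_V_succ.mp hx
  by_cases h : y ∈ V 0
  · right
    obtain ⟨b, rfl⟩ := mem_V_zero.mp h
    refine ⟨i, b, ?_, rfl⟩
    rintro rfl
    exact hx0 (by simp)
  · exact Or.inl ⟨i, y, hy, h, rfl⟩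

/-- Harmonic functions satisfy the discrete Laplace equation at all levels. -/
theorem graphLaplacian_harm {m : ℕ} (c : Fin 3 → ℝ) {x : gasket} (hx : x ∈ V m) (hx0 : x ∉ V 0) :
    graphLaplacian m (harm c) x = 0 := by
  induction m generalizing c x with
  | zero => exact absurd hx hx0
  | succ m ih =>
    rcases vertex_cases hx hx0 with ⟨i, y, hy, hy0, rfl⟩ | ⟨a, b, hab, rfl⟩
    · rw [graphLaplacian_F m _ i hy0, harm_comp_F]
      exact ih _ hy hy0
    · rw [graphLaplacian_junction m _ hab, harm_comp_F, harm_comp_F, nd_harm, nd_harm, ← mul_add]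
      rw [neg_eq_zero, mul_eq_zero]
      right
      fin_cases a <;> fin_cases b <;> simp at hab <;>
        simp [child, show (-1 : Fin 3) = 2 from rfl, show (2 - 1 : Fin 3) = 1 from rfl,
          show (2 + 1 : Fin 3) = 0 from rfl] <;> ring

theorem graphLaplacian_add (m : ℕ) (u v : gasket → ℝ) (x : gasket) :
    graphLaplacian m (u + v) x = graphLaplacian m u x + graphLaplacian m v x := by
  unfold graphLaplacian
  rw [← Finset.sum_add_distrib]
  refine Finset.sum_congr rfl fun y _ => ?_
  simp only [Pi.add_apply]; ring

theorem graphLaplacian_smul (m : ℕ) (r : ℝ) (u : gasket → ℝ) (x : gasket) :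
    graphLaplacian m (r • u) x = r * graphLaplacian m u x := by
  unfold graphLaplacian
  rw [Finset.mul_sum]
  refine Finset.sum_congr rfl fun y _ => ?_
  simp only [Pi.smul_apply, smul_eq_mul]; ring

/-! ### Green's operator -/

theorem gr_continuous_right (x : gasket) : Continuous (gr x) := by
  have h : Continuous fun y : gasket => (x, y) := by fun_prop
  have h2 := gr_continuous.comp h
  simpa only [Function.comp_def] using h2

theorem gr_continuous_left (y : gasket) : Continuous fun x => gr x y := by
  simp only [gr_comm _ y]
  exact gr_continuous_right y

/-- The function `y ↦ G(x, y)`. -/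
def grC (x : gasket) : C(gasket, ℝ) := ⟨gr x, gr_continuous_right x⟩

@[simp] theorem grC_apply (x y : gasket) : grC x y = gr x y := rfl

theorem greenOp_continuous (f : C(gasket, ℝ)) : Continuous fun x => ∫ y, gr x y * f y ∂μ := by
  refine continuous_of_dominated (bound := fun y => 9 / 20 * |f y|) ?_ ?_ ?_ ?_
  · exact fun x => ((grC x).continuous.mul f.continuous).aestronglyMeasurable
  · intro x
    refine Eventually.of_forall fun y => ?_
    rw [norm_mul, Real.norm_of_nonneg (gr_nonneg x y), Real.norm_eq_abs]
    exact mul_le_mul_of_nonneg_right (gr_le x y) (abs_nonneg _)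
  · exact integrable_of_continuous (continuous_const.mul f.continuous.abs)
  · refine Eventually.of_forall fun y => ?_
    exact (gr_continuous_left y).mul continuous_const

/-- Green's operator `f ↦ ∫ G(·, y) f(y) dμ(y)`. -/
def greenOp : C(gasket, ℝ) →ₗ[ℝ] C(gasket, ℝ) where
  toFun f := ⟨fun x => ∫ y, gr x y * f y ∂μ, greenOp_continuous f⟩
  map_add' f g := by
    ext x
    change meanL (grC x * (f + g)) = meanL (grC x * f) + meanL (grC x * g)
    rw [mul_add, map_add]
  map_smul' r f := by
    ext x
    change meanL (grC x * (r • f)) = r • meanL (grC x * f)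
    rw [mul_smul_comm, map_smul]

theorem greenOp_apply (f : C(gasket, ℝ)) (x : gasket) : greenOp f x = meanL (grC x * f) := rfl

/-- The value of `greenOp f` at `node k`. -/
def nodeValue (f : C(gasket, ℝ)) (k : Fin 3) : ℝ :=
  3 / 50 * (meanL (psiC 0 * f) + meanL (psiC 1 * f) + meanL (psiC 2 * f) +
    2 * meanL (psiC k * f))

/-- The boundary values on `F_i(SG)` of the part of `greenOp f` that is harmonic on cells of
level `1`. -/
def nodeBdry (f : C(gasket, ℝ)) (i j : Fin 3) : ℝ := if j = i then 0 else nodeValue f (-(i + j))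

/-- The function `y ↦ G_0(x, y)`, where `G_0` is the first term of the series of `G`. -/
def gZeroC (x : gasket) : C(gasket, ℝ) :=
  (3 / 50 : ℝ) • ((psi 0 x + psi 1 x + psi 2 x) • (psiC 0 + psiC 1 + psiC 2) +
    (2 : ℝ) • (psi 0 x • psiC 0 + psi 1 x • psiC 1 + psi 2 x • psiC 2))

theorem gZeroC_apply (x y : gasket) : gZeroC x y = gTerm 0 x y := by
  rw [gTerm_zero]
  simp only [gZeroC, ContinuousMap.smul_apply, ContinuousMap.add_apply, psiC_apply, smul_eq_mul]

theorem cell_grC_self (i : Fin 3) (x : gasket) :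
    cell i (grC (F i x)) = cell i (gZeroC (F i x)) + (3 / 5 : ℝ) • grC x := by
  ext y
  simp only [cell_apply, grC_apply, ContinuousMap.add_apply, ContinuousMap.smul_apply,
    gZeroC_apply, smul_eq_mul]
  exact gr_F_self i x y

theorem cell_grC_ne {i j : Fin 3} (h : i ≠ j) (x : gasket) :
    cell j (grC (F i x)) = cell j (gZeroC (F i x)) := by
  ext y
  simp only [cell_apply, grC_apply, gZeroC_apply]
  exact gr_F_ne h x y

theorem greenOp_F_aux (f : C(gasket, ℝ)) (i : Fin 3) (x : gasket) :
    greenOp f (F i x) = meanL (gZeroC (F i x) * f) + 1 / 5 * greenOp (cell i f) x := by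
  rw [greenOp_apply, greenOp_apply, meanL_eq, meanL_eq (gZeroC (F i x) * f)]
  simp only [cell_mul]
  fin_cases i
  · have h0 := cell_grC_self 0 x
    have h1 := cell_grC_ne (show (0 : Fin 3) ≠ 1 by decide) x
    have h2 := cell_grC_ne (show (0 : Fin 3) ≠ 2 by decide) x
    simp only [Fin.zero_eta, h0, h1, h2, add_mul, map_add, smul_mul_assoc, map_smul, smul_eq_mul]
    ring
  · have h0 := cell_grC_ne (show (1 : Fin 3) ≠ 0 by decide) x
    have h1 := cell_grC_self 1 x
    have h2 := cell_grC_ne (show (1 : Fin 3) ≠ 2 by decide) x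
    simp only [Fin.mk_one, h0, h1, h2, add_mul, map_add, smul_mul_assoc, map_smul, smul_eq_mul]
    ring
  · have h0 := cell_grC_ne (show (2 : Fin 3) ≠ 0 by decide) x
    have h1 := cell_grC_ne (show (2 : Fin 3) ≠ 1 by decide) x
    have h2 := cell_grC_self 2 x
    simp only [Fin.reduceFinMk, h0, h1, h2, add_mul, map_add, smul_mul_assoc, map_smul,
      smul_eq_mul]
    ring

theorem meanL_gZeroC (f : C(gasket, ℝ)) (x : gasket) : meanL (gZeroC x * f) =
    psi 0 x * nodeValue f 0 + psi 1 x * nodeValue f 1 + psi 2 x * nodeValue f 2 := by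
  simp only [gZeroC, nodeValue, add_mul, smul_mul_assoc, map_add, map_smul, smul_eq_mul]
  ring

theorem psi_F_values (x : gasket) : (psi 0 (F 0 x) = 0 ∧ psi 1 (F 0 x) = hb 2 x ∧
    psi 2 (F 0 x) = hb 1 x) ∧ (psi 0 (F 1 x) = hb 2 x ∧ psi 1 (F 1 x) = 0 ∧
    psi 2 (F 1 x) = hb 0 x) ∧ (psi 0 (F 2 x) = hb 1 x ∧ psi 1 (F 2 x) = hb 0 x ∧
    psi 2 (F 2 x) = 0) :=
  ⟨⟨psi_F_self 0 x, psi_F (by decide) x, psi_F (by decide) x⟩,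
    ⟨psi_F (by decide) x, psi_F_self 1 x, psi_F (by decide) x⟩,
    ⟨psi_F (by decide) x, psi_F (by decide) x, psi_F_self 2 x⟩⟩

/-- Self-similarity of Green's operator: on a cell of level `1` it is a harmonic function plus
`1 / 5` times Green's operator of the restriction. -/
theorem greenOp_F (f : C(gasket, ℝ)) (i : Fin 3) (x : gasket) :
    greenOp f (F i x) = harm (nodeBdry f i) x + 1 / 5 * greenOp (cell i f) x := by
  rw [greenOp_F_aux, meanL_gZeroC, harm_eq]
  obtain ⟨⟨h00, h10, h20⟩, ⟨h01, h11, h21⟩, ⟨h02, h12, h22⟩⟩ := psi_F_values x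
  congr 1
  have n1 : (-1 : Fin 3) = 2 := rfl
  have n2 : (-2 : Fin 3) = 1 := rfl
  have n3 : (1 + 2 : Fin 3) = 0 := rfl
  have n4 : (2 + 1 : Fin 3) = 0 := rfl
  fin_cases i <;> simp [*, nodeBdry] <;> ring

theorem greenOp_q (f : C(gasket, ℝ)) (i : Fin 3) : greenOp f (q i) = 0 := by
  have h : ∀ m y, gTerm m (q i) y = 0 := by
    intro m y
    refine Finset.sum_eq_zero fun z hz => Finset.sum_eq_zero fun z' _ => ?_
    rw [spl_q, if_neg, mul_zero, zero_mul]
    rintro rfl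
    exact notMem_V_zero_of_mem_newV hz (q_mem_V_zero i)
  have h2 : grC (q i) = 0 := by
    ext y
    simp [gr, h]
  rw [greenOp_apply, h2, zero_mul, map_zero]

theorem greenOp_comp_F (f : C(gasket, ℝ)) (i : Fin 3) :
    greenOp f ∘ F i = harm (nodeBdry f i) + (1 / 5 : ℝ) • ⇑(greenOp (cell i f)) := by
  funext x
  exact greenOp_F f i x

/-- The recursion behind `nd_greenOp`, from the values of the splines on cells of level `1`. -/
theorem meanL_hC_mul_eq (f : C(gasket, ℝ)) (b : Fin 3) :
    nodeBdry f b (b + 1) + nodeBdry f b (b - 1) + 1 / 5 * meanL (hC b * cell b f) =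
      3 / 5 * meanL (hC b * f) := by
  obtain ⟨⟨h00, h10, h20⟩, ⟨h01, h11, h21⟩, ⟨h02, h12, h22⟩⟩ := cell_hC_values
  obtain ⟨⟨p00, p10, p20⟩, ⟨p01, p11, p21⟩, ⟨p02, p12, p22⟩⟩ := cell_psiC_values
  have n1 : (-1 : Fin 3) = 2 := rfl
  have n2 : (-2 : Fin 3) = 1 := rfl
  have n3 : (1 + 2 : Fin 3) = 0 := rfl
  have n4 : (2 + 1 : Fin 3) = 0 := rfl
  have n5 : (2 - 1 : Fin 3) = 1 := rfl
  have n6 : (1 + 1 : Fin 3) = 2 := rfl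
  have e0 := meanL_eq (psiC 0 * f)
  have e1 := meanL_eq (psiC 1 * f)
  have e2 := meanL_eq (psiC 2 * f)
  have eb := meanL_eq (hC b * f)
  simp only [cell_mul, p00, p10, p20, p01, p11, p21, p02, p12, p22, zero_mul, map_zero]
    at e0 e1 e2
  simp only [nodeBdry, nodeValue]
  fin_cases b <;> simp only [cell_mul, h00, h10, h20, h01, h11, h21, h02, h12, h22, add_mul,
    smul_mul_assoc, map_add, map_smul, smul_eq_mul, Fin.zero_eta, Fin.mk_one,
    Fin.reduceFinMk] at eb ⊢ <;> simp [n1, n2, n3, n4, n5, n6] <;> linarith only [e0, e1, e2, eb]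

/-- The difference `nd` of `greenOp f`: this is the Gauss-Green formula for `greenOp f` and the
harmonic function `hb b`. -/
theorem nd_greenOp (m : ℕ) (b : Fin 3) (f : C(gasket, ℝ)) : nd m b (greenOp f) =
    -((3 / 5) ^ m * meanL (hC b * f)) + (1 / 5) ^ m * meanL (hC b * (cell b)^[m] f) := by
  induction m generalizing f with
  | zero => simp [nd, greenOp_q]
  | succ m ih =>
    rw [nd_succ, greenOp_comp_F, nd_add, nd_smul, ih, nd_harm, Function.iterate_succ_apply]
    have h : nodeBdry f b b = 0 := if_pos rfl
    have k := meanL_hC_mul_eq f b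
    rw [h, pow_succ, pow_succ]
    linear_combination (-(3 / 5 : ℝ) ^ m) * k

/-- The harmonic parts of `greenOp f` on the two cells cancel up to integrals of `f` against
harmonic functions: this is where the coefficients of `G` matter. -/
theorem graphLaplacian_greenOp_junction (m : ℕ) (f : C(gasket, ℝ)) {a b : Fin 3} (hab : a ≠ b) :
    graphLaplacian (m + 1) (greenOp f) (F a (q b)) = -((1 / 5) ^ (m + 1) *
      (meanL (hC b * (cell b)^[m] (cell a f)) + meanL (hC a * (cell a)^[m] (cell b f)))) := by
  rw [graphLaplacian_junction m _ hab, greenOp_comp_F, greenOp_comp_F, nd_add, nd_add, nd_smul,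
    nd_smul, nd_greenOp, nd_greenOp, nd_harm, nd_harm]
  have key : 2 * nodeBdry f a b - nodeBdry f a (b + 1) - nodeBdry f a (b - 1) +
      (2 * nodeBdry f b a - nodeBdry f b (a + 1) - nodeBdry f b (a - 1)) =
      1 / 5 * (meanL (hC b * cell a f) + meanL (hC a * cell b f)) := by
    obtain ⟨⟨p00, p10, p20⟩, ⟨p01, p11, p21⟩, ⟨p02, p12, p22⟩⟩ := cell_psiC_values
    have n1 : (-1 : Fin 3) = 2 := rfl
    have n2 : (-2 : Fin 3) = 1 := rfl
    have n3 : (1 + 2 : Fin 3) = 0 := rfl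
    have n4 : (2 + 1 : Fin 3) = 0 := rfl
    have n5 : (2 - 1 : Fin 3) = 1 := rfl
    have n6 : (1 + 1 : Fin 3) = 2 := rfl
    have e0 := meanL_eq (psiC 0 * f)
    have e1 := meanL_eq (psiC 1 * f)
    have e2 := meanL_eq (psiC 2 * f)
    simp only [cell_mul, p00, p10, p20, p01, p11, p21, p02, p12, p22, zero_mul, map_zero]
      at e0 e1 e2
    simp only [nodeBdry, nodeValue]
    fin_cases a <;> fin_cases b <;> simp at hab <;> simp [n1, n2, n3, n4, n5, n6] <;>
      linarith only [e0, e1, e2]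
  rw [pow_succ]
  linear_combination (-(3 / 5 : ℝ) ^ m) * key

/-- If `f` oscillates by at most `ε` on each cell of level `m`, then the renormalized graph
Laplacian of level `m` of `-greenOp f` is within `ε` of `f`. -/
theorem graphLaplacian_greenOp_close {m : ℕ} {f : C(gasket, ℝ)} {ε : ℝ}
    (hf : ∀ w : List (Fin 3), w.length = m → ∀ x y, |f (wordMap w x) - f (wordMap w y)| ≤ ε)
    {x : gasket} (hx : x ∈ V m) (hx0 : x ∉ V 0) :
    |3 / 2 * 5 ^ m * graphLaplacian m (-⇑(greenOp f)) x - f x| ≤ ε := by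
  have hneg : -⇑(greenOp f) = (-1 : ℝ) • ⇑(greenOp f) := by simp
  rw [hneg, graphLaplacian_smul]
  induction m generalizing f x with
  | zero => exact absurd hx hx0
  | succ m ih =>
    rcases vertex_cases hx hx0 with ⟨i, y, hy, hy0, rfl⟩ | ⟨a, b, hab, rfl⟩
    · have h := ih (f := cell i f) (fun w hw x y => hf (i :: w) (by simp [hw]) x y) hy hy0
        (by simp)
      rw [graphLaplacian_F m _ i hy0, greenOp_comp_F, graphLaplacian_add,
        graphLaplacian_harm _ hy hy0, graphLaplacian_smul]
      rw [cell_apply] at h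
      refine le_trans (le_of_eq (congrArg abs ?_)) h
      rw [pow_succ]; ring
    · rw [graphLaplacian_greenOp_junction m f hab]
      have h5 : (5 : ℝ) ^ (m + 1) * (1 / 5) ^ (m + 1) = 1 := by
        rw [← mul_pow]; norm_num
      have hcell : ∀ (a b : Fin 3) (y : gasket), (cell b)^[m] (cell a f) y =
          f (F a ((F b)^[m] y)) := by
        intro a b y
        rw [iterate_cell_apply]; rfl
      have key : ∀ a b : Fin 3, |meanL (hC b * (cell b)^[m] (cell a f)) - 1 / 3 * f (F a (q b))|
          ≤ 1 / 3 * ε := by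
        intro a b
        have e : meanL (hC b * (cell b)^[m] (cell a f)) - 1 / 3 * f (F a (q b)) =
            meanL (hC b * ((cell b)^[m] (cell a f) - f (F a (q b)) • 1)) := by
          rw [mul_sub, map_sub, mul_smul_comm, map_smul, mul_one, meanL_hC, smul_eq_mul]
          ring
        rw [e, meanL_apply]
        have hbd : ∀ y, |(cell b)^[m] (cell a f) y - f (F a (q b))| ≤ ε := by
          intro y
          rw [hcell]
          have := hf (a :: List.replicate m b) (by simp) y (q b)
          rwa [wordMap_cons, wordMap_cons, wordMap_replicate, wordMap_replicate, iterate_F_q]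
            at this
        calc |∫ y, (hC b * ((cell b)^[m] (cell a f) - f (F a (q b)) • 1)) y ∂μ|
            ≤ ∫ y, |(hC b * ((cell b)^[m] (cell a f) - f (F a (q b)) • 1)) y| ∂μ :=
              abs_integral_le_integral_abs
          _ ≤ ∫ y, (ε • hC b) y ∂μ := by
              refine integral_mono (integrable_of_continuous (ContinuousMap.continuous _).abs)
                (integrable_of_continuous (ContinuousMap.continuous _)) fun y => ?_
              have h0 := hb_nonneg b y
              simp only [ContinuousMap.mul_apply, hC_apply, ContinuousMap.sub_apply,
                ContinuousMap.smul_apply, ContinuousMap.one_apply, smul_eq_mul, mul_one]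
              rw [abs_mul, abs_of_nonneg h0, mul_comm]
              exact mul_le_mul_of_nonneg_right (hbd y) h0
          _ = 1 / 3 * ε := by
              rw [← meanL_apply, map_smul, meanL_hC, smul_eq_mul, mul_comm]
      have k1 := abs_le.mp (key a b)
      have k2 := abs_le.mp (key b a)
      rw [F_q_comm b a] at k2
      set M1 := meanL (hC b * (cell b)^[m] (cell a f))
      set M2 := meanL (hC a * (cell a)^[m] (cell b f))
      have e : 3 / 2 * 5 ^ (m + 1) * (-1 * -((1 / 5) ^ (m + 1) * (M1 + M2))) - f (F a (q b)) =
          3 / 2 * (M1 + M2) - f (F a (q b)) := by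
        linear_combination 3 / 2 * (M1 + M2) * h5
      rw [e, abs_le]
      constructor <;> linarith

/-! ### The Laplacian: uniqueness and Green's operator -/

theorem V_mono : Monotone V := monotone_nat_of_le_succ V_subset_succ

theorem HasLaplacian.add {u v f g : gasket → ℝ} (hu : HasLaplacian u f) (hv : HasLaplacian v g) :
    HasLaplacian (u + v) (f + g) := by
  refine ⟨hu.1.add hv.1, hu.2.1.add hv.2.1, fun ε hε => ?_⟩
  obtain ⟨M, hM⟩ := hu.2.2 (ε / 2) (half_pos hε)
  obtain ⟨N, hN⟩ := hv.2.2 (ε / 2) (half_pos hε)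
  refine ⟨max M N, fun m hm x hx hx0 => ?_⟩
  have h1 := abs_lt.mp (hM m (le_of_max_le_left hm) x hx hx0)
  have h2 := abs_lt.mp (hN m (le_of_max_le_right hm) x hx hx0)
  rw [graphLaplacian_add, Pi.add_apply, mul_add, abs_lt]
  constructor <;> linarith

theorem HasLaplacian.smul {u f : gasket → ℝ} (hu : HasLaplacian u f) (r : ℝ) :
    HasLaplacian (r • u) (r • f) := by
  refine ⟨hu.1.const_smul r, hu.2.1.const_smul r, fun ε hε => ?_⟩
  have hr : 0 < |r| + 1 := by positivity
  obtain ⟨M, hM⟩ := hu.2.2 (ε / (|r| + 1)) (div_pos hε hr)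
  refine ⟨M, fun m hm x hx hx0 => ?_⟩
  have h1 := hM m hm x hx hx0
  have e : 3 / 2 * 5 ^ m * graphLaplacian m (r • u) x - (r • f) x =
      r * (3 / 2 * 5 ^ m * graphLaplacian m u x - f x) := by
    rw [graphLaplacian_smul, Pi.smul_apply, smul_eq_mul]; ring
  rw [e, abs_mul]
  rw [lt_div_iff₀ hr] at h1
  nlinarith [abs_nonneg (3 / 2 * 5 ^ m * graphLaplacian m u x - f x)]

theorem HasLaplacian.neg {u f : gasket → ℝ} (hu : HasLaplacian u f) : HasLaplacian (-u) (-f) := by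
  have := hu.smul (-1)
  simpa using this

theorem HasLaplacian.sub {u v f g : gasket → ℝ} (hu : HasLaplacian u f) (hv : HasLaplacian v g) :
    HasLaplacian (u - v) (f - g) := by
  rw [sub_eq_add_neg, sub_eq_add_neg]
  exact hu.add hv.neg

theorem HasLaplacian.unique {u f g : gasket → ℝ} (hf : HasLaplacian u f) (hg : HasLaplacian u g) :
    f = g := by
  refine eq_of_eq_on_vertices hf.2.1 hg.2.1 fun k x hx hx0 => ?_
  by_contra hne
  have hpos : 0 < |f x - g x| / 2 := half_pos (abs_pos.mpr (sub_ne_zero.mpr hne))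
  obtain ⟨M, hM⟩ := hf.2.2 _ hpos
  obtain ⟨N, hN⟩ := hg.2.2 _ hpos
  let m := max k (max M N)
  have hxm : x ∈ V m := V_mono (le_max_left _ _) hx
  have h1 := hM m ((le_max_left M N).trans (le_max_right _ _)) x hxm hx0
  have h2 := hN m ((le_max_right M N).trans (le_max_right _ _)) x hxm hx0
  set A := 3 / 2 * 5 ^ m * graphLaplacian m u x
  have h3 : |f x - g x| ≤ |A - f x| + |A - g x| := by
    have := abs_sub (A - g x) (A - f x)
    have e : A - g x - (A - f x) = f x - g x := by ring
    rw [e] at this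
    linarith
  linarith

theorem HasLaplacian.comp_F {u f : gasket → ℝ} (hu : HasLaplacian u f) (i : Fin 3) :
    HasLaplacian (u ∘ F i) ((1 / 5 : ℝ) • (f ∘ F i)) := by
  refine ⟨hu.1.comp (F_continuous i), (hu.2.1.comp (F_continuous i)).const_smul _, fun ε hε => ?_⟩
  obtain ⟨M, hM⟩ := hu.2.2 ε hε
  refine ⟨M, fun m hm x hx hx0 => ?_⟩
  have h := hM (m + 1) (hm.trans (Nat.le_succ m)) (F i x) (F_mem_V hx i) (F_notMem_V_zero hx0)
  rw [graphLaplacian_F m u i hx0] at h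
  have e : 3 / 2 * 5 ^ (m + 1) * graphLaplacian m (u ∘ F i) x - f (F i x) =
      5 * (3 / 2 * 5 ^ m * graphLaplacian m (u ∘ F i) x - ((1 / 5 : ℝ) • (f ∘ F i)) x) := by
    simp only [Pi.smul_apply, Function.comp, smul_eq_mul]; ring
  rw [e, abs_mul, abs_of_pos (by norm_num : (0 : ℝ) < 5)] at h
  linarith [abs_nonneg (3 / 2 * 5 ^ m * graphLaplacian m (u ∘ F i) x -
    ((1 / 5 : ℝ) • (f ∘ F i)) x)]

theorem hasLaplacian_harm (c : Fin 3 → ℝ) : HasLaplacian (harm c) 0 := by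
  refine ⟨harm_continuous c, continuous_zero, fun ε hε => ⟨0, fun m _ x hx hx0 => ?_⟩⟩
  rw [graphLaplacian_harm c hx hx0]
  simpa using hε

/-- `-greenOp f` solves `Δ u = f` with zero boundary values. -/
theorem hasLaplacian_greenOp (f : C(gasket, ℝ)) : HasLaplacian (-⇑(greenOp f)) f := by
  refine ⟨(greenOp f).continuous.neg, f.continuous, fun ε hε => ?_⟩
  obtain ⟨M, hM⟩ := exists_osc_lt f.continuous (half_pos hε)
  refine ⟨M, fun m hm x hx hx0 => ?_⟩
  refine lt_of_le_of_lt (graphLaplacian_greenOp_close (fun w hw x y => ?_) hx hx0) (half_lt_self hε)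
  exact (hM m hm w hw x y).le

theorem nodeValue_one (k : Fin 3) : nodeValue 1 k = 1 / 15 := by
  simp only [nodeValue, mul_one, meanL_psiC]; norm_num

theorem greenOp_nonneg {f : C(gasket, ℝ)} (hf : ∀ x, 0 ≤ f x) (x : gasket) : 0 ≤ greenOp f x :=
  integral_nonneg fun y => mul_nonneg (gr_nonneg x y) (hf y)

/-- By self-similarity the maximum `M` of `greenOp 1` satisfies `M ≤ M / 5 + 1 / 15`. -/
theorem greenOp_one_le (x : gasket) : greenOp 1 x ≤ 1 / 12 := by
  obtain ⟨z, -, hz⟩ := isCompact_univ.exists_isMaxOn (Set.univ_nonempty (α := gasket))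
    (greenOp 1).continuous.continuousOn
  have hmax : ∀ y, greenOp 1 y ≤ greenOp 1 z := fun y => hz (Set.mem_univ y)
  obtain ⟨i, y, rfl⟩ := exists_F z
  have h1 := hmax y
  have h2 := hmax x
  have hcell : cell i 1 = 1 := rfl
  have h3 : harm (nodeBdry 1 i) y ≤ 1 / 15 := by
    refine (harm_bounds (A := 0) (fun j => ?_) y).2
    rw [nodeBdry, nodeValue_one]
    split_ifs <;> norm_num
  rw [greenOp_F, hcell] at h1 h2
  linarith

/-- The discrete maximum principle for strictly subharmonic functions. -/
theorem le_zero_of_graphLaplacian_pos {m : ℕ} {u : gasket → ℝ}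
    (h : ∀ x ∈ V m, x ∉ V 0 → 0 < graphLaplacian m u x) (h0 : ∀ i, u (q i) ≤ 0) :
    ∀ x ∈ V m, u x ≤ 0 := by
  classical
  obtain ⟨z, hz, hmax⟩ := (V m).exists_max_image u ⟨q 0, q_mem_V m 0⟩
  have hz0 : u z ≤ 0 := by
    by_cases hzV : z ∈ V 0
    · obtain ⟨i, rfl⟩ := mem_V_zero.mp hzV
      exact h0 i
    · exfalso
      have h1 := h z hz hzV
      have h2 : graphLaplacian m u z ≤ 0 := by
        refine Finset.sum_nonpos fun y hy => ?_
        linarith [hmax y (Finset.mem_filter.mp hy).1]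
      linarith
  exact fun x hx => (hmax x hx).trans hz0

theorem HasLaplacian.le_zero {u : gasket → ℝ} (hu : HasLaplacian u 0) (h0 : ∀ i, u (q i) = 0)
    {k : ℕ} {x : gasket} (hx : x ∈ V k) : u x ≤ 0 := by
  refine le_of_forall_pos_le_add fun ε hε => ?_
  obtain ⟨M, hM⟩ := hu.2.2 ε hε
  set m := max k M
  set g : gasket → ℝ := -⇑(greenOp 1)
  have hg : ∀ y ∈ V m, y ∉ V 0 → 3 / 2 * 5 ^ m * graphLaplacian m g y = 1 := by
    intro y hy hy0
    -- A constant has no oscillation, so the discrete equation is exact.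
    have := graphLaplacian_greenOp_close (m := m) (f := 1) (ε := 0) (fun w _ x y => by simp) hy hy0
    simpa [sub_eq_zero] using this
  -- `ε • g` is a barrier: it makes `u + ε • g` strictly subharmonic.
  have key := le_zero_of_graphLaplacian_pos (m := m) (u := u + ε • g) (fun y hy hy0 => by
    have h1 := (abs_lt.mp (hM m (le_max_right _ _) y hy hy0)).1
    have h2 := hg y hy hy0
    rw [Pi.zero_apply, sub_zero] at h1
    have h3 : 0 < 3 / 2 * 5 ^ m * graphLaplacian m (u + ε • g) y := by
      rw [graphLaplacian_add, graphLaplacian_smul]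
      have : 3 / 2 * 5 ^ m * (graphLaplacian m u y + ε * graphLaplacian m g y) =
        3 / 2 * 5 ^ m * graphLaplacian m u y + ε * (3 / 2 * 5 ^ m * graphLaplacian m g y) := by ring
      rw [this, h2]
      linarith
    exact (mul_pos_iff_of_pos_left (by positivity)).mp h3)
    (fun i => by simp [g, h0, greenOp_q]) x (V_mono (le_max_left _ _) hx)
  simp only [g, Pi.add_apply, Pi.smul_apply, Pi.neg_apply, smul_eq_mul] at key
  have h1 := greenOp_one_le x
  nlinarith

/-- The Dirichlet problem has at most one solution. -/
theorem HasLaplacian.eq_zero {u : gasket → ℝ} (hu : HasLaplacian u 0) (h0 : ∀ i, u (q i) = 0) :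
    u = 0 := by
  refine eq_of_eq_on_vertices hu.1 continuous_zero fun k x hx _ => ?_
  refine le_antisymm (hu.le_zero h0 hx) ?_
  have := hu.neg
  rw [neg_zero] at this
  have h2 := this.le_zero (fun i => by simp [h0]) hx
  simp only [Pi.neg_apply] at h2
  simp only [Pi.zero_apply]
  linarith

theorem HasLaplacian.eq_harm {u : gasket → ℝ} (hu : HasLaplacian u 0) :
    u = harm fun i => u (q i) := by
  have h := hu.sub (hasLaplacian_harm fun i => u (q i))
  rw [sub_zero] at h
  exact sub_eq_zero.mp (h.eq_zero fun i => by simp)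

/-- A solution of `Δ u = f` differs from `-greenOp f` by the harmonic function with the same
boundary values. -/
theorem HasLaplacian.eq_greenOp {u : gasket → ℝ} {f : C(gasket, ℝ)} (hu : HasLaplacian u f) :
    u = harm (fun i => u (q i)) - ⇑(greenOp f) := by
  have h := hu.sub (hasLaplacian_greenOp f)
  rw [sub_self] at h
  have h2 := h.eq_harm
  have h3 : (fun i => (u - -⇑(greenOp f)) (q i)) = fun i => u (q i) := by
    funext i; simp [greenOp_q]
  rw [h3] at h2
  rw [← h2]
  abel

theorem isSpline_spl (m : ℕ) (z : gasket) : IsSpline m z (spl m z) := by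
  refine ⟨spl_continuous m z, fun x hx => ?_, fun w hw => ?_⟩
  · rw [spl_vertex m z hx]
  · obtain ⟨c, hc⟩ := spl_wordMap m z hw
    rw [hc]
    exact hasLaplacian_harm c

theorem IsSpline.unique {m : ℕ} {z : gasket} {φ ψ : gasket → ℝ} (hφ : IsSpline m z φ)
    (hψ : IsSpline m z ψ) : φ = ψ := by
  funext x
  obtain ⟨w, hw, y, rfl⟩ := exists_wordMap m x
  have h := (hφ.2.2 w hw).sub (hψ.2.2 w hw)
  rw [sub_zero] at h
  have h2 := congrFun (h.eq_zero fun i => ?_) y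
  · simpa [sub_eq_zero] using h2
  · have hm : wordMap w (q i) ∈ V m := by
      have := wordMap_mem_V (w := w) (q_mem_V_zero i)
      rwa [hw] at this
    simp only [Pi.sub_apply, Function.comp, hφ.2.1 _ hm, hψ.2.1 _ hm, sub_self]

theorem spline_eq (m : ℕ) (z : gasket) : spline m z = spl m z :=
  (Classical.epsilon_spec (p := IsSpline m z) ⟨_, isSpline_spl m z⟩).unique (isSpline_spl m z)

/-- The limit that defines `green` exists, and is the sum of the series `gr`. -/
theorem green_eq : green = gr := by
  have h : ∀ M x y, greenPartial M x y = ∑ m ∈ Finset.range (M + 1), gTerm m x y := by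
    intro M x y
    simp only [greenPartial, spline_eq]
    rfl
  funext x y
  unfold green
  simp only [h]
  exact ((gTerm_summable x y).hasSum.tendsto_sum_nat.comp (tendsto_add_atTop_nat 1)).limUnder_eq

/-! ### Reflections -/

/-- The transposition of the indices other than `n`. -/
def swp (n i : Fin 3) : Fin 3 := -(n + i)

theorem swp_swp (n i : Fin 3) : swp n (swp n i) = i := by revert n i; decide

theorem swp_eq_iff (n i j : Fin 3) : swp n i = j ↔ i = swp n j := by revert n i j; decide

theorem swp_self (n : Fin 3) : swp n n = n := by revert n; decide

theorem swp_add (n : Fin 3) : swp n (n + 1) = n - 1 := by revert n; decide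

theorem bary_combination (c : Fin 3 → ℝ) (hc : c 0 + c 1 + c 2 = 1) (i : Fin 3) :
    bary i (c 0 • corner 0 + c 1 • corner 1 + c 2 • corner 2) = c i := by
  have h : Real.sqrt 3 ≠ 0 := by positivity
  fin_cases i <;> simp [bary, corner] <;> field_simp <;> linarith

/-- The reflection of the plane that fixes `q_n` and exchanges the other two boundary points. -/
def planeRefl (n : Fin 3) (x : Plane) : Plane :=
  bary (swp n 0) x • corner 0 + bary (swp n 1) x • corner 1 + bary (swp n 2) x • corner 2

theorem bary_planeRefl (n i : Fin 3) (x : Plane) :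
    bary i (planeRefl n x) = bary (swp n i) x := by
  refine bary_combination (fun k => bary (swp n k) x) ?_ i
  have h := bary_sum x
  fin_cases n <;> simp [swp, show (-1 : Fin 3) = 2 from rfl, show (-2 : Fin 3) = 1 from rfl,
    show (1 + 2 : Fin 3) = 0 from rfl, show (2 + 1 : Fin 3) = 0 from rfl] <;> linarith

theorem planeRefl_continuous (n : Fin 3) : Continuous (planeRefl n) := by
  unfold planeRefl
  exact (((bary_continuous _).smul continuous_const).add
    ((bary_continuous _).smul continuous_const)).add ((bary_continuous _).smul continuous_const)

theorem planeRefl_planeMap (n j : Fin 3) (x : Plane) :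
    planeRefl n (planeMap j x) = planeMap (swp n j) (planeRefl n x) := by
  refine bary_ext fun i => ?_
  rw [bary_planeRefl, bary_planeMap, bary_planeMap, bary_planeRefl]
  simp only [swp_eq_iff]

/-- The largest distance of a point `planeRefl n x`, `x ∈ SG`, from the gasket is at most half of
itself. -/
theorem planeRefl_mem (n : Fin 3) {x : Plane} (hx : x ∈ gasket) : planeRefl n x ∈ gasket := by
  obtain ⟨m, hm, hmax⟩ := gasket_isCompact.exists_isMaxOn gasket_nonempty
    ((Metric.continuous_infDist_pt gasket).comp (planeRefl_continuous n)).continuousOn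
  have hmax' : ∀ y ∈ gasket, Metric.infDist (planeRefl n y) gasket ≤
      Metric.infDist (planeRefl n m) gasket := fun y hy => hmax hy
  have hhalf : ∀ j a, Metric.infDist (planeMap j a) gasket ≤ 1 / 2 * Metric.infDist a gasket := by
    intro j a
    obtain ⟨g, hg, e⟩ := gasket_isCompact.exists_infDist_eq_dist gasket_nonempty a
    refine (Metric.infDist_le_dist_of_mem (planeMap_mem j hg)).trans (le_of_eq ?_)
    rw [e]
    simp only [planeMap, dist_add_right, dist_smul₀, dist_sub_right]
    norm_num
  have h0 : Metric.infDist (planeRefl n m) gasket ≤ 0 := by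
    obtain ⟨j, y, hy⟩ := exists_F ⟨m, hm⟩
    have hy' : m = planeMap j y := (congrArg Subtype.val hy).symm
    have h1 := hmax' y y.2
    have h2 := hhalf (swp n j) (planeRefl n y)
    rw [← planeRefl_planeMap, ← hy'] at h2
    linarith
  rw [gasket_isCompact.isClosed.mem_iff_infDist_zero gasket_nonempty]
  exact le_antisymm ((hmax' x hx).trans h0) Metric.infDist_nonneg

/-- The reflection of the gasket that fixes `q_n`. -/
def refl (n : Fin 3) (x : gasket) : gasket := ⟨planeRefl n x, planeRefl_mem n x.2⟩

theorem refl_continuous (n : Fin 3) : Continuous (refl n) :=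
  ((planeRefl_continuous n).comp continuous_subtype_val).subtype_mk _

theorem bary_refl (n i : Fin 3) (x : gasket) : bary i (refl n x) = bary (swp n i) x :=
  bary_planeRefl n i x

theorem refl_F (n j : Fin 3) (x : gasket) : refl n (F j x) = F (swp n j) (refl n x) :=
  Subtype.ext (planeRefl_planeMap n j x)

theorem refl_q (n i : Fin 3) : refl n (q i) = q (swp n i) := by
  refine gasket_ext fun j => ?_
  rw [bary_refl, bary_q, bary_q]
  simp only [swp_eq_iff]

theorem refl_refl (n : Fin 3) (x : gasket) : refl n (refl n x) = x := by
  refine gasket_ext fun j => ?_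
  rw [bary_refl, bary_refl, swp_swp]

theorem refl_injective (n : Fin 3) : Function.Injective (refl n) :=
  Function.LeftInverse.injective (refl_refl n)

theorem refl_wordMap (n : Fin 3) (w : List (Fin 3)) (x : gasket) :
    refl n (wordMap w x) = wordMap (w.map (swp n)) (refl n x) := by
  induction w with
  | nil => rfl
  | cons i w ih => rw [wordMap_cons, refl_F, ih, List.map_cons, wordMap_cons]

theorem refl_mem_V (n : Fin 3) {m : ℕ} {x : gasket} (hx : x ∈ V m) : refl n x ∈ V m := by
  induction m generalizing x with
  | zero =>
    obtain ⟨i, rfl⟩ := mem_V_zero.mp hx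
    rw [refl_q]; exact q_mem_V_zero _
  | succ m ih =>
    obtain ⟨i, y, hy, rfl⟩ := mem_V_succ.mp hx
    rw [refl_F]; exact F_mem_V (ih hy) _

theorem refl_notMem_V_zero (n : Fin 3) {x : gasket} (hx : x ∉ V 0) : refl n x ∉ V 0 := by
  intro h
  have := refl_mem_V n h
  rw [refl_refl] at this
  exact hx this

theorem Adj.refl (n : Fin 3) {m : ℕ} {x y : gasket} (h : Adj m x y) :
    Adj m (refl n x) (refl n y) := by
  obtain ⟨hne, w, hw, ⟨i, rfl⟩, ⟨j, rfl⟩⟩ := h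
  exact ⟨fun e => hne (refl_injective n e), w.map (swp n), by simp [hw],
    ⟨_, by rw [refl_wordMap, refl_q]⟩, ⟨_, by rw [refl_wordMap, refl_q]⟩⟩

theorem graphLaplacian_comp_refl (n : Fin 3) (m : ℕ) (u : gasket → ℝ) (x : gasket) :
    graphLaplacian m (u ∘ refl n) x = graphLaplacian m u (refl n x) := by
  classical
  unfold graphLaplacian
  refine Finset.sum_bij' (fun y _ => refl n y) (fun y _ => refl n y) ?_ ?_ ?_ ?_ ?_
  · intro y hy
    simp only [Finset.mem_filter] at hy ⊢
    exact ⟨refl_mem_V n hy.1, hy.2.refl n⟩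
  · intro y hy
    simp only [Finset.mem_filter] at hy ⊢
    refine ⟨refl_mem_V n hy.1, ?_⟩
    have := hy.2.refl n
    rwa [refl_refl] at this
  · intro y _; exact refl_refl n y
  · intro y _; exact refl_refl n y
  · intro y _; rfl

theorem HasLaplacian.comp_refl {u f : gasket → ℝ} (h : HasLaplacian u f) (n : Fin 3) :
    HasLaplacian (u ∘ refl n) (f ∘ refl n) := by
  refine ⟨h.1.comp (refl_continuous n), h.2.1.comp (refl_continuous n), fun ε hε => ?_⟩
  obtain ⟨M, hM⟩ := h.2.2 ε hε
  refine ⟨M, fun m hm x hx hx0 => ?_⟩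
  rw [graphLaplacian_comp_refl]
  exact hM m hm _ (refl_mem_V n hx) (refl_notMem_V_zero n hx0)

/-! ### Monomials as eigenfunctions of the contraction `F_n` -/

theorem harm_comp_refl (c : Fin 3 → ℝ) (n : Fin 3) : harm c ∘ refl n = harm (c ∘ swp n) := by
  have h := (hasLaplacian_harm c).comp_refl n
  rw [Pi.zero_comp] at h
  rw [h.eq_harm]
  congr 1
  funext i
  simp [refl_q]

/-- The boundary values of the harmonic monomial `P_{0i}^{(n)}`. -/
def bvals (n : Fin 3) (i : ℕ) (j : Fin 3) : ℝ :=
  if i = 1 then 1 else if j = n then 0 else if i = 2 then -1 / 2 else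
    if j = n + 1 then 1 / 2 else -1 / 2

/-- The scaling factor `s` in `P_{0i}^{(n)} ∘ F_n = s P_{0i}^{(n)}`. -/
def scale (i : ℕ) : ℝ := if i = 1 then 1 else if i = 2 then 3 / 5 else 1 / 5

/-- The parity of `P_{ji}^{(n)}` under the reflection that fixes `q_n`. -/
def parity (i : ℕ) : ℝ := if i = 3 then -1 else 1

/-- The scaling factor under `F_n` of the harmonic functions that vanish at `q_n` and have the
parity of `P_{ji}^{(n)}`. -/
def scaleBdry (i : ℕ) : ℝ := if i = 3 then 1 / 5 else 3 / 5

/-- The functions `P_{ji}^{(n)}`, see `monomial_eq`. The harmonic summand is chosen such that the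
function is an eigenfunction of composition with `F_n`; for `i = 1, 2, 3` the number inverted there
is nonzero, see `scale_ne`. -/
def mono (n : Fin 3) (i : ℕ) : ℕ → C(gasket, ℝ)
  | 0 => ⟨harm (bvals n i), harm_continuous _⟩
  | j + 1 => -greenOp (mono n i j) + (scale i * (1 / 5) ^ (j + 1) - scaleBdry i)⁻¹ •
      ⟨harm fun a => -greenOp (mono n i j) (F n (q a)), harm_continuous _⟩

theorem hasLaplacian_mono (n : Fin 3) (i j : ℕ) :
    HasLaplacian (mono n i (j + 1)) (mono n i j) := by
  have h := (hasLaplacian_greenOp (mono n i j)).add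
    ((hasLaplacian_harm fun a => -greenOp (mono n i j) (F n (q a))).smul
      (scale i * (1 / 5) ^ (j + 1) - scaleBdry i)⁻¹)
  rw [smul_zero, add_zero] at h
  exact h

theorem greenOp_comp_refl {f : C(gasket, ℝ)} {n : Fin 3} {σ : ℝ}
    (hf : ⇑f ∘ refl n = σ • ⇑f) : ⇑(greenOp f) ∘ refl n = σ • ⇑(greenOp f) := by
  have h1 := (hasLaplacian_greenOp f).comp_refl n
  have h2 := (hasLaplacian_greenOp f).smul σ
  rw [hf] at h1
  have h3 := h1.sub h2
  rw [sub_self] at h3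
  have h4 := sub_eq_zero.mp (h3.eq_zero fun i => by simp [refl_q, greenOp_q])
  funext x
  have h5 := congrFun h4 x
  simp only [Function.comp, Pi.neg_apply, Pi.smul_apply, smul_eq_mul] at h5 ⊢
  linarith

theorem cases_of_fin (n j : Fin 3) : j = n ∨ j = n + 1 ∨ j = n - 1 := by revert n j; decide

/-- A harmonic function that vanishes at `q_n` and is symmetric or antisymmetric there is an
eigenfunction of composition with `F_n`. -/
theorem child_eq_scaleBdry_smul {n : Fin 3} {i : ℕ} {c : Fin 3 → ℝ} (h0 : c n = 0)
    (h : c (n - 1) = parity i * c (n + 1)) : child n c = scaleBdry i • c := by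
  have n1 : (-1 : Fin 3) = 2 := rfl
  have n4 : (2 + 1 : Fin 3) = 0 := rfl
  have n5 : (2 - 1 : Fin 3) = 1 := rfl
  have n6 : (1 + 1 : Fin 3) = 2 := rfl
  funext j
  unfold child scaleBdry
  unfold parity at h
  by_cases hi : i = 3
  · rw [if_pos hi] at h
    fin_cases n <;> fin_cases j <;> simp [n1, n4, n5, n6] at h h0 <;>
      simp [hi, h0, h] <;> ring
  · rw [if_neg hi] at h
    fin_cases n <;> fin_cases j <;> simp [n1, n4, n5, n6] at h h0 <;>
      simp [hi, h0, h] <;> ring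

theorem scale_ne (i j : ℕ) (hi : i = 1 ∨ i = 2 ∨ i = 3) :
    scale i * (1 / 5) ^ (j + 1) - scaleBdry i ≠ 0 := by
  have h1 : (1 / 5 : ℝ) ^ (j + 1) ≤ 1 / 5 := by
    rw [pow_succ]
    have : (1 / 5 : ℝ) ^ j ≤ 1 := pow_le_one₀ (by norm_num) (by norm_num)
    linarith
  have h0 : (0 : ℝ) < (1 / 5 : ℝ) ^ (j + 1) := by positivity
  rcases hi with rfl | rfl | rfl <;> norm_num [scale, scaleBdry] <;> intro h <;>
    norm_num at h h0 h1 <;> linarith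

/-- The functions `mono n i j` have a parity under reflection, and are eigenfunctions of composition
with `F_n`. -/
theorem mono_symm (n : Fin 3) {i : ℕ} (hi : i = 1 ∨ i = 2 ∨ i = 3) (j : ℕ) :
    ⇑(mono n i j) ∘ refl n = parity i • ⇑(mono n i j) ∧
      ⇑(mono n i j) ∘ F n = (scale i * (1 / 5) ^ j) • ⇑(mono n i j) := by
  have n1 : (-1 : Fin 3) = 2 := rfl
  have n2 : (-2 : Fin 3) = 1 := rfl
  have n3 : (1 + 2 : Fin 3) = 0 := rfl
  have n4 : (2 + 1 : Fin 3) = 0 := rfl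
  have n5 : (2 - 1 : Fin 3) = 1 := rfl
  have n6 : (1 + 1 : Fin 3) = 2 := rfl
  induction j with
  | zero =>
    change harm (bvals n i) ∘ refl n = parity i • harm (bvals n i) ∧
      harm (bvals n i) ∘ F n = (scale i * (1 / 5) ^ 0) • harm (bvals n i)
    rw [harm_comp_refl, harm_comp_F, ← harm_smul, ← harm_smul]
    constructor <;> congr 1 <;> funext j <;> rcases hi with rfl | rfl | rfl <;>
      fin_cases n <;> fin_cases j <;>
      simp [bvals, parity, scale, child, swp, n1, n2, n3, n4, n6] <;> norm_num
  | succ j ih =>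
    obtain ⟨ih1, ih2⟩ := ih
    set f := mono n i j with hf
    set α := (scale i * (1 / 5) ^ (j + 1) - scaleBdry i)⁻¹ with hα
    set c : Fin 3 → ℝ := fun a => -greenOp f (F n (q a)) with hc
    have hg := greenOp_comp_refl ih1
    have hc0 : c n = 0 := by simp [hc, greenOp_q]
    have hcs : ∀ a, c (swp n a) = parity i * c a := by
      intro a
      have := congrFun hg (F n (q a))
      simp only [Function.comp, refl_F, refl_q, swp_self, Pi.smul_apply, smul_eq_mul] at this
      simp only [hc, this]; ring
    have hc1 : c (n - 1) = parity i * c (n + 1) := by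
      rw [← hcs, swp_add]
    have hu : ⇑(mono n i (j + 1)) = -⇑(greenOp f) + α • harm c := rfl
    have hFc : harm c ∘ F n = scaleBdry i • harm c := by
      rw [harm_comp_F, child_eq_scaleBdry_smul hc0 hc1, harm_smul]
    have hRc : harm c ∘ refl n = parity i • harm c := by
      rw [harm_comp_refl, ← harm_smul]
      congr 1
      exact funext hcs
    have hgF : (-⇑(greenOp f)) ∘ F n = (scale i * (1 / 5) ^ (j + 1)) • (-⇑(greenOp f)) +
        harm c := by
      have h1 := (hasLaplacian_greenOp f).comp_F n
      have h2 := (hasLaplacian_greenOp f).smul (scale i * (1 / 5) ^ (j + 1))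
      have h3 := h1.sub h2
      rw [ih2, smul_smul] at h3
      have e : (1 / 5 : ℝ) * (scale i * (1 / 5) ^ j) = scale i * (1 / 5) ^ (j + 1) := by
        rw [pow_succ]; ring
      rw [e, sub_self] at h3
      have h4 := h3.eq_harm
      have h5 : (fun a => ((-⇑(greenOp f)) ∘ F n - (scale i * (1 / 5) ^ (j + 1)) •
          (-⇑(greenOp f))) (q a)) = c := by
        funext a
        simp [greenOp_q, hc]
      rw [h5] at h4
      rw [← h4]
      abel
    rw [hu]
    constructor
    · funext x
      have h1 := congrFun hg x
      have h2 := congrFun hRc x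
      simp only [Function.comp, Pi.add_apply, Pi.neg_apply, Pi.smul_apply, smul_eq_mul] at h1 h2 ⊢
      rw [h1, h2]; ring
    · funext x
      have h1 := congrFun hgF x
      have h2 := congrFun hFc x
      have hne := scale_ne i j hi
      have h3 : α * (scale i * (1 / 5) ^ (j + 1) - scaleBdry i) = 1 := inv_mul_cancel₀ hne
      simp only [Function.comp, Pi.add_apply, Pi.neg_apply, Pi.smul_apply, smul_eq_mul] at h1 h2 ⊢
      rw [h1, h2]
      linear_combination (-harm c x) * h3

theorem mono_iterate (n : Fin 3) {i : ℕ} (hi : i = 1 ∨ i = 2 ∨ i = 3) (j m : ℕ) (x : gasket) :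
    mono n i j ((F n)^[m] x) = (scale i * (1 / 5) ^ j) ^ m * mono n i j x := by
  induction m with
  | zero => simp
  | succ m ih =>
    rw [Function.iterate_succ_apply']
    have := congrFun (mono_symm n hi j).2 ((F n)^[m] x)
    simp only [Function.comp, Pi.smul_apply, smul_eq_mul] at this
    rw [this, ih, pow_succ]; ring

theorem mono_bdry (n : Fin 3) {i : ℕ} (hi : i = 1 ∨ i = 2 ∨ i = 3) (j : ℕ) :
    mono n i j (q (n - 1)) = parity i * mono n i j (q (n + 1)) := by
  have := congrFun (mono_symm n hi j).1 (q (n + 1))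
  simpa only [Function.comp, refl_q, swp_add, Pi.smul_apply, smul_eq_mul] using this

theorem mono_zero_q (n : Fin 3) (i : ℕ) (a : Fin 3) : mono n i 0 (q a) = bvals n i a :=
  harm_q _ a

theorem scale_pow_le {i : ℕ} (hi : i = 1 ∨ i = 2 ∨ i = 3) (j : ℕ) :
    0 < scale i * (1 / 5) ^ j ∧ scale i * (1 / 5) ^ (j + 1) ≤ scale i / 5 := by
  have h1 : (1 / 5 : ℝ) ^ j ≤ 1 := pow_le_one₀ (by norm_num) (by norm_num)
  have h0 : (0 : ℝ) < (1 / 5 : ℝ) ^ j := by positivity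
  have hs : 0 < scale i := by rcases hi with rfl | rfl | rfl <;> norm_num [scale]
  refine ⟨by positivity, ?_⟩
  rw [pow_succ]
  nlinarith

theorem mono_succ_q (n : Fin 3) {i : ℕ} (hi : i = 1 ∨ i = 2 ∨ i = 3) (j : ℕ) :
    mono n i (j + 1) (q n) = 0 := by
  have h := mono_iterate n hi (j + 1) 1 (q n)
  rw [iterate_F_q, pow_one] at h
  have h1 := (scale_pow_le hi j).2
  have hs : scale i ≤ 1 := by rcases hi with rfl | rfl | rfl <;> norm_num [scale]
  have h2 : (1 - scale i * (1 / 5) ^ (j + 1)) * mono n i (j + 1) (q n) = 0 := by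
    rw [sub_mul, one_mul, sub_eq_zero]; exact h
  rcases mul_eq_zero.mp h2 with h3 | h3
  · linarith
  · exact h3

theorem mono_value (n : Fin 3) {i : ℕ} (hi : i = 1 ∨ i = 2 ∨ i = 3) (j : ℕ) :
    mono n i j (q n) = if j = 0 ∧ i = 1 then 1 else 0 := by
  cases j with
  | zero => rw [mono_zero_q]; rcases hi with rfl | rfl | rfl <;> simp [bvals]
  | succ j => rw [mono_succ_q n hi]; simp

theorem mono_normalDeriv (n : Fin 3) {i : ℕ} (hi : i = 1 ∨ i = 2 ∨ i = 3) (j : ℕ) :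
    HasNormalDeriv (mono n i j) n (if j = 0 ∧ i = 2 then 1 else 0) := by
  unfold HasNormalDeriv
  simp only [mono_iterate n hi]
  cases j with
  | zero =>
    simp only [mono_zero_q]
    have h : ∀ n : Fin 3, n + 1 ≠ n ∧ n - 1 ≠ n ∧ n - 1 ≠ n + 1 := by decide
    obtain ⟨h1, h2, h3⟩ := h n
    rcases hi with rfl | rfl | rfl
    · norm_num [bvals, scale]
    · have e : ∀ m : ℕ, (5 / 3 : ℝ) ^ m * (2 * bvals n 2 n - (scale 2 * (1 / 5) ^ 0) ^ m *
          bvals n 2 (n + 1) - (scale 2 * (1 / 5) ^ 0) ^ m * bvals n 2 (n - 1)) = 1 := by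
        intro m
        have : (5 / 3 : ℝ) ^ m * (3 / 5) ^ m = 1 := by rw [← mul_pow]; norm_num
        simp [bvals, scale, h1, h2]
        linear_combination this
      simp only [e]
      simp
    · have e : ∀ m : ℕ, (5 / 3 : ℝ) ^ m * (2 * bvals n 3 n - (scale 3 * (1 / 5) ^ 0) ^ m *
          bvals n 3 (n + 1) - (scale 3 * (1 / 5) ^ 0) ^ m * bvals n 3 (n - 1)) = 0 := by
        intro m
        simp [bvals, h1, h2, h3]
        ring
      simp only [e]
      simp
  | succ j =>
    simp only [mono_succ_q n hi]
    have hlt : 5 / 3 * (scale i * (1 / 5) ^ (j + 1)) < 1 := by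
      have h1 := (scale_pow_le hi j).2
      have hs : scale i ≤ 1 := by rcases hi with rfl | rfl | rfl <;> norm_num [scale]
      linarith
    have h0 := (scale_pow_le hi (j + 1)).1
    have hlim := (tendsto_pow_atTop_nhds_zero_of_lt_one (by positivity) hlt).mul_const
      (-(mono n i (j + 1) (q (n + 1)) + mono n i (j + 1) (q (n - 1))))
    rw [zero_mul] at hlim
    simp only [Nat.add_eq_zero_iff, one_ne_zero, and_false, false_and, if_false]
    refine hlim.congr fun m => ?_
    rw [mul_pow]; ring

theorem mono_tangentialDeriv (n : Fin 3) {i : ℕ} (hi : i = 1 ∨ i = 2 ∨ i = 3) (j : ℕ) :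
    HasTangentialDeriv (mono n i j) n (if j = 0 ∧ i = 3 then 1 else 0) := by
  unfold HasTangentialDeriv
  simp only [mono_iterate n hi, mono_bdry n hi]
  by_cases h3 : i = 3
  · subst h3
    cases j with
    | zero =>
      have h : ∀ n : Fin 3, n + 1 ≠ n := by decide
      have e : ∀ m : ℕ, (5 : ℝ) ^ m * ((scale 3 * (1 / 5) ^ 0) ^ m * mono n 3 0 (q (n + 1)) -
          (scale 3 * (1 / 5) ^ 0) ^ m * (parity 3 * mono n 3 0 (q (n + 1)))) = 1 := by
        intro m
        have : (5 : ℝ) ^ m * (1 / 5) ^ m = 1 := by rw [← mul_pow]; norm_num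
        rw [mono_zero_q]
        norm_num [bvals, scale, parity, h n] at this ⊢
        linear_combination this
      simp only [e]
      simp
    | succ j =>
      have hlt : 5 * (scale 3 * (1 / 5) ^ (j + 1)) < 1 := by
        have h1 := (scale_pow_le hi j).2
        have hs : scale 3 = 1 / 5 := by norm_num [scale]
        rw [hs] at h1 ⊢
        linarith
      have h0 := (scale_pow_le hi (j + 1)).1
      have hlim := (tendsto_pow_atTop_nhds_zero_of_lt_one (by positivity) hlt).mul_const
        (mono n 3 (j + 1) (q (n + 1)) - parity 3 * mono n 3 (j + 1) (q (n + 1)))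
      rw [zero_mul] at hlim
      simp only [Nat.add_eq_zero_iff, one_ne_zero, and_false, false_and, if_false]
      refine hlim.congr fun m => ?_
      rw [mul_pow]; ring
  · simp [h3, parity]

theorem hasLaplacianPow_mono (n : Fin 3) (i k m : ℕ) :
    HasLaplacianPow m (mono n i (k + m)) (mono n i k) := by
  induction m with
  | zero => rfl
  | succ m ih => exact ⟨_, hasLaplacian_mono n i (k + m), ih⟩

theorem isPolynomial_mono (n : Fin 3) (i j : ℕ) : IsPolynomial j (mono n i j) := by
  induction j with
  | zero => exact ⟨0, hasLaplacian_harm _, rfl⟩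
  | succ j ih => exact ⟨_, hasLaplacian_mono n i j, ih⟩

theorem isMonomial_mono (n : Fin 3) {i : ℕ} (hi : i = 1 ∨ i = 2 ∨ i = 3) (j : ℕ) :
    IsMonomial n i j (mono n i j) := by
  refine ⟨isPolynomial_mono n i j, fun m hm => ?_⟩
  obtain ⟨k, rfl⟩ := Nat.exists_eq_add_of_le' hm
  refine ⟨mono n i k, hasLaplacianPow_mono n i k m, ?_⟩
  have e : m = k + m ↔ k = 0 := by omega
  simp only [e]
  exact ⟨mono_value n hi k, mono_normalDeriv n hi k, mono_tangentialDeriv n hi k⟩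

theorem HasNormalDeriv.add {u v : gasket → ℝ} {n : Fin 3} {a b : ℝ} (hu : HasNormalDeriv u n a)
    (hv : HasNormalDeriv v n b) : HasNormalDeriv (u + v) n (a + b) := by
  refine (Tendsto.add hu hv).congr fun m => ?_
  simp only [Pi.add_apply]; ring

theorem HasNormalDeriv.smul {u : gasket → ℝ} {n : Fin 3} {a : ℝ} (hu : HasNormalDeriv u n a)
    (r : ℝ) : HasNormalDeriv (r • u) n (r * a) := by
  refine (Tendsto.const_mul r hu).congr fun m => ?_
  simp only [Pi.smul_apply, smul_eq_mul]; ring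

theorem HasNormalDeriv.sub {u v : gasket → ℝ} {n : Fin 3} {a b : ℝ} (hu : HasNormalDeriv u n a)
    (hv : HasNormalDeriv v n b) : HasNormalDeriv (u - v) n (a - b) := by
  refine (Tendsto.sub hu hv).congr fun m => ?_
  simp only [Pi.sub_apply]; ring

theorem HasTangentialDeriv.sub {u v : gasket → ℝ} {n : Fin 3} {a b : ℝ}
    (hu : HasTangentialDeriv u n a) (hv : HasTangentialDeriv v n b) :
    HasTangentialDeriv (u - v) n (a - b) := by
  refine (Tendsto.sub hu hv).congr fun m => ?_
  simp only [Pi.sub_apply]; ring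

theorem hasNormalDeriv_harm (c : Fin 3 → ℝ) (n : Fin 3) :
    HasNormalDeriv (harm c) n (2 * c n - c (n + 1) - c (n - 1)) := by
  refine tendsto_const_nhds.congr fun m => ?_
  have h := nd_harm m n c
  unfold nd at h
  rw [h, ← mul_assoc, ← mul_pow]
  norm_num

theorem hasTangentialDeriv_harm (c : Fin 3 → ℝ) (n : Fin 3) :
    HasTangentialDeriv (harm c) n (c (n + 1) - c (n - 1)) := by
  refine tendsto_const_nhds.congr fun m => ?_
  have h : harm c ((F n)^[m] (q (n + 1))) - harm c ((F n)^[m] (q (n - 1))) =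
      (1 / 5) ^ m * (c (n + 1) - c (n - 1)) := by
    induction m generalizing c with
    | zero => simp
    | succ m ih =>
      rw [Function.iterate_succ_apply', Function.iterate_succ_apply', harm_F, harm_F, ih, pow_succ]
      have hn : ∀ n : Fin 3, n + 1 ≠ n ∧ n - 1 ≠ n := by decide
      simp only [child, if_neg (hn n).1, if_neg (hn n).2]
      ring
  rw [h, ← mul_assoc, ← mul_pow]
  norm_num

/-- A solution of `Δ u = f` is determined by its value, normal derivative and tangential derivative
at a boundary point. -/
theorem HasLaplacian.eq_of_jet {u v : gasket → ℝ} {f : gasket → ℝ} (hu : HasLaplacian u f)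
    (hv : HasLaplacian v f) {n : Fin 3} {a b : ℝ} (h0 : u (q n) = v (q n))
    (hnu : HasNormalDeriv u n a) (hnv : HasNormalDeriv v n a)
    (htu : HasTangentialDeriv u n b) (htv : HasTangentialDeriv v n b) : u = v := by
  have h := hu.sub hv
  rw [sub_self] at h
  have e := h.eq_harm
  set c : Fin 3 → ℝ := fun i => (u - v) (q i) with hc
  have h1 := hnu.sub hnv
  have h2 := htu.sub htv
  rw [e] at h1 h2
  have k1 := tendsto_nhds_unique h1 (hasNormalDeriv_harm c n)
  have k2 := tendsto_nhds_unique h2 (hasTangentialDeriv_harm c n)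
  have k0 : c n = 0 := by simp [hc, h0]
  refine sub_eq_zero.mp (h.eq_zero fun j => ?_)
  change c j = 0
  rcases cases_of_fin n j with rfl | rfl | rfl
  · exact k0
  · linarith
  · linarith

/-- The conditions on `P_{ji}^{(n)}` have at most one solution. -/
theorem IsMonomial.eq_mono {n : Fin 3} {i : ℕ} (hi : i = 1 ∨ i = 2 ∨ i = 3) {j : ℕ}
    {u : gasket → ℝ} (hu : IsMonomial n i j u) : u = mono n i j := by
  induction j generalizing u with
  | zero =>
    obtain ⟨⟨v, hv, rfl⟩, h⟩ := hu
    obtain ⟨w, rfl, h1, h2, h3⟩ := h 0 le_rfl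
    have hm1 := mono_value n hi 0
    simp only [true_and] at h1 h2 h3 hm1
    refine hv.eq_of_jet (v := mono n i 0) (hasLaplacian_harm _) (h1.trans hm1.symm) h2 ?_ h3 ?_
    · simpa using mono_normalDeriv n hi 0
    · simpa using mono_tangentialDeriv n hi 0
  | succ j ih =>
    obtain ⟨⟨v, hv, hp⟩, h⟩ := hu
    have hvj : v = mono n i j := by
      refine ih ⟨hp, fun m hm => ?_⟩
      obtain ⟨w, ⟨v', hv', hw⟩, hw2⟩ := h (m + 1) (Nat.succ_le_succ hm)
      rw [← hv.unique hv'] at hw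
      simp only [Nat.add_right_cancel_iff] at hw2
      exact ⟨w, hw, hw2⟩
    subst hvj
    obtain ⟨w, rfl, h1, h2, h3⟩ := h 0 (Nat.zero_le _)
    have hj : ¬ (0 = j + 1) := by omega
    simp only [hj, false_and, if_false] at h1 h2 h3
    refine hv.eq_of_jet (hasLaplacian_mono n i j) (h1.trans (mono_succ_q n hi j).symm) h2 ?_ h3 ?_
    · simpa using mono_normalDeriv n hi (j + 1)
    · simpa using mono_tangentialDeriv n hi (j + 1)

theorem monomial_eq (n : Fin 3) {i : ℕ} (hi : i = 1 ∨ i = 2 ∨ i = 3) (j : ℕ) :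
    monomial n i j = mono n i j :=
  IsMonomial.eq_mono hi
    (Classical.epsilon_spec (p := IsMonomial n i j) ⟨_, isMonomial_mono n hi j⟩)

/-! ### The Gram-Schmidt process -/

theorem meanL_nonneg {f : C(gasket, ℝ)} (h : ∀ x, 0 ≤ f x) : 0 ≤ meanL f := integral_nonneg h

theorem meanL_mono {f g : C(gasket, ℝ)} (h : ∀ x, f x ≤ g x) : meanL f ≤ meanL g :=
  integral_mono (integrable_of_continuous f.continuous) (integrable_of_continuous g.continuous) h

theorem meanL_sq_nonneg (f : C(gasket, ℝ)) : 0 ≤ meanL (f * f) :=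
  meanL_nonneg fun _ => mul_self_nonneg _

theorem eq_zero_of_meanL_sq {f : C(gasket, ℝ)} (h : meanL (f * f) = 0) : f = 0 := by
  by_contra hne
  obtain ⟨x, hx⟩ := DFunLike.ne_iff.mp hne
  have := integral_pos_of_pos (f := ⇑(f * f)) (f * f).continuous (fun x => mul_self_nonneg _)
    (x := x) (mul_self_pos.mpr hx)
  exact absurd h this.ne'

theorem meanL_sq_pos {f : C(gasket, ℝ)} (h : f ≠ 0) : 0 < meanL (f * f) :=
  lt_of_le_of_ne (meanL_sq_nonneg f) fun e => h (eq_zero_of_meanL_sq e.symm)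

theorem meanL_cauchySchwarz (f g : C(gasket, ℝ)) :
    meanL (f * g) ^ 2 ≤ meanL (f * f) * meanL (g * g) := by
  by_cases hg : g = 0
  · simp [hg]
  have hpos := meanL_sq_pos hg
  have h := meanL_sq_nonneg (meanL (g * g) • f - meanL (f * g) • g)
  simp only [sub_mul, mul_sub, smul_mul_assoc, mul_smul_comm, map_sub, map_smul, smul_eq_mul,
    mul_comm g f] at h
  set A := meanL (f * f)
  set B := meanL (f * g)
  set D := meanL (g * g)
  have h2 : 0 ≤ D * (A * D - B ^ 2) := by nlinarith
  have := nonneg_of_mul_nonneg_right h2 hpos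
  linarith

theorem ip_eq (f g : C(gasket, ℝ)) : ip f g = meanL (f * g) := rfl

theorem l2norm_sq (f : C(gasket, ℝ)) : l2norm f ^ 2 = meanL (f * f) :=
  Real.sq_sqrt (meanL_sq_nonneg f)

theorem l2norm_nonneg (u : gasket → ℝ) : 0 ≤ l2norm u := Real.sqrt_nonneg _

theorem l2norm_pos {f : C(gasket, ℝ)} (h : f ≠ 0) : 0 < l2norm f :=
  Real.sqrt_pos.mpr (meanL_sq_pos h)

theorem gramSchmidt_continuous (P : ℕ → C(gasket, ℝ)) (k : ℕ) :
    Continuous (gramSchmidt (fun j => ⇑(P j)) k) := by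
  induction k using Nat.strong_induction_on with
  | _ k ih =>
    rw [gramSchmidt]
    refine (P k).continuous.sub ?_
    have : (fun x => (∑ l : Fin k, ((l2norm (gramSchmidt (fun j => ⇑(P j)) l))⁻¹ ^ 2 *
        ip (P k) (gramSchmidt (fun j => ⇑(P j)) l)) • gramSchmidt (fun j => ⇑(P j)) l) x) =
        fun x => ∑ l : Fin k, ((l2norm (gramSchmidt (fun j => ⇑(P j)) l))⁻¹ ^ 2 *
        ip (P k) (gramSchmidt (fun j => ⇑(P j)) l)) * gramSchmidt (fun j => ⇑(P j)) l x := by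
      funext x
      simp only [Finset.sum_apply, Pi.smul_apply, smul_eq_mul]
    change Continuous (fun x => (∑ l : Fin k, ((l2norm (gramSchmidt (fun j => ⇑(P j)) l))⁻¹ ^ 2 *
        ip (P k) (gramSchmidt (fun j => ⇑(P j)) l)) • gramSchmidt (fun j => ⇑(P j)) l) x)
    rw [this]
    exact continuous_finsetSum _ fun l _ => continuous_const.mul (ih l l.2)

/-- The Gram-Schmidt process for continuous functions. -/
def gsC (P : ℕ → C(gasket, ℝ)) (k : ℕ) : C(gasket, ℝ) := ⟨_, gramSchmidt_continuous P k⟩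

theorem gsC_eq (P : ℕ → C(gasket, ℝ)) (k : ℕ) : gsC P k = P k -
    ∑ l ∈ Finset.range k, ((l2norm (gsC P l))⁻¹ ^ 2 * meanL (P k * gsC P l)) • gsC P l := by
  ext x
  change gramSchmidt (fun j => ⇑(P j)) k x = _
  rw [gramSchmidt, ← Fin.sum_univ_eq_sum_range
    (fun l => ((l2norm (gsC P l))⁻¹ ^ 2 * meanL (P k * gsC P l)) • gsC P l)]
  simp only [Pi.sub_apply, Finset.sum_apply, Pi.smul_apply, ContinuousMap.sub_apply,
    ContinuousMap.sum_apply, ContinuousMap.smul_apply]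
  rfl

theorem gsC_orthogonal (P : ℕ → C(gasket, ℝ)) {k l : ℕ} (hl : l < k) :
    meanL (gsC P k * gsC P l) = 0 := by
  induction k using Nat.strong_induction_on generalizing l with
  | _ k ih =>
    have hother : ∀ l' < k, l' ≠ l → meanL (gsC P l' * gsC P l) = 0 := by
      intro l' hl' hne
      rcases lt_or_gt_of_ne hne with h | h
      · rw [mul_comm]; exact ih l hl h
      · exact ih l' hl' h
    rw [gsC_eq P k, sub_mul, map_sub, Finset.sum_mul, map_sum,
      Finset.sum_eq_single_of_mem l (Finset.mem_range.mpr hl)]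
    · rw [smul_mul_assoc, map_smul, smul_eq_mul, ← l2norm_sq]
      by_cases h0 : gsC P l = 0
      · simp [h0]
      · have := (l2norm_pos h0).ne'
        field_simp
        ring
    · intro l' hl' hne
      rw [smul_mul_assoc, map_smul, hother l' (Finset.mem_range.mp hl') hne, smul_zero]

/-- The span of the first `k` functions of a sequence. -/
def spanBelow (P : ℕ → C(gasket, ℝ)) (k : ℕ) : Submodule ℝ C(gasket, ℝ) :=
  Submodule.span ℝ (P '' {l | l < k})

theorem mem_spanBelow (P : ℕ → C(gasket, ℝ)) {k l : ℕ} (h : l < k) : P l ∈ spanBelow P k :=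
  Submodule.subset_span ⟨l, h, rfl⟩

theorem spanBelow_mono (P : ℕ → C(gasket, ℝ)) {k l : ℕ} (h : k ≤ l) :
    spanBelow P k ≤ spanBelow P l :=
  Submodule.span_mono (Set.image_mono fun _ hm => lt_of_lt_of_le hm h)

theorem gsC_sub_mem (P : ℕ → C(gasket, ℝ)) (k : ℕ) : gsC P k - P k ∈ spanBelow P k := by
  induction k using Nat.strong_induction_on with
  | _ k ih =>
    rw [gsC_eq, sub_sub_cancel_left]
    refine Submodule.neg_mem _ (Submodule.sum_mem _ fun l hl => Submodule.smul_mem _ _ ?_)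
    have hl := Finset.mem_range.mp hl
    have := Submodule.add_mem _ (spanBelow_mono P hl.le (ih l hl)) (mem_spanBelow P hl)
    rwa [sub_add_cancel] at this

theorem gsC_orthogonal_span (P : ℕ → C(gasket, ℝ)) {k : ℕ} {s : C(gasket, ℝ)}
    (hs : s ∈ spanBelow P k) : meanL (gsC P k * s) = 0 := by
  induction hs using Submodule.span_induction with
  | mem x hx =>
    obtain ⟨l, hl, rfl⟩ := hx
    have h := gsC_eq P l
    rw [eq_sub_iff_add_eq] at h
    rw [← h, mul_add, map_add, gsC_orthogonal P hl, zero_add, Finset.mul_sum, map_sum]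
    refine Finset.sum_eq_zero fun l' hl' => ?_
    rw [mul_smul_comm, map_smul, gsC_orthogonal P ((Finset.mem_range.mp hl').trans hl), smul_zero]
  | zero => simp
  | add x y _ _ hx hy => rw [mul_add, map_add, hx, hy, add_zero]
  | smul r x _ hx => rw [mul_smul_comm, map_smul, hx, smul_zero]

/-- `gsC P k` has minimal norm in `P k + spanBelow P k`. -/
theorem gsC_minimal (P : ℕ → C(gasket, ℝ)) {k : ℕ} {v : C(gasket, ℝ)}
    (hv : v - P k ∈ spanBelow P k) : meanL (gsC P k * gsC P k) ≤ meanL (v * v) := by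
  set s := v - gsC P k with hs
  have hmem : s ∈ spanBelow P k := by
    have := Submodule.sub_mem _ hv (gsC_sub_mem P k)
    rwa [sub_sub_sub_cancel_right] at this
  have h0 := gsC_orthogonal_span P hmem
  have e : v = gsC P k + s := by rw [hs]; abel
  have h1 := meanL_sq_nonneg s
  rw [e, add_mul, mul_add, mul_add, map_add, map_add, map_add, mul_comm s, h0]
  linarith

/-! ### Antiderivatives of orthogonal polynomials -/

section

variable {n : Fin 3} {i : ℕ}

theorem exists_laplacian_spanBelow {k : ℕ} {s : C(gasket, ℝ)}
    (hs : s ∈ spanBelow (mono n i) (k + 1)) :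
    ∃ s' ∈ spanBelow (mono n i) k, HasLaplacian s s' := by
  induction hs using Submodule.span_induction with
  | mem x hx =>
    obtain ⟨l, hl, rfl⟩ := hx
    cases l with
    | zero => exact ⟨0, Submodule.zero_mem _, hasLaplacian_harm _⟩
    | succ l =>
      exact ⟨_, mem_spanBelow _ (Nat.lt_of_succ_lt_succ hl), hasLaplacian_mono n i l⟩
  | zero =>
    refine ⟨0, Submodule.zero_mem _, ?_⟩
    have := hasLaplacian_harm 0
    rwa [harm_zero] at this
  | add x y _ _ hx hy =>
    obtain ⟨a, ha, hxa⟩ := hx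
    obtain ⟨b, hb, hyb⟩ := hy
    exact ⟨a + b, Submodule.add_mem _ ha hb, hxa.add hyb⟩
  | smul r x _ hx =>
    obtain ⟨a, ha, hxa⟩ := hx
    exact ⟨r • a, Submodule.smul_mem _ r ha, hxa.smul r⟩

theorem bvals_ne_zero (hi : i = 1 ∨ i = 2 ∨ i = 3) : ∃ a, bvals n i a ≠ 0 := by
  refine ⟨n + 1, ?_⟩
  have h : ∀ n : Fin 3, n + 1 ≠ n := by decide
  rcases hi with rfl | rfl | rfl <;> simp [bvals, h]

/-- The monomials are linearly independent: apply the Laplacian `k` times. -/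
theorem mono_add_ne_zero (hi : i = 1 ∨ i = 2 ∨ i = 3) {k : ℕ} {s : C(gasket, ℝ)}
    (hs : s ∈ spanBelow (mono n i) k) : mono n i k + s ≠ 0 := by
  induction k generalizing s with
  | zero =>
    have hs0 : s = 0 := by simpa [spanBelow] using hs
    rw [hs0, add_zero]
    intro h
    obtain ⟨a, ha⟩ := bvals_ne_zero (n := n) hi
    rw [← mono_zero_q, h] at ha
    exact ha rfl
  | succ k ih =>
    intro h
    obtain ⟨s', hs', hL⟩ := exists_laplacian_spanBelow hs
    have h1 := (hasLaplacian_mono n i k).add hL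
    have h2 : ⇑(mono n i (k + 1)) + ⇑s = harm 0 := by
      rw [harm_zero, ← ContinuousMap.coe_add, h]; rfl
    rw [h2] at h1
    exact ih hs' (DFunLike.coe_injective (h1.unique (hasLaplacian_harm 0)))

theorem gsC_mono_ne_zero (hi : i = 1 ∨ i = 2 ∨ i = 3) (k : ℕ) : gsC (mono n i) k ≠ 0 := by
  have := mono_add_ne_zero hi (gsC_sub_mem (mono n i) k)
  rwa [add_sub_cancel] at this

/-- The conditions at the boundary satisfied by all `P_{ji}^{(n)}` with `j ≥ 1`. The tangential
derivative is not needed: the parity under reflection takes its place. -/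
structure IsNormalized (n : Fin 3) (i : ℕ) (v : gasket → ℝ) : Prop where
  value : v (q n) = 0
  symm : v (q (n - 1)) = parity i * v (q (n + 1))
  normalDeriv : HasNormalDeriv v n 0

theorem isNormalized_mono (hi : i = 1 ∨ i = 2 ∨ i = 3) (k : ℕ) :
    IsNormalized n i (mono n i (k + 1)) :=
  ⟨mono_succ_q n hi k, mono_bdry n hi (k + 1), by simpa using mono_normalDeriv n hi (k + 1)⟩

theorem IsNormalized.add {u v : gasket → ℝ} (hu : IsNormalized n i u) (hv : IsNormalized n i v) :
    IsNormalized n i (u + v) := by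
  refine ⟨?_, ?_, ?_⟩
  · rw [Pi.add_apply, hu.value, hv.value, add_zero]
  · rw [Pi.add_apply, Pi.add_apply, hu.symm, hv.symm, mul_add]
  · have := hu.normalDeriv.add hv.normalDeriv
    rwa [add_zero] at this

theorem IsNormalized.smul {u : gasket → ℝ} (hu : IsNormalized n i u) (r : ℝ) :
    IsNormalized n i (r • u) := by
  refine ⟨?_, ?_, ?_⟩
  · rw [Pi.smul_apply, hu.value, smul_zero]
  · rw [Pi.smul_apply, Pi.smul_apply, hu.symm, smul_eq_mul, smul_eq_mul]; ring
  · have := hu.normalDeriv.smul r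
    rwa [mul_zero] at this

theorem exists_antideriv_spanBelow (hi : i = 1 ∨ i = 2 ∨ i = 3) {k : ℕ} {s : C(gasket, ℝ)}
    (hs : s ∈ spanBelow (mono n i) k) :
    ∃ v ∈ spanBelow (mono n i) (k + 1), HasLaplacian v s ∧ IsNormalized n i v := by
  induction hs using Submodule.span_induction with
  | mem x hx =>
    obtain ⟨l, hl, rfl⟩ := hx
    exact ⟨_, mem_spanBelow _ (Nat.succ_lt_succ hl), hasLaplacian_mono n i l,
      isNormalized_mono hi l⟩
  | zero =>
    have h := (isNormalized_mono (n := n) hi 0).smul 0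
    have h1 := hasLaplacian_harm 0
    rw [harm_zero] at h1
    rw [zero_smul] at h
    exact ⟨0, Submodule.zero_mem _, h1, h⟩
  | add x y _ _ hx hy =>
    obtain ⟨a, ha, hxa, ha'⟩ := hx
    obtain ⟨b, hb, hyb, hb'⟩ := hy
    exact ⟨a + b, Submodule.add_mem _ ha hb, hxa.add hyb, ha'.add hb'⟩
  | smul r x _ hx =>
    obtain ⟨a, ha, hxa, ha'⟩ := hx
    exact ⟨r • a, Submodule.smul_mem _ r ha, hxa.smul r, ha'.smul r⟩

/-- The orthogonal polynomial `p_k` has an antiderivative in `P_{k+1} + span(P_0, …, P_k)`. -/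
theorem exists_antideriv (hi : i = 1 ∨ i = 2 ∨ i = 3) (k : ℕ) :
    ∃ v : C(gasket, ℝ), v - mono n i (k + 1) ∈ spanBelow (mono n i) (k + 1) ∧
      HasLaplacian v (gsC (mono n i) k) ∧ IsNormalized n i v := by
  obtain ⟨v, hv, hL, hN⟩ := exists_antideriv_spanBelow hi (gsC_sub_mem (mono n i) k)
  refine ⟨mono n i (k + 1) + v, ?_, ?_, (isNormalized_mono hi k).add hN⟩
  · rwa [add_sub_cancel_left]
  · have := (hasLaplacian_mono n i k).add hL
    rwa [← ContinuousMap.coe_add, ← ContinuousMap.coe_add, add_sub_cancel] at this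

end

/-! ### Kernels and the Hilbert-Schmidt norm -/

/-- The integral over `SG × SG`, as a linear functional. -/
def prodL : C(gasket × gasket, ℝ) →ₗ[ℝ] ℝ where
  toFun f := ∫ z, f z ∂(μ.prod μ)
  map_add' f g := integral_add (integrable_prod_of_continuous f.continuous)
    (integrable_prod_of_continuous g.continuous)
  map_smul' r _ := integral_const_mul r _

theorem prodL_apply (f : C(gasket × gasket, ℝ)) : prodL f = ∫ z, f z ∂(μ.prod μ) := rfl

theorem prodL_mono {f g : C(gasket × gasket, ℝ)} (h : ∀ z, f z ≤ g z) : prodL f ≤ prodL g :=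
  integral_mono (integrable_prod_of_continuous f.continuous)
    (integrable_prod_of_continuous g.continuous) h

/-- Green's function as a continuous map. -/
def grP : C(gasket × gasket, ℝ) := ⟨fun z => gr z.1 z.2, gr_continuous⟩

/-- The function `(x, y) ↦ f x`. -/
def fstC (f : C(gasket, ℝ)) : C(gasket × gasket, ℝ) := f.comp ⟨Prod.fst, continuous_fst⟩

/-- The function `(x, y) ↦ f y`. -/
def sndC (f : C(gasket, ℝ)) : C(gasket × gasket, ℝ) := f.comp ⟨Prod.snd, continuous_snd⟩

@[simp] theorem grP_apply (z : gasket × gasket) : grP z = gr z.1 z.2 := rfl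

@[simp] theorem fstC_apply (f : C(gasket, ℝ)) (z : gasket × gasket) : fstC f z = f z.1 := rfl

@[simp] theorem sndC_apply (f : C(gasket, ℝ)) (z : gasket × gasket) : sndC f z = f z.2 := rfl

theorem prodL_eq (f : C(gasket × gasket, ℝ)) : prodL f = ∫ x, ∫ y, f (x, y) ∂μ ∂μ :=
  integral_prod _ (integrable_prod_of_continuous f.continuous)

theorem prodL_tensor (f g : C(gasket, ℝ)) : prodL (fstC f * sndC g) = meanL f * meanL g :=
  integral_prod_mul (μ := μ) (ν := μ) (⇑f) (⇑g)

theorem prodL_one : prodL 1 = 1 := by simp [prodL_apply]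

theorem prodL_grP (f g : C(gasket, ℝ)) : prodL (grP * (fstC f * sndC g)) =
    meanL (greenOp g * f) := by
  rw [prodL_eq, meanL_apply]
  congr 1
  funext x
  have h : ∀ y, (grP * (fstC f * sndC g)) (x, y) = f x * (gr x y * g y) := by
    intro y
    simp only [ContinuousMap.mul_apply, grP_apply, fstC_apply, sndC_apply]
    ring
  simp only [h]
  rw [integral_const_mul, mul_comm]
  rfl

theorem fstC_one : fstC 1 = 1 := rfl

theorem sndC_one : sndC 1 = 1 := rfl

theorem greenOp_selfAdjoint (f g : C(gasket, ℝ)) :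
    meanL (greenOp g * f) = meanL (greenOp f * g) := by
  rw [← prodL_grP, ← prodL_grP, prodL_apply, ← integral_prod_swap, prodL_apply]
  congr 1
  funext z
  simp only [ContinuousMap.mul_apply, grP_apply, fstC_apply, sndC_apply, Prod.fst_swap,
    Prod.snd_swap]
  rw [gr_comm]; ring

/-- Integral operators are bounded by the Hilbert-Schmidt norm of their kernels. -/
theorem hilbertSchmidt_bound (K : C(gasket × gasket, ℝ)) {f v : C(gasket, ℝ)}
    (hv : ∀ x, v x = ∫ y, K (x, y) * f y ∂μ) :
    meanL (v * v) ≤ prodL (K * K) * meanL (f * f) := by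
  have hK : ∀ x, Continuous fun y => K (x, y) := fun x => K.continuous.comp (by fun_prop)
  have h1 : ∀ x, (v * v) x ≤ (∫ y, (K * K) (x, y) ∂μ) * meanL (f * f) := by
    intro x
    have := meanL_cauchySchwarz ⟨fun y => K (x, y), hK x⟩ f
    rw [ContinuousMap.mul_apply, hv x, ← sq]
    exact this
  rw [prodL_eq, ← integral_mul_const]
  refine integral_mono (integrable_of_continuous (v * v).continuous) ?_ h1
  exact (integrable_prod_of_continuous (K * K).continuous).integral_prod_left.mul_const _

theorem greenNorm_sq : greenNorm ^ 2 = prodL (grP * grP) := by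
  unfold greenNorm
  rw [green_eq, Real.sq_sqrt (integral_nonneg fun z => sq_nonneg _), prodL_apply]
  simp only [ContinuousMap.mul_apply, grP_apply, sq]

theorem greenNorm_nonneg : 0 ≤ greenNorm := Real.sqrt_nonneg _

theorem greenNorm_lt_one : greenNorm < 1 := by
  have h : greenNorm ^ 2 ≤ 81 / 400 := by
    rw [greenNorm_sq]
    have := prodL_mono (f := grP * grP) (g := (81 / 400 : ℝ) • 1) fun z => by
      have h0 := gr_nonneg z.1 z.2
      have h1 := gr_le z.1 z.2
      simp only [ContinuousMap.mul_apply, grP_apply, ContinuousMap.smul_apply,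
        ContinuousMap.one_apply, smul_eq_mul]
      nlinarith
    rw [map_smul, prodL_one] at this
    simpa using this
  nlinarith [greenNorm_nonneg]

theorem greenOp_bound (f : C(gasket, ℝ)) :
    meanL (greenOp f * greenOp f) ≤ greenNorm ^ 2 * meanL (f * f) := by
  rw [greenNorm_sq]
  exact hilbertSchmidt_bound grP fun x => rfl

/-! ### The quadratic form of Green's operator -/

/-- The quadratic form `∬ G(x, y) f(x) f(y) dμ(x) dμ(y)`. -/
def greenForm (f : C(gasket, ℝ)) : ℝ := meanL (greenOp f * f)

theorem cell_greenOp (f : C(gasket, ℝ)) (i : Fin 3) : cell i (greenOp f) =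
    nodeValue f 0 • cell i (psiC 0) + nodeValue f 1 • cell i (psiC 1) +
      nodeValue f 2 • cell i (psiC 2) + (1 / 5 : ℝ) • greenOp (cell i f) := by
  ext x
  have h := greenOp_F_aux f i x
  rw [meanL_gZeroC] at h
  simp only [cell_apply, ContinuousMap.add_apply, ContinuousMap.smul_apply, psiC_apply,
    smul_eq_mul, h]
  ring

/-- Self-similarity of the bilinear form of Green's operator. -/
theorem meanL_greenOp_mul (f g : C(gasket, ℝ)) : meanL (greenOp f * g) =
    nodeValue f 0 * meanL (psiC 0 * g) + nodeValue f 1 * meanL (psiC 1 * g) +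
      nodeValue f 2 * meanL (psiC 2 * g) + 1 / 15 * (meanL (greenOp (cell 0 f) * cell 0 g) +
      meanL (greenOp (cell 1 f) * cell 1 g) + meanL (greenOp (cell 2 f) * cell 2 g)) := by
  rw [meanL_eq (greenOp f * g), meanL_eq (psiC 0 * g), meanL_eq (psiC 1 * g),
    meanL_eq (psiC 2 * g)]
  simp only [cell_mul, cell_greenOp, add_mul, smul_mul_assoc, map_add, map_smul, smul_eq_mul]
  ring

theorem greenForm_eq (f : C(gasket, ℝ)) : greenForm f = 3 / 50 *
    ((meanL (psiC 0 * f) + meanL (psiC 1 * f) + meanL (psiC 2 * f)) ^ 2 +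
      2 * (meanL (psiC 0 * f) ^ 2 + meanL (psiC 1 * f) ^ 2 + meanL (psiC 2 * f) ^ 2)) +
    1 / 15 * (greenForm (cell 0 f) + greenForm (cell 1 f) + greenForm (cell 2 f)) := by
  unfold greenForm
  rw [meanL_greenOp_mul]
  simp only [nodeValue]
  ring

/-- Schur's test for the kernel `G`. -/
theorem abs_greenForm_le (f : C(gasket, ℝ)) : |greenForm f| ≤ 1 / 12 * meanL (f * f) := by
  have hsq : meanL (greenOp 1 * (f * f)) ≤ 1 / 12 * meanL (f * f) := by
    have := meanL_mono (f := greenOp 1 * (f * f)) (g := (1 / 12 : ℝ) • (f * f)) fun x => by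
      simp only [ContinuousMap.mul_apply, ContinuousMap.smul_apply, smul_eq_mul]
      exact mul_le_mul_of_nonneg_right (greenOp_one_le x) (mul_self_nonneg _)
    rwa [map_smul, smul_eq_mul] at this
  have hsq2 : meanL (greenOp (f * f) * 1) = meanL (greenOp 1 * (f * f)) := greenOp_selfAdjoint 1 _
  have key : ∀ σ : ℝ, σ ^ 2 = 1 → σ * greenForm f ≤ 1 / 12 * meanL (f * f) := by
    intro σ hσ
    have h := prodL_mono (f := σ • (grP * (fstC f * sndC f)))
      (g := (1 / 2 : ℝ) • (grP * (fstC (f * f) * sndC 1)) +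
        (1 / 2 : ℝ) • (grP * (fstC 1 * sndC (f * f)))) fun z => by
      have h0 := gr_nonneg z.1 z.2
      have h1 : 0 ≤ gr z.1 z.2 * (f z.1 - σ * f z.2) ^ 2 := by positivity
      simp only [ContinuousMap.add_apply, ContinuousMap.smul_apply, ContinuousMap.mul_apply,
        grP_apply, fstC_apply, sndC_apply, ContinuousMap.one_apply, smul_eq_mul]
      have e : (f z.1 - σ * f z.2) ^ 2 = f z.1 ^ 2 - 2 * σ * (f z.1 * f z.2) + f z.2 ^ 2 := by
        linear_combination (f z.2) ^ 2 * hσ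
      rw [e] at h1
      nlinarith
    rw [map_add, map_smul, map_smul, map_smul, prodL_grP, prodL_grP, prodL_grP, hsq2] at h
    simp only [smul_eq_mul] at h
    unfold greenForm
    linarith
  have h1 := key 1 (by norm_num)
  have h2 := key (-1) (by norm_num)
  rw [abs_le]
  constructor <;> linarith

theorem meanL_sq_cells (f : C(gasket, ℝ)) : meanL (cell 0 f * cell 0 f) +
    meanL (cell 1 f * cell 1 f) + meanL (cell 2 f * cell 2 f) = 3 * meanL (f * f) := by
  rw [meanL_eq (f * f)]
  simp only [cell_mul]
  ring

/-- Iterating the self-similarity of the form shows that its negative part is arbitrarily small. -/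
theorem greenForm_nonneg (f : C(gasket, ℝ)) : 0 ≤ greenForm f := by
  have key : ∀ m : ℕ, ∀ f : C(gasket, ℝ), -((1 / 5) ^ m * meanL (f * f)) ≤ greenForm f := by
    intro m
    induction m with
    | zero =>
      intro f
      have h := (abs_le.mp (abs_greenForm_le f)).1
      have h2 := meanL_sq_nonneg f
      rw [pow_zero]
      linarith
    | succ m ih =>
      intro f
      have h0 := ih (cell 0 f)
      have h1 := ih (cell 1 f)
      have h2 := ih (cell 2 f)
      have hs := congrArg ((1 / 5 : ℝ) ^ m * ·) (meanL_sq_cells f)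
      simp only [mul_add] at hs
      have hp : 0 ≤ 3 / 50 *
          ((meanL (psiC 0 * f) + meanL (psiC 1 * f) + meanL (psiC 2 * f)) ^ 2 +
          2 * (meanL (psiC 0 * f) ^ 2 + meanL (psiC 1 * f) ^ 2 + meanL (psiC 2 * f) ^ 2)) := by
        positivity
      rw [greenForm_eq, pow_succ]
      linarith
  have hlim : Tendsto (fun m : ℕ => -((1 / 5 : ℝ) ^ m * meanL (f * f))) atTop
      (𝓝 (-(0 * meanL (f * f)))) :=
    ((tendsto_pow_atTop_nhds_zero_of_lt_one (by norm_num) (by norm_num)).mul_const _).neg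
  rw [zero_mul, neg_zero] at hlim
  exact le_of_tendsto' hlim fun m => key m f

theorem greenForm_cell_eq_zero {f : C(gasket, ℝ)} (h : greenForm f = 0) :
    meanL (psiC 0 * f) = 0 ∧ ∀ i, greenForm (cell i f) = 0 := by
  have e := greenForm_eq f
  rw [h] at e
  have h0 := greenForm_nonneg (cell 0 f)
  have h1 := greenForm_nonneg (cell 1 f)
  have h2 := greenForm_nonneg (cell 2 f)
  have s0 := sq_nonneg (meanL (psiC 0 * f))
  have s1 := sq_nonneg (meanL (psiC 1 * f))
  have s2 := sq_nonneg (meanL (psiC 2 * f))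
  have s3 := sq_nonneg (meanL (psiC 0 * f) + meanL (psiC 1 * f) + meanL (psiC 2 * f))
  constructor
  · exact pow_eq_zero_iff two_ne_zero |>.mp (by linarith)
  · intro i
    fin_cases i <;> simp only [Fin.zero_eta, Fin.mk_one, Fin.reduceFinMk] <;> linarith

/-- The restriction of `f` to the cell `F_w(SG)`. -/
def wordCell (w : List (Fin 3)) (f : C(gasket, ℝ)) : C(gasket, ℝ) :=
  f.comp ⟨wordMap w, wordMap_continuous w⟩

@[simp] theorem wordCell_apply (w : List (Fin 3)) (f : C(gasket, ℝ)) (x : gasket) :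
    wordCell w f x = f (wordMap w x) := rfl

theorem greenForm_wordCell {f : C(gasket, ℝ)} (h : greenForm f = 0) (w : List (Fin 3)) :
    greenForm (wordCell w f) = 0 := by
  induction w generalizing f with
  | nil => exact h
  | cons i w ih => exact ih ((greenForm_cell_eq_zero h).2 i)

/-- If `f` were positive somewhere, its integral against a spline supported near that point would
not vanish. -/
theorem le_zero_of_greenForm {f : C(gasket, ℝ)} (h : greenForm f = 0) (x : gasket) : f x ≤ 0 := by
  by_contra! hx
  obtain ⟨M, hM⟩ := exists_osc_lt f.continuous (half_pos hx)
  obtain ⟨w, hw, y, rfl⟩ := exists_wordMap M x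
  have h1 := (greenForm_cell_eq_zero (greenForm_wordCell h w)).1
  have h2 : meanL ((f (wordMap w y) / 2) • psiC 0) ≤ meanL (psiC 0 * wordCell w f) := by
    refine meanL_mono fun z => ?_
    have h3 := (abs_lt.mp (hM M le_rfl w hw z y)).1
    have h4 := psi_nonneg 0 z
    simp only [ContinuousMap.smul_apply, ContinuousMap.mul_apply, psiC_apply, wordCell_apply,
      smul_eq_mul]
    nlinarith
  rw [h1, map_smul, meanL_psiC, smul_eq_mul] at h2
  linarith

/-- Green's operator is strictly positive. -/
theorem greenForm_pos {f : C(gasket, ℝ)} (hf : f ≠ 0) : 0 < greenForm f := by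
  refine lt_of_le_of_ne (greenForm_nonneg f) fun h => hf ?_
  have h1 := le_zero_of_greenForm h.symm
  have hneg : greenForm (-f) = 0 := by
    unfold greenForm at h ⊢
    rw [map_neg, neg_mul_neg, ← h]
  have h2 := le_zero_of_greenForm hneg
  ext x
  exact le_antisymm (h1 x) (by simpa using h2 x)

/-! ### Explicit integrals -/

theorem greenForm_one : greenForm 1 = 1 / 18 := by
  have h := greenForm_eq 1
  have hc : ∀ i, cell i 1 = 1 := fun _ => rfl
  simp only [hc, mul_one, meanL_psiC] at h
  linarith

theorem meanL_greenOp_one : meanL (greenOp 1) = 1 / 18 := by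
  have := greenForm_one
  rwa [greenForm, mul_one] at this

theorem meanL_psiC_hC (k a : Fin 3) :
    meanL (psiC k * hC a) = if k = a then 2 / 45 else 4 / 45 := by
  obtain ⟨⟨h00, h10, h20⟩, ⟨h01, h11, h21⟩, ⟨h02, h12, h22⟩⟩ := cell_hC_values
  obtain ⟨⟨p00, p10, p20⟩, ⟨p01, p11, p21⟩, ⟨p02, p12, p22⟩⟩ := cell_psiC_values
  have m01 := meanL_hC_mul (show (0 : Fin 3) ≠ 1 by decide)
  have m02 := meanL_hC_mul (show (0 : Fin 3) ≠ 2 by decide)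
  have m10 := meanL_hC_mul (show (1 : Fin 3) ≠ 0 by decide)
  have m12 := meanL_hC_mul (show (1 : Fin 3) ≠ 2 by decide)
  have m20 := meanL_hC_mul (show (2 : Fin 3) ≠ 0 by decide)
  have m21 := meanL_hC_mul (show (2 : Fin 3) ≠ 1 by decide)
  rw [meanL_eq]
  fin_cases k <;> fin_cases a <;>
    simp only [Fin.zero_eta, Fin.mk_one, Fin.reduceFinMk, cell_mul, p00, p10, p20, p01, p11, p21,
      p02, p12, p22, h00, h10, h20, h01, h11, h21, h02, h12, h22, zero_mul, mul_add,
      mul_smul_comm, map_add, map_smul, map_zero, smul_eq_mul, meanL_hC_sq, m01, m02, m10, m12,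
      m20, m21] <;> norm_num <;> decide

theorem meanL_greenOp_one_hC (a : Fin 3) : meanL (greenOp 1 * hC a) = 1 / 54 := by
  obtain ⟨⟨h00, h10, h20⟩, ⟨h01, h11, h21⟩, ⟨h02, h12, h22⟩⟩ := cell_hC_values
  have hc : ∀ i, cell i 1 = 1 := fun _ => rfl
  have e0 := meanL_greenOp_mul 1 (hC 0)
  have e1 := meanL_greenOp_mul 1 (hC 1)
  have e2 := meanL_greenOp_mul 1 (hC 2)
  have n02 : (0 : Fin 3) ≠ 2 := by decide
  have n12 : (1 : Fin 3) ≠ 2 := by decide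
  simp only [hc, nodeValue_one, meanL_psiC_hC, n02, n12, n02.symm, n12.symm, if_false, h00, h10,
    h20, h01, h11, h21, h02, h12, h22, mul_add, mul_smul_comm, map_add, map_smul, smul_eq_mul]
    at e0 e1 e2
  norm_num at e0 e1 e2
  fin_cases a <;> simp only [Fin.zero_eta, Fin.mk_one, Fin.reduceFinMk] <;>
    linarith only [e0, e1, e2]

/-- The harmonic function `hb n` minus its mean. -/
def hTilde (n : Fin 3) : C(gasket, ℝ) := hC n - (1 / 3 : ℝ) • 1

theorem meanL_hTilde (n : Fin 3) : meanL (hTilde n) = 0 := by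
  rw [hTilde, map_sub, map_smul, meanL_hC, meanL_one]; norm_num

theorem meanL_hTilde_sq (n : Fin 3) : meanL (hTilde n * hTilde n) = 2 / 45 := by
  simp only [hTilde, sub_mul, mul_sub, smul_mul_assoc, mul_smul_comm, map_sub, map_smul, mul_one,
    one_mul, meanL_hC, meanL_hC_sq, meanL_one, smul_eq_mul]
  norm_num

theorem meanL_greenOp_one_hTilde (n : Fin 3) : meanL (greenOp 1 * hTilde n) = 0 := by
  simp only [hTilde, mul_sub, mul_smul_comm, map_sub, map_smul, mul_one, meanL_greenOp_one_hC,
    meanL_greenOp_one, smul_eq_mul]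
  norm_num

/-- The leading term of `greenForm_eq` is computed, and Schur's test is applied on the cells; the
bound is the one that `prodL_neumannKernel_sq` needs. -/
theorem greenForm_hTilde_le (n : Fin 3) : greenForm (hTilde n) ≤ 1 / 324 - 1 / 2025 := by
  have h := greenForm_eq (hTilde n)
  have b0 := (abs_le.mp (abs_greenForm_le (cell 0 (hTilde n)))).2
  have b1 := (abs_le.mp (abs_greenForm_le (cell 1 (hTilde n)))).2
  have b2 := (abs_le.mp (abs_greenForm_le (cell 2 (hTilde n)))).2
  have hs := meanL_sq_cells (hTilde n)
  rw [meanL_hTilde_sq] at hs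
  have hI : ∀ k, meanL (psiC k * hTilde n) = if k = n then -4 / 135 else 2 / 135 := by
    intro k
    simp only [hTilde, mul_sub, mul_smul_comm, map_sub, map_smul, mul_one, meanL_psiC,
      meanL_psiC_hC, smul_eq_mul]
    split_ifs <;> norm_num
  have hv : 3 / 50 * ((meanL (psiC 0 * hTilde n) + meanL (psiC 1 * hTilde n) +
      meanL (psiC 2 * hTilde n)) ^ 2 + 2 * (meanL (psiC 0 * hTilde n) ^ 2 +
      meanL (psiC 1 * hTilde n) ^ 2 + meanL (psiC 2 * hTilde n) ^ 2)) =
      8 / 50625 := by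
    rw [hI, hI, hI]
    fin_cases n <;> simp <;> norm_num
  rw [hv] at h
  linarith

theorem prodL_grP_self : prodL grP = 1 / 18 := by
  have := prodL_grP 1 1
  rwa [fstC_one, sndC_one, mul_one, mul_one, mul_one, meanL_greenOp_one] at this

/-- The kernel `G` has mean `1 / 18`, and its norm is at least its mean. -/
theorem le_greenNorm_sq : 1 / 324 ≤ greenNorm ^ 2 := by
  have h0 := prodL_mono (f := 0) (g := (grP - (1 / 18 : ℝ) • 1) * (grP - (1 / 18 : ℝ) • 1))
    fun z => mul_self_nonneg _
  simp only [sub_mul, mul_sub, smul_mul_assoc, mul_smul_comm, map_sub, map_smul, mul_one, one_mul,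
    map_zero, prodL_one, prodL_grP_self, smul_eq_mul] at h0
  rw [greenNorm_sq]
  linarith

/-- The kernel `G(x, y) + h(x) h(y) / 2 - 1 / 18`, with `h = hTilde n`. -/
def neumannKernel (n : Fin 3) : C(gasket × gasket, ℝ) :=
  grP + (1 / 2 : ℝ) • (fstC (hTilde n) * sndC (hTilde n)) - (1 / 18 : ℝ) • 1

theorem prodL_neumannKernel_sq (n : Fin 3) :
    prodL (neumannKernel n * neumannKernel n) ≤ greenNorm ^ 2 := by
  have h2 : prodL (grP * (fstC (hTilde n) * sndC (hTilde n))) = greenForm (hTilde n) :=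
    prodL_grP _ _
  have h3 : prodL (fstC (hTilde n) * sndC (hTilde n)) = 0 := by
    rw [prodL_tensor, meanL_hTilde, zero_mul]
  set T := fstC (hTilde n) * sndC (hTilde n) with hT
  have h4 : prodL (T * T) = 4 / 2025 := by
    have : T * T = fstC (hTilde n * hTilde n) * sndC (hTilde n * hTilde n) := by
      ext z
      simp only [hT, ContinuousMap.mul_apply, fstC_apply, sndC_apply]
      ring
    rw [this, prodL_tensor, meanL_hTilde_sq]
    norm_num
  have h5 := greenForm_hTilde_le n
  rw [neumannKernel, ← hT]
  simp only [sub_mul, mul_sub, add_mul, mul_add, smul_mul_assoc, mul_smul_comm, map_sub, map_add,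
    map_smul, mul_one, one_mul, prodL_one, prodL_grP_self, h3, h4, mul_comm T grP, h2, smul_eq_mul,
    ← greenNorm_sq]
  linarith

/-! ### The norms of successive orthogonal polynomials -/

theorem hasNormalDeriv_greenOp (n : Fin 3) (f : C(gasket, ℝ)) :
    HasNormalDeriv (greenOp f) n (-meanL (hC n * f)) := by
  have hbd : ∀ m, |meanL (hC n * (cell n)^[m] f)| ≤ ‖f‖ := by
    intro m
    have hle : ∀ x, |(hC n * (cell n)^[m] f) x| ≤ ‖f‖ := by
      intro x
      have h1 : hb n x ≤ 1 := (harm_bounds (A := 0) (fun j => by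
        simp only [Pi.single_apply]; split_ifs <;> norm_num) x).2
      rw [ContinuousMap.mul_apply, iterate_cell_apply, abs_mul, hC_apply,
        abs_of_nonneg (hb_nonneg n x)]
      have h2 := f.norm_coe_le_norm ((F n)^[m] x)
      rw [Real.norm_eq_abs] at h2
      exact (mul_le_of_le_one_left (abs_nonneg _) h1).trans h2
    rw [abs_le]
    constructor
    · have := meanL_mono (f := (-‖f‖) • 1) (g := hC n * (cell n)^[m] f)
        fun x => by simpa using (abs_le.mp (hle x)).1
      simpa [map_smul, meanL_one] using this
    · have := meanL_mono (g := ‖f‖ • 1) (f := hC n * (cell n)^[m] f)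
        fun x => by simpa using (abs_le.mp (hle x)).2
      simpa [map_smul, meanL_one] using this
  have hlim : Tendsto (fun m : ℕ => (1 / 3 : ℝ) ^ m * meanL (hC n * (cell n)^[m] f)) atTop
      (𝓝 0) := by
    refine squeeze_zero_norm (a := fun m : ℕ => (1 / 3 : ℝ) ^ m * ‖f‖) (fun m => ?_) ?_
    · rw [norm_mul, Real.norm_of_nonneg (by positivity), Real.norm_eq_abs]
      exact mul_le_mul_of_nonneg_left (hbd m) (by positivity)
    · have := (tendsto_pow_atTop_nhds_zero_of_lt_one (r := (1 / 3 : ℝ)) (by norm_num)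
        (by norm_num)).mul_const ‖f‖
      rwa [zero_mul] at this
  have h2 := (tendsto_const_nhds (x := -meanL (hC n * f))).add hlim
  rw [add_zero] at h2
  refine h2.congr fun m => ?_
  have h := nd_greenOp m n f
  unfold nd at h
  rw [h, mul_add, mul_neg, ← mul_assoc, ← mul_assoc, ← mul_pow, ← mul_pow]
  norm_num

section

variable {n : Fin 3} {i : ℕ}

theorem mono_one_zero : mono n 1 0 = 1 := by
  ext x
  change harm (bvals n 1) x = 1
  have : bvals n 1 = fun _ => 1 := by funext j; simp [bvals]
  rw [this, harm_const]

/-- For `i = 2, 3` the antiderivative of `p_k` with zero boundary values differs from the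
normalized one by a multiple of `P_{0i}^{(n)}`. -/
theorem norm_succ_le_of_ne_one (hi : i = 2 ∨ i = 3) (k : ℕ) :
    meanL (gsC (mono n i) (k + 1) * gsC (mono n i) (k + 1)) ≤
      greenNorm ^ 2 * meanL (gsC (mono n i) k * gsC (mono n i) k) := by
  obtain ⟨v, hv, hL, hN⟩ := exists_antideriv (n := n) (i := i) (Or.inr hi) k
  set g := gsC (mono n i) k
  have e := hL.eq_greenOp
  set c : Fin 3 → ℝ := fun a => v (q a) with hc
  obtain ⟨r, hr⟩ : ∃ r : ℝ, harm c = r • ⇑(mono n i 0) := by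
    have h : ∀ n : Fin 3, n + 1 ≠ n ∧ n - 1 ≠ n ∧ n - 1 ≠ n + 1 := by decide
    obtain ⟨h1, h2, h3⟩ := h n
    have c0 : c n = 0 := hN.value
    have c1 : c (n - 1) = parity i * c (n + 1) := hN.symm
    rcases hi with rfl | rfl
    · refine ⟨-2 * c (n + 1), ?_⟩
      change harm c = (-2 * c (n + 1)) • harm (bvals n 2)
      rw [← harm_smul]
      congr 1
      funext a
      rcases cases_of_fin n a with rfl | rfl | rfl
      · simp [bvals, c0]
      · simp [bvals, h1]; ring
      · simp [bvals, h2, c1, parity]; ring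
    · refine ⟨2 * c (n + 1), ?_⟩
      change harm c = (2 * c (n + 1)) • harm (bvals n 3)
      rw [← harm_smul]
      congr 1
      funext a
      rcases cases_of_fin n a with rfl | rfl | rfl
      · simp [bvals, c0]
      · simp [bvals, h1]; ring
      · simp [bvals, h2, h3, c1, parity]; ring
  have hvC : v = r • mono n i 0 - greenOp g := by
    apply DFunLike.coe_injective
    rw [e, hr]; rfl
  have hmem : -greenOp g - mono n i (k + 1) ∈ spanBelow (mono n i) (k + 1) := by
    have := Submodule.sub_mem _ hv (Submodule.smul_mem _ r
      (mem_spanBelow (mono n i) (Nat.succ_pos k)))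
    have e2 : v - mono n i (k + 1) - r • mono n i 0 = -greenOp g - mono n i (k + 1) := by
      rw [hvC]; abel
    rwa [e2] at this
  have h1 := gsC_minimal (mono n i) hmem
  rw [neg_mul_neg] at h1
  exact h1.trans (greenOp_bound g)

/-- For `i = 1` the boundary condition at `q_n` is a Neumann condition, and the antiderivative of
`p_k` is, up to a constant, given by Green's function plus a rank one kernel. -/
theorem antideriv_mem_of_eq_one (k : ℕ) : let g := gsC (mono n 1) k
    ∀ r : ℝ, -(greenOp g + (1 / 2 * meanL (hC n * g)) • hTilde n - r • 1) - mono n 1 (k + 1) ∈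
      spanBelow (mono n 1) (k + 1) := by
  intro g r
  obtain ⟨v, hv, hL, hN⟩ := exists_antideriv (n := n) (i := 1) (Or.inl rfl) k
  have e := hL.eq_greenOp
  set c : Fin 3 → ℝ := fun a => v (q a) with hc
  have c0 : c n = 0 := hN.value
  have c1 : c (n - 1) = c (n + 1) := by
    have := hN.symm
    simpa [parity] using this
  have hnd := hN.normalDeriv
  rw [e] at hnd
  have ha := tendsto_nhds_unique hnd
    ((hasNormalDeriv_harm c n).sub (hasNormalDeriv_greenOp n (gsC (mono n 1) k)))
  rw [c0, c1] at ha
  set a := 1 / 2 * meanL (hC n * g) with ha'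
  have ca : c (n + 1) = a := by rw [ha']; linarith
  have hcC : ∀ x, harm c x = a * (1 - hb n x) := by
    intro x
    have h : c = a • ((fun _ => 1) - Pi.single n 1) := by
      have hne : ∀ n : Fin 3, n + 1 ≠ n ∧ n - 1 ≠ n := by decide
      funext b
      rcases cases_of_fin n b with rfl | rfl | rfl
      · simp [c0]
      · simp [ca, (hne n).1]
      · simp [c1, ca, (hne n).2]
    rw [h, harm_smul, harm_sub, Pi.smul_apply, Pi.sub_apply, harm_const, smul_eq_mul]
    rfl
  have hvC : -(greenOp g + a • hTilde n - r • 1) = v + (r - 2 / 3 * a) • mono n 1 0 := by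
    ext x
    have hx := congrFun e x
    rw [Pi.sub_apply, hcC] at hx
    simp only [mono_one_zero, hTilde, ContinuousMap.neg_apply, ContinuousMap.sub_apply,
      ContinuousMap.add_apply, ContinuousMap.smul_apply, ContinuousMap.one_apply, hC_apply,
      smul_eq_mul, hx]
    ring
  have e2 : v + (r - 2 / 3 * a) • mono n 1 0 - mono n 1 (k + 1) =
      v - mono n 1 (k + 1) + (r - 2 / 3 * a) • mono n 1 0 := by abel
  rw [hvC, e2]
  exact Submodule.add_mem _ hv (Submodule.smul_mem _ _ (mem_spanBelow _ (Nat.succ_pos k)))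

/-- Here `p_0 = 1`, and the antiderivative can be normalized to have mean zero. -/
theorem norm_one_le_of_eq_one : meanL (gsC (mono n 1) 1 * gsC (mono n 1) 1) ≤
    greenNorm ^ 2 * meanL (gsC (mono n 1) 0 * gsC (mono n 1) 0) := by
  have hg : gsC (mono n 1) 0 = 1 := by rw [gsC_eq, mono_one_zero]; simp
  -- `1 / 18` is the mean of `greenOp 1`, and `hTilde n` has mean zero.
  have hmem := antideriv_mem_of_eq_one (n := n) 0 (1 / 18)
  have h1 := gsC_minimal (mono n 1) hmem
  rw [neg_mul_neg, hg, mul_one, meanL_hC] at h1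
  have hsq : meanL (greenOp 1 * greenOp 1) ≤ 1 / 12 * (1 / 18) := by
    have := meanL_mono (f := greenOp 1 * greenOp 1) (g := (1 / 12 : ℝ) • greenOp 1) fun x => by
      simp only [ContinuousMap.mul_apply, ContinuousMap.smul_apply, smul_eq_mul]
      exact mul_le_mul_of_nonneg_right (greenOp_one_le x)
        (greenOp_nonneg (fun _ => zero_le_one) x)
    rwa [map_smul, meanL_greenOp_one, smul_eq_mul] at this
  simp only [sub_mul, mul_sub, add_mul, mul_add, smul_mul_assoc, mul_smul_comm, map_sub, map_add,
    map_smul, mul_one, one_mul, mul_comm (hTilde n) (greenOp 1), meanL_greenOp_one_hTilde,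
    meanL_hTilde_sq, meanL_hTilde, meanL_greenOp_one, meanL_one, smul_eq_mul] at h1
  rw [hg, mul_one, meanL_one, mul_one]
  have h2 := le_greenNorm_sq
  simp only [zero_add] at h1
  linarith

/-- The antiderivative of `p_{k+1}` is minus its integral against `neumannKernel n`. As `p_{k+1}`
has mean zero, the constant `1 / 18` may be subtracted from the kernel. -/
theorem norm_succ_succ_le_of_eq_one (k : ℕ) :
    meanL (gsC (mono n 1) (k + 2) * gsC (mono n 1) (k + 2)) ≤
      greenNorm ^ 2 * meanL (gsC (mono n 1) (k + 1) * gsC (mono n 1) (k + 1)) := by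
  have hmem := antideriv_mem_of_eq_one (n := n) (k + 1) 0
  set g := gsC (mono n 1) (k + 1) with hgdef
  have hmean : meanL g = 0 := by
    have := gsC_orthogonal_span (mono n 1) (mem_spanBelow (mono n 1) (Nat.succ_pos k))
    rwa [mono_one_zero, mul_one] at this
  have h1 := gsC_minimal (mono n 1) hmem
  rw [neg_mul_neg, zero_smul, sub_zero] at h1
  refine h1.trans ?_
  refine (hilbertSchmidt_bound (neumannKernel n) (f := g) fun x => ?_).trans
    (mul_le_mul_of_nonneg_right (prodL_neumannKernel_sq n) (meanL_sq_nonneg g))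
  have hy : ∀ y, neumannKernel n (x, y) * g y =
      (grC x * g + (1 / 2 * hTilde n x) • (hTilde n * g) - (1 / 18 : ℝ) • g) y := by
    intro y
    simp only [neumannKernel, ContinuousMap.sub_apply, ContinuousMap.add_apply,
      ContinuousMap.smul_apply, ContinuousMap.mul_apply, grP_apply, fstC_apply, sndC_apply,
      ContinuousMap.one_apply, grC_apply, smul_eq_mul]
    ring
  have hmul : meanL (hTilde n * g) = meanL (hC n * g) := by
    rw [hTilde, sub_mul, map_sub, smul_mul_assoc, one_mul, map_smul, hmean, smul_zero, sub_zero]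
  simp only [hy]
  rw [← meanL_apply, map_sub, map_add, map_smul, map_smul, hmean, hmul, ← greenOp_apply]
  simp only [ContinuousMap.add_apply, ContinuousMap.smul_apply, smul_eq_mul]
  ring

theorem norm_succ_le (hi : i = 1 ∨ i = 2 ∨ i = 3) (k : ℕ) :
    meanL (gsC (mono n i) (k + 1) * gsC (mono n i) (k + 1)) ≤
      greenNorm ^ 2 * meanL (gsC (mono n i) k * gsC (mono n i) k) := by
  rcases hi with rfl | hi
  · cases k with
    | zero => exact norm_one_le_of_eq_one
    | succ k => exact norm_succ_succ_le_of_eq_one k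
  · exact norm_succ_le_of_ne_one hi k

theorem p_eq (hi : i = 1 ∨ i = 2 ∨ i = 3) (k : ℕ) : p n i k = gsC (mono n i) k := by
  have : monomial n i = fun j => ⇑(mono n i j) := funext fun j => monomial_eq n hi j
  unfold p
  rw [this]
  rfl

theorem l2norm_p_pos (hi : i = 1 ∨ i = 2 ∨ i = 3) (k : ℕ) : 0 < l2norm (p n i k) := by
  rw [p_eq hi]
  exact l2norm_pos (gsC_mono_ne_zero hi k)

theorem l2norm_p_succ_le (hi : i = 1 ∨ i = 2 ∨ i = 3) (k : ℕ) :
    l2norm (p n i (k + 1)) ≤ greenNorm * l2norm (p n i k) := by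
  rw [p_eq hi, p_eq hi]
  refine le_of_sq_le_sq ?_ (mul_nonneg greenNorm_nonneg (l2norm_nonneg _))
  rw [mul_pow, l2norm_sq, l2norm_sq]
  exact norm_succ_le hi k

theorem b_eq (hi : i = 1 ∨ i = 2 ∨ i = 3) (k : ℕ) : b n i k =
    -(greenForm (gsC (mono n i) k) / meanL (gsC (mono n i) k * gsC (mono n i) k)) := by
  have hf : fNext n i k = ⇑(-greenOp (gsC (mono n i) k)) := by
    funext x
    unfold fNext
    rw [green_eq, p_eq hi]
    rfl
  rw [b, d, hf, p_eq hi, ip_eq, neg_mul, map_neg, inv_pow, l2norm_sq, greenForm]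
  ring

theorem b_bounds (hi : i = 1 ∨ i = 2 ∨ i = 3) (k : ℕ) : -greenNorm ≤ b n i k ∧ b n i k < 0 := by
  have hne := gsC_mono_ne_zero (n := n) hi k
  rw [b_eq hi]
  set g := gsC (mono n i) k
  have hpos := meanL_sq_pos hne
  have hform := greenForm_pos hne
  refine ⟨?_, neg_lt_zero.mpr (div_pos hform hpos)⟩
  rw [neg_le_neg_iff, div_le_iff₀ hpos]
  refine le_of_sq_le_sq ?_ (mul_nonneg greenNorm_nonneg hpos.le)
  have h1 := meanL_cauchySchwarz (greenOp g) g
  have h2 := mul_le_mul_of_nonneg_right (greenOp_bound g) hpos.le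
  unfold greenForm
  calc meanL (greenOp g * g) ^ 2 ≤ _ := h1
    _ ≤ _ := h2
    _ = (greenNorm * meanL (g * g)) ^ 2 := by ring

end

end

end SierpinskiGasket

theorem theorem3p5 (n : Fin 3) (i : ℕ) (hi : i = 1 ∨ i = 2 ∨ i = 3) :
    (∀ k : ℕ, -SierpinskiGasket.greenNorm ≤ SierpinskiGasket.b n i k ∧
      SierpinskiGasket.b n i k < 0) ∧
    (∀ k : ℕ, 1 ≤ k → 0 < SierpinskiGasket.c n i k ∧
      SierpinskiGasket.c n i k ≤ SierpinskiGasket.greenNorm ^ 2) ∧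
    (∀ k : ℕ, (SierpinskiGasket.d n i (k + 1))⁻¹ ≤
      SierpinskiGasket.greenNorm * (SierpinskiGasket.d n i k)⁻¹) ∧
    (∀ k : ℕ, SierpinskiGasket.l2norm (SierpinskiGasket.p n i k) ≤
      SierpinskiGasket.l2norm (SierpinskiGasket.p n i 0) * SierpinskiGasket.greenNorm ^ k) ∧
    SierpinskiGasket.greenNorm < 1 := by
  have hpos := SierpinskiGasket.l2norm_p_pos (n := n) hi
  have hsucc := SierpinskiGasket.l2norm_p_succ_le (n := n) hi
  refine ⟨SierpinskiGasket.b_bounds hi, fun k hk => ?_, fun k => ?_, fun k => ?_,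
    SierpinskiGasket.greenNorm_lt_one⟩
  · obtain ⟨j, rfl⟩ := Nat.exists_eq_add_of_le' hk
    have hc : SierpinskiGasket.c n i (j + 1) =
        (SierpinskiGasket.l2norm (SierpinskiGasket.p n i (j + 1)) /
          SierpinskiGasket.l2norm (SierpinskiGasket.p n i j)) ^ 2 := by
      have h0 := (hpos j).ne'
      have h1 := (hpos (j + 1)).ne'
      simp only [SierpinskiGasket.c, SierpinskiGasket.d, Nat.add_sub_cancel]
      field_simp
    rw [hc]
    refine ⟨pow_pos (div_pos (hpos _) (hpos _)) 2, pow_le_pow_left₀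
      (div_pos (hpos _) (hpos _)).le ?_ 2⟩
    rw [div_le_iff₀ (hpos j)]
    exact hsucc j
  · simpa only [SierpinskiGasket.d, inv_inv] using hsucc k
  · induction k with
    | zero => simp
    | succ k ih =>
      calc _ ≤ _ := hsucc k
        _ ≤ _ := mul_le_mul_of_nonneg_left ih SierpinskiGasket.greenNorm_nonneg
        _ = _ := by ring
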